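/- **Setting.** Let $\Omega\subset\mathbb R^2$ be a bounded open set (for instance a bounded polygonal Lipschitz domain), partitioned as $\Omega=\Omega_1\cup\Omega_2\cup\Gamma^{\mathrm{if}}$ with disjoint open sets $\Omega_1,\Omega_2$ and an interface $\Gamma^{\mathrm{if}}$ disjoint from both. Let $\partial_D\Omega\subset\partial\Omega$, $f\in L^2(\Omega)$, $g\in H^1(\Omega)$, $\Phi\in[H^1(\Omega)]^2$. *Mesh.* Let $k\in\mathbb N$, let $\widehat T$ be the closed reference triangle, and let $\mathcal T_h$ be a finite conforming triangulation of $\Omega$ into elements $T=\psi_T(\widehat T)$ with $\psi_T\in[\mathbb P_k]^2$ injective on $\widehat T$ and $\det D\psi_T\neq0$ on $\widehat T$. Thus $\bigcup_T T=\overline\Omega$, open elements lie in $\Omega$, two distinct elements are disjoint or meet in a common vertex or a common side, and, up to endpoints, sides common to two elements lie in $\Omega$ and all other sides lie in $\partial\Omega$. The mesh resolves $\Gamma^{\mathrm{if}}$ and $\partial_D\Omega$: open elements do not meet $\Gamma^{\mathrm{if}}$, and each side without its endpoints is contained in or disjoint from $\Gamma^{\mathrm{if}}$, and likewise for $\partial_D\Omega$.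 Let $\Gamma_h^0$, $\Gamma_h^{\mathrm b}$, $\Gamma_h^{\mathrm{if}}$ be the unions of the sides contained (up to endpoints) in $\Omega$, $\partial_D\Omega$, $\Gamma^{\mathrm{if}}$, and $\Gamma_h=\Gamma_h^0\cup\Gamma_h^{\mathrm b}$. Let $$\mathbb V_h^k=\{v\in L^2(\Omega): v|_T\circ\psi_T\in\mathbb P_k(\widehat T)\ \text{for all } T\in\mathcal T_h\}.$$ *Jumps and averages.* On an inner side $S=\partial T_+\cap\partial T_-$ with unit normal $\eta$ pointing from $T_+$ into $T_-$ put $[\![v]\!]=v|_{T_-}-v|_{T_+}$ and $\{\!\{v\}\!\}=\frac12(v|_{T_+}+v|_{T_-})$. On a side in $\partial_D\Omega$ let $\eta$ be the outward unit normal and $\{\!\{v\}\!\}=v$. There, jumps depend on boundary data: $[\![v]\!]=g-v$ and $[\![\nabla v]\!]=\Phi-\nabla v$ for data $(g,\Phi)$. We write $\mathbb V_h^k(g,\Phi)$ for $\mathbb V_h^k$ with this interpretation of boundary jumps; in particular $[\![v]\!]=-v$ and $[\![\nabla v]\!]=-\nabla v$ in $\mathbb V_h^k(0,0)$. *The form.*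 Let $\gamma_0,\gamma_1\in\mathbb R$, and let the function $h>0$ on $\Gamma_h$ be locally equivalent to the size of the sides. With all derivatives taken elementwise, $$\begin{aligned}a_h(w,v)={}&\sum_{T\in\mathcal T_h}\int_T D^2w:D^2v\,dx+\langle\{\!\{\partial_\eta\nabla w\}\!\},[\![\nabla v]\!]\rangle_{L^2(\Gamma_h\setminus\Gamma_h^{\mathrm{if}})}+\langle\{\!\{\partial_\eta\nabla v\}\!\},[\![\nabla w]\!]\rangle_{L^2(\Gamma_h\setminus\Gamma_h^{\mathrm{if}})}\\&-\langle\{\!\{\partial_\eta\Delta w\}\!\},[\![v]\!]\rangle_{L^2(\Gamma_h)}-\langle\{\!\{\partial_\eta\Delta v\}\!\},[\![w]\!]\rangle_{L^2(\Gamma_h)}\\&+\gamma_1\langle h^{-1}[\![\nabla w]\!],[\![\nabla v]\!]\rangle_{L^2(\Gamma_h\setminus\Gamma_h^{\mathrm{if}})}+\gamma_0\langle h^{-3}[\![w]\!],[\![v]\!]\rangle_{L^2(\Gamma_h)}.\end{aligned}$$ Let $u_h\in\mathbb V_h^k(g,\Phi)$ solve the discrete problem $a_h(u_h,v_h)=\int_\Omega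 f v_h\,dx$ for all $v_h\in\mathbb V_h^k(0,0)$. *The strong form.* A function $u\in H^4(\Omega_1\cup\Omega_2)\cap H^1(\Omega)$ is a solution of the strong form if $\operatorname{div}\operatorname{div}D^2u=\Delta^2u=f$ a.e. in $\Omega_1\cup\Omega_2$, and, in the sense of traces, * $u=g$ and $\nabla u=\Phi$ on $\partial_D\Omega$; * $\partial_\eta\nabla u=D^2u\,\eta=0$ and $\partial_\eta\Delta u=0$ on $\partial\Omega\setminus\partial_D\Omega$; * $[\![u]\!]=0$, $\partial_\eta\nabla u=0$ (from both sides) and $[\![\partial_\eta\Delta u]\!]=0$ on $\Gamma^{\mathrm{if}}$. **Proposition (Galerkin orthogonality).** If the solution $u$ of the strong form satisfies $u\in H^4(\Omega_1\cup\Omega_2)\cap H^1(\Omega)$, then $$a_h(u-u_h,v_h)=0\qquad\text{for all } v_h\in\mathbb V_h^k(0,0),$$ where the boundary jumps of $u-u_h$ are those for the data $(0,0)$, i.e. $[\![u-u_h]\!]=-(u-u_h)$ and $[\![\nabla(u-u_h)]\!]=-\nabla(u-u_h)$ on $\Gamma_h^{\mathrm b}$. -/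

import Mathlib

open MeasureTheory Filter Topology

noncomputable section

/-! ### Sobolev spaces and traces in the plane -/

/-- The Euclidean plane `ℝ²`. -/
abbrev Plane : Type := EuclideanSpace ℝ (Fin 2)

/-- The coordinate vector `e i`. -/
def basisVec (i : Fin 2) : Plane := EuclideanSpace.single i (1 : ℝ)

/-- `g` is the weak partial derivative `∂_i w` on the open set `U`. -/
def IsWeakPartial (U : Set Plane) (i : Fin 2) (w g : Plane → ℝ) : Prop :=
  LocallyIntegrableOn w U volume ∧ LocallyIntegrableOn g U volume ∧
    ∀ φ : Plane → ℝ, ContDiff ℝ ((⊤ : ℕ∞) : WithTop ℕ∞) φ → HasCompactSupport φ →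
      tsupport φ ⊆ U →
        ∫ x in U, w x * fderiv ℝ φ x (basisVec i) = -∫ x in U, g x * φ x

/-- `w ∈ H^m(U)`: `w` and its weak derivatives up to order `m` are square integrable on `U`. -/
def MemSobolev : ℕ → Set Plane → (Plane → ℝ) → Prop
  | 0, U, w => MemLp w 2 (volume.restrict U)
  | m + 1, U, w => MemLp w 2 (volume.restrict U) ∧
      ∀ i : Fin 2, ∃ g : Plane → ℝ, IsWeakPartial U i w g ∧ MemSobolev m U g

open Classical in
/-- The weak derivative `∂_i w` on `U` (unique up to null sets of `U`), and `0` if there is none. -/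
def weakPartial (U : Set Plane) (i : Fin 2) (w : Plane → ℝ) : Plane → ℝ :=
  if h : ∃ g, IsWeakPartial U i w g then h.choose else 0

/-- The entry `∂_j ∂_i w` of the weak Hessian of `w` on `U`. -/
def weakHess (U : Set Plane) (i j : Fin 2) (w : Plane → ℝ) : Plane → ℝ :=
  weakPartial U j (weakPartial U i w)

/-- The weak Laplacian of `w` on `U`. -/
def weakLaplacian (U : Set Plane) (w : Plane → ℝ) : Plane → ℝ :=
  fun x => ∑ j, weakHess U j j w x

/-- `τ ∈ L²(σ)` is the trace of `w ∈ H¹(U)` on a piece of the boundary of `U` that carries the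
arc length measure `σ`: some functions that are `C¹` up to the boundary converge to `w` in `H¹(U)`,
and their restrictions converge to `τ` in `L²(σ)`. -/
def HasTrace (U : Set Plane) (σ : Measure Plane) (w τ : Plane → ℝ) : Prop :=
  MemLp τ 2 σ ∧ ∃ φ : ℕ → Plane → ℝ,
    (∀ m, ContDiff ℝ 1 (φ m)) ∧
    Tendsto (fun m => eLpNorm (fun x => φ m x - w x) 2 (volume.restrict U)) atTop (𝓝 0) ∧
    (∀ i : Fin 2, Tendsto (fun m =>
      eLpNorm (fun x => fderiv ℝ (φ m) x (basisVec i) - weakPartial U i w x) 2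
        (volume.restrict U)) atTop (𝓝 0)) ∧
    Tendsto (fun m => eLpNorm (fun x => φ m x - τ x) 2 σ) atTop (𝓝 0)

open Classical in
/-- The trace of `w` (unique `σ`-almost everywhere), and `0` if there is none. -/
def trace (U : Set Plane) (σ : Measure Plane) (w : Plane → ℝ) : Plane → ℝ :=
  if h : ∃ τ, HasTrace U σ w τ then h.choose else 0

/-! ### The folded plate -/

/-- A bounded open set `Ω`, split by an interface `Γ` into open sets `Ω₁` and `Ω₂`, with a part
`D` of the boundary on which clamped boundary conditions are imposed. -/
structure FoldedPlate where
  Ω : Set Plane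
  Ω₁ : Set Plane
  Ω₂ : Set Plane
  Γ : Set Plane
  D : Set Plane
  isOpen_Ω : IsOpen Ω
  bounded_Ω : Bornology.IsBounded Ω
  isOpen_Ω₁ : IsOpen Ω₁
  isOpen_Ω₂ : IsOpen Ω₂
  disjoint_Ω₁_Ω₂ : Disjoint Ω₁ Ω₂
  disjoint_Γ : Disjoint (Ω₁ ∪ Ω₂) Γ
  partition : Ω = Ω₁ ∪ Ω₂ ∪ Γ
  D_subset : D ⊆ frontier Ω

/-! ### Isoparametric elements -/

/-- The closed reference triangle. -/
def refTriangle : Set Plane := {x | 0 ≤ x 0 ∧ 0 ≤ x 1 ∧ x 0 + x 1 ≤ 1}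

/-- The open reference triangle. -/
def refOpenTriangle : Set Plane := {x | 0 < x 0 ∧ 0 < x 1 ∧ x 0 + x 1 < 1}

/-- The vertices of the reference triangle. -/
def refVertex : Fin 3 → Plane
  | 0 => !₂[0, 0]
  | 1 => !₂[1, 0]
  | 2 => !₂[0, 1]

/-- The parametrization over `[0,1]` of the reference side from vertex `j` to vertex `j + 1`. -/
def refSide (j : Fin 3) (t : ℝ) : Plane := (1 - t) • refVertex j + t • refVertex (j + 1)

/-- A vector (of any positive length) that is normal to the reference side `j` and points out of
the reference triangle. -/
def refNormal : Fin 3 → Fin 2 → ℝ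
  | 0 => ![0, -1]
  | 1 => ![1, 1]
  | 2 => ![-1, 0]

/-- A pair of polynomials in two variables. -/
abbrev PolyPair : Type := Fin 2 → MvPolynomial (Fin 2) ℝ

/-- The polynomial map `ψ` of the plane given by a pair of polynomials. -/
def polyMap (p : PolyPair) (x : Plane) : Plane :=
  WithLp.toLp 2 fun i => MvPolynomial.eval (fun j => x j) (p i)

/-- The Jacobian matrix `Dψ`. -/
def polyJacobian (p : PolyPair) (x : Plane) : Matrix (Fin 2) (Fin 2) ℝ :=
  Matrix.of fun i j => MvPolynomial.eval (fun l => x l) (MvPolynomial.pderiv j (p i))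

/-- `ψ` is a diffeomorphism of the closed reference triangle onto its image. -/
def IsElementMap (p : PolyPair) : Prop :=
  Set.InjOn (polyMap p) refTriangle ∧ ∀ x ∈ refTriangle, (polyJacobian p x).det ≠ 0

/-- The closed element `T = ψ(T̂)`. -/
def element (p : PolyPair) : Set Plane := polyMap p '' refTriangle

/-- The open element. -/
def openElement (p : PolyPair) : Set Plane := polyMap p '' refOpenTriangle

/-- The side `j` of the element, with its endpoints. -/
def side (p : PolyPair) (j : Fin 3) : Set Plane :=
  (fun t => polyMap p (refSide j t)) '' Set.Icc (0 : ℝ) 1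

/-- The side `j` of the element, without its endpoints. -/
def openSide (p : PolyPair) (j : Fin 3) : Set Plane :=
  (fun t => polyMap p (refSide j t)) '' Set.Ioo (0 : ℝ) 1

/-- The arc length measure on the side `j` of the element. -/
def sideMeasure (p : PolyPair) (j : Fin 3) : Measure Plane :=
  Measure.map (fun t => polyMap p (refSide j t))
    ((volume.restrict (Set.Icc (0 : ℝ) 1)).withDensity fun t =>
      ENNReal.ofReal ‖deriv (fun s => polyMap p (refSide j s)) t‖)

/-- The unit normal at the point `x` of the side `j` that points out of the element, that is,
`Dψ^{-T} η̂ / |Dψ^{-T} η̂|` at the point `ψ⁻¹(x)` of the reference triangle. -/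
def sideNormal (p : PolyPair) (j : Fin 3) (x : Plane) : Plane :=
  let v : Plane := WithLp.toLp 2 (Matrix.mulVec
    ((polyJacobian p (Function.invFunOn (polyMap p) refTriangle x))⁻¹).transpose (refNormal j))
  ‖v‖⁻¹ • v

/-! ### Traces on the sides of an element -/

/-- A side of an element: the elemental map and the number of the side. -/
abbrev ElemSide : Type := PolyPair × Fin 3

namespace ElemSide

/-- The open element to which a side belongs. -/
def elem (s : ElemSide) : Set Plane := openElement s.1

/-- Arc length on a side. -/
def len (s : ElemSide) : Measure Plane := sideMeasure s.1 s.2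

/-- The side with its endpoints. -/
def closedSet (s : ElemSide) : Set Plane := side s.1 s.2

/-- The side without its endpoints. -/
def openSet (s : ElemSide) : Set Plane := openSide s.1 s.2

/-- The unit normal on a side that points out of its element. -/
def normal (s : ElemSide) (x : Plane) : Plane := sideNormal s.1 s.2 x

/-- `w|_T` on the side `s` of the element `T`. -/
def tr (s : ElemSide) (w : Plane → ℝ) : Plane → ℝ := trace s.elem s.len w

/-- The component `i` of `∇(w|_T)` on the side `s` of the element `T`. -/
def trGrad (s : ElemSide) (i : Fin 2) (w : Plane → ℝ) : Plane → ℝ :=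
  s.tr (weakPartial s.elem i w)

/-- The component `i` of `∂_η ∇(w|_T) = D²(w|_T) η` on the side `s` of the element `T`. -/
def trHessNormal (s : ElemSide) (η : Plane → Plane) (i : Fin 2) (w : Plane → ℝ) : Plane → ℝ :=
  fun x => ∑ j, s.tr (weakHess s.elem i j w) x * η x j

/-- `∂_η Δ(w|_T)` on the side `s` of the element `T`. -/
def trLapNormal (s : ElemSide) (η : Plane → Plane) (w : Plane → ℝ) : Plane → ℝ :=
  fun x => ∑ i, s.tr (weakPartial s.elem i (weakLaplacian s.elem w)) x * η x i

/-- The inner product of `L²` on a side. -/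
def inner (s : ElemSide) (p q : Plane → ℝ) : ℝ := ∫ x, p x * q x ∂s.len

end ElemSide

/-! ### The strong form -/

namespace FoldedPlate

/-- `s` is a side of a (curved) triangle in `Ω \ Γ`. Such triangles are used to express boundary
and interface conditions through the traces from one side of a piecewise polynomial curve. -/
def IsSideIn (P : FoldedPlate) (s : ElemSide) : Prop :=
  IsElementMap s.1 ∧ s.elem ⊆ P.Ω₁ ∪ P.Ω₂

/-- `u` solves the strong form of the folding problem: the equation on both sides of the
interface, the clamped conditions on `D`, and the natural boundary and interface conditions. -/
structure IsStrongSolution (P : FoldedPlate) (f g : Plane → ℝ) (Φ : Fin 2 → Plane → ℝ)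
    (u : Plane → ℝ) : Prop where
  /-- `Δ²u = f` -/
  equation : ∀ᵐ x ∂(volume.restrict (P.Ω₁ ∪ P.Ω₂)),
    weakLaplacian (P.Ω₁ ∪ P.Ω₂) (weakLaplacian (P.Ω₁ ∪ P.Ω₂) u) x = f x
  /-- `u = g` on `D` -/
  clamped_value : ∀ s, P.IsSideIn s → s.openSet ⊆ P.D →
    ∀ᵐ x ∂s.len, s.tr u x = s.tr g x
  /-- `∇u = Φ` on `D` -/
  clamped_grad : ∀ s, P.IsSideIn s → s.openSet ⊆ P.D →
    ∀ i, ∀ᵐ x ∂s.len, s.trGrad i u x = s.tr (Φ i) x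
  /-- `∂_η ∇u = 0` on `∂Ω \ D` -/
  natural_hess : ∀ s, P.IsSideIn s → s.openSet ⊆ frontier P.Ω \ P.D →
    ∀ i, ∀ᵐ x ∂s.len, s.trHessNormal s.normal i u x = 0
  /-- `∂_η Δu = 0` on `∂Ω \ D` -/
  natural_lap : ∀ s, P.IsSideIn s → s.openSet ⊆ frontier P.Ω \ P.D →
    ∀ᵐ x ∂s.len, s.trLapNormal s.normal u x = 0
  /-- `⟦u⟧ = 0` on `Γ` -/
  interface_value : ∀ s t, P.IsSideIn s → P.IsSideIn t → Disjoint s.elem t.elem →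
    s.closedSet = t.closedSet → s.openSet ⊆ P.Γ →
      ∀ᵐ x ∂s.len, t.tr u x - s.tr u x = 0
  /-- `∂_η ∇u = 0` on `Γ`, from either side -/
  interface_hess : ∀ s, P.IsSideIn s → s.openSet ⊆ P.Γ →
    ∀ i, ∀ᵐ x ∂s.len, s.trHessNormal s.normal i u x = 0
  /-- `⟦∂_η Δu⟧ = 0` on `Γ` -/
  interface_lap : ∀ s t, P.IsSideIn s → P.IsSideIn t → Disjoint s.elem t.elem →
    s.closedSet = t.closedSet → s.openSet ⊆ P.Γ →
      ∀ᵐ x ∂s.len, t.trLapNormal s.normal u x - s.trLapNormal s.normal u x = 0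

end FoldedPlate

/-! ### Triangulations -/

/-- A conforming isoparametric triangulation of `Ω` of degree `k`, given by numbered elements, that
resolves the interface `Γ` and the clamped part `D` of the boundary. -/
structure IsoMesh (k : ℕ) (P : FoldedPlate) where
  /-- the number of elements -/
  n : ℕ
  /-- the elemental maps `ψ_T` -/
  ψ : Fin n → PolyPair
  degree_le : ∀ T i, (ψ T i).totalDegree ≤ k
  isElementMap : ∀ T, IsElementMap (ψ T)
  cover : ⋃ T, element (ψ T) = closure P.Ω
  openElement_subset : ∀ T, openElement (ψ T) ⊆ P.Ω
  /-- two elements are disjoint or meet in a common vertex or in a common side -/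
  conforming : ∀ T T', T ≠ T' →
    Disjoint (element (ψ T)) (element (ψ T')) ∨
    (∃ i j, polyMap (ψ T) (refVertex i) = polyMap (ψ T') (refVertex j) ∧
      element (ψ T) ∩ element (ψ T') = {polyMap (ψ T) (refVertex i)}) ∨
    (∃ i j, side (ψ T) i = side (ψ T') j ∧
      element (ψ T) ∩ element (ψ T') = side (ψ T) i)
  /-- common sides of two elements are contained in `Ω`, up to endpoints -/
  interior_side : ∀ T T' i j, T ≠ T' → side (ψ T) i = side (ψ T') j → openSide (ψ T) i ⊆ P.Ω
  /-- the other sides are contained in the boundary of `Ω` -/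
  boundary_side : ∀ T i, (∀ T' j, T ≠ T' → side (ψ T) i ≠ side (ψ T') j) →
    openSide (ψ T) i ⊆ frontier P.Ω
  /-- the interface consists of sides -/
  openElement_disjoint_Γ : ∀ T, Disjoint (openElement (ψ T)) P.Γ
  side_Γ : ∀ T i, openSide (ψ T) i ⊆ P.Γ ∨ Disjoint (openSide (ψ T) i) P.Γ
  /-- the clamped part of the boundary consists of sides -/
  side_D : ∀ T i, openSide (ψ T) i ⊆ P.D ∨ Disjoint (openSide (ψ T) i) P.D

namespace IsoMesh

variable {k : ℕ} {P : FoldedPlate} (M : IsoMesh k P)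

/-- The discrete space `V_h^k`. -/
def discreteSpace : Set (Plane → ℝ) :=
  {v | ∀ T, ∃ q : MvPolynomial (Fin 2) ℝ, q.totalDegree ≤ k ∧
    ∀ᵐ x ∂(volume.restrict refTriangle),
      v (polyMap (M.ψ T) x) = MvPolynomial.eval (fun j => x j) q}

/-- An element of the mesh together with the number of one of its three sides. -/
abbrev Side : Type := Fin M.n × Fin 3

/-- The side of the element with the given number. -/
def el (s : M.Side) : ElemSide := (M.ψ s.1, s.2)

/-- A side shared by the elements `T₊` (first) and `T₋` (second). -/
abbrev SidePair : Type := M.Side × M.Side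

open Classical in
/-- The inner sides. The element with the smaller number is `T₊`, and the normal is the one that
points from `T₊` into `T₋`. Interchanging `T₊` and `T₋` changes the signs of the normal and of all
jumps, so that the form `a_h` does not depend on the numbering. -/
def innerSides : Finset M.SidePair :=
  Finset.univ.filter fun e =>
    e.1.1 < e.2.1 ∧ (M.el e.1).closedSet = (M.el e.2).closedSet

open Classical in
/-- The inner sides contained in the interface, up to endpoints. -/
def interfaceSides : Finset M.SidePair :=
  M.innerSides.filter fun e => (M.el e.1).openSet ⊆ P.Γ

open Classical in
/-- The sides contained in the clamped part of the boundary, up to endpoints. -/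
def clampedSides : Finset M.Side :=
  Finset.univ.filter fun s => (M.el s).openSet ⊆ P.D

end IsoMesh

/-! ### The interior penalty form -/

/-- The jump across an inner side, `T₋` minus `T₊`, of a quantity `q` defined on both sides. -/
def sideJump (q : ElemSide → Plane → ℝ) (s t : ElemSide) : Plane → ℝ :=
  fun x => q t x - q s x

/-- The average on an inner side of a quantity `q` defined on both sides. -/
def sideAverage (q : ElemSide → Plane → ℝ) (s t : ElemSide) : Plane → ℝ :=
  fun x => (q s x + q t x) / 2

/-- The jump on a clamped boundary side of a quantity `q` with prescribed value `b`. -/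
def bdJump (b q : ElemSide → Plane → ℝ) (s : ElemSide) : Plane → ℝ :=
  fun x => b s x - q s x

/-- Boundary data `(g, Φ)` for a function and its gradient. -/
abbrev BdData : Type := (Plane → ℝ) × (Fin 2 → Plane → ℝ)

/-- The contribution of an inner side (`s` in `T₊` and `t` in `T₋`) to the terms of the form that
contain jumps of gradients. -/
def innerGradTerm (γ₁ : ℝ) (h : Plane → ℝ) (w v : Plane → ℝ) (s t : ElemSide) : ℝ :=
  ∑ i, (s.inner (sideAverage (·.trHessNormal s.normal i w) s t) (sideJump (·.trGrad i v) s t)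
      + s.inner (sideAverage (·.trHessNormal s.normal i v) s t) (sideJump (·.trGrad i w) s t)
      + γ₁ * s.inner (fun x => (h x)⁻¹ * sideJump (·.trGrad i w) s t x) (sideJump (·.trGrad i v) s t))

/-- The contribution of an inner side (`s` in `T₊` and `t` in `T₋`) to the terms of the form that
contain jumps of functions. -/
def innerValueTerm (γ₀ : ℝ) (h : Plane → ℝ) (w v : Plane → ℝ) (s t : ElemSide) : ℝ :=
  - s.inner (sideAverage (·.trLapNormal s.normal w) s t) (sideJump (·.tr v) s t)
  - s.inner (sideAverage (·.trLapNormal s.normal v) s t) (sideJump (·.tr w) s t)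
  + γ₀ * s.inner (fun x => (h x ^ 3)⁻¹ * sideJump (·.tr w) s t x) (sideJump (·.tr v) s t)

/-- The contribution of a clamped boundary side to the terms of the form that contain jumps of
gradients, where `w` has boundary data `a` and `v` has boundary data `b`. -/
def bdGradTerm (γ₁ : ℝ) (h : Plane → ℝ) (a : BdData) (w : Plane → ℝ) (b : BdData)
    (v : Plane → ℝ) (s : ElemSide) : ℝ :=
  ∑ i, (s.inner (s.trHessNormal s.normal i w) (bdJump (·.tr (b.2 i)) (·.trGrad i v) s)
      + s.inner (s.trHessNormal s.normal i v) (bdJump (·.tr (a.2 i)) (·.trGrad i w) s)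
      + γ₁ * s.inner (fun x => (h x)⁻¹ * bdJump (·.tr (a.2 i)) (·.trGrad i w) s x)
        (bdJump (·.tr (b.2 i)) (·.trGrad i v) s))

/-- The contribution of a clamped boundary side to the terms of the form that contain jumps of
functions, where `w` has boundary data `a` and `v` has boundary data `b`. -/
def bdValueTerm (γ₀ : ℝ) (h : Plane → ℝ) (a : BdData) (w : Plane → ℝ) (b : BdData)
    (v : Plane → ℝ) (s : ElemSide) : ℝ :=
  - s.inner (s.trLapNormal s.normal w) (bdJump (·.tr b.1) (·.tr v) s)
  - s.inner (s.trLapNormal s.normal v) (bdJump (·.tr a.1) (·.tr w) s)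
  + γ₀ * s.inner (fun x => (h x ^ 3)⁻¹ * bdJump (·.tr a.1) (·.tr w) s x)
        (bdJump (·.tr b.1) (·.tr v) s)

namespace IsoMesh

variable {k : ℕ} {P : FoldedPlate} (M : IsoMesh k P)

open Classical in
/-- The interior penalty form `a_h(w, v)`, where jumps on the clamped boundary are taken with
respect to boundary data `a` for `w` and `b` for `v`. All differential operators are applied
elementwise. For zero data this is the bilinear form `a_h`. -/
def dgForm (γ₀ γ₁ : ℝ) (h : Plane → ℝ) (a : BdData) (w : Plane → ℝ) (b : BdData)
    (v : Plane → ℝ) : ℝ :=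
  (∑ T, ∫ x in openElement (M.ψ T), ∑ i, ∑ j,
      weakHess (openElement (M.ψ T)) i j w x * weakHess (openElement (M.ψ T)) i j v x)
  + ∑ e ∈ M.innerSides \ M.interfaceSides, innerGradTerm γ₁ h w v (M.el e.1) (M.el e.2)
  + ∑ e ∈ M.innerSides, innerValueTerm γ₀ h w v (M.el e.1) (M.el e.2)
  + ∑ s ∈ M.clampedSides, (bdGradTerm γ₁ h a w b v (M.el s) + bdValueTerm γ₀ h a w b v (M.el s))

/-- `h` is locally equivalent to the size of the sides in the skeleton. -/
def IsMeshSize (h : Plane → ℝ) : Prop :=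
  Measurable h ∧ ∃ c C : ℝ, 0 < c ∧ ∀ s : M.Side, (M.el s).openSet ⊆ P.Ω ∨ (M.el s).openSet ⊆ P.D →
    ∀ᵐ x ∂(M.el s).len, c * Metric.diam (M.el s).openSet ≤ h x ∧
      h x ≤ C * Metric.diam (M.el s).openSet

/-- `u_h` solves the discrete problem with right-hand side `f` and boundary data `(g, Φ)`. -/
def IsDiscreteSolution (γ₀ γ₁ : ℝ) (h : Plane → ℝ) (f g : Plane → ℝ) (Φ : Fin 2 → Plane → ℝ)
    (u_h : Plane → ℝ) : Prop :=
  u_h ∈ M.discreteSpace ∧ ∀ v ∈ M.discreteSpace,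
    M.dgForm γ₀ γ₁ h (g, Φ) u_h 0 v = ∫ x in P.Ω, f x * v x

end IsoMesh

end

noncomputable section

/-! ### Weak derivatives -/

theorem MeasureTheory.LocallyIntegrableOn.congr_ae_restrict {U : Set Plane} {f f' : Plane → ℝ}
    (hf : LocallyIntegrableOn f U volume) (h : f =ᵐ[volume.restrict U] f') :
    LocallyIntegrableOn f' U volume := by
  intro x hx
  obtain ⟨t, ht, hft⟩ := hf x hx
  refine ⟨t ∩ U, inter_mem ht self_mem_nhdsWithin, ?_⟩
  exact (hft.mono_set Set.inter_subset_left).congr_fun_ae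
    (ae_restrict_of_ae_restrict_of_subset Set.inter_subset_right h)

theorem MeasureTheory.LocallyIntegrableOn.integrableOn_mul_of_tsupport_subset {U : Set Plane}
    {g φ : Plane → ℝ} (hg : LocallyIntegrableOn g U volume) (hφ : Continuous φ)
    (hc : HasCompactSupport φ) (hs : tsupport φ ⊆ U) :
    Integrable (fun x => g x * φ x) volume := by
  have h1 : IntegrableOn g (tsupport φ) volume := hg.integrableOn_compact_subset hs hc
  have h2 : IntegrableOn (fun x => g x * φ x) (tsupport φ) volume :=
    h1.mul_continuousOn hφ.continuousOn hc
  rw [← integrableOn_univ]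
  refine h2.of_forall_sdiff_eq_zero MeasurableSet.univ ?_
  intro x hx
  rw [image_eq_zero_of_notMem_tsupport hx.2, mul_zero]

theorem setIntegral_mul_eq_integral_of_tsupport_subset {U : Set Plane} {φ : Plane → ℝ}
    (hs : tsupport φ ⊆ U) (g : Plane → ℝ) :
    ∫ x in U, g x * φ x = ∫ x, g x * φ x := by
  apply setIntegral_eq_integral_of_forall_compl_eq_zero
  intro x hx
  rw [image_eq_zero_of_notMem_tsupport (fun h => hx (hs h)), mul_zero]

theorem hasCompactSupport_fderiv_apply {φ : Plane → ℝ} (h : HasCompactSupport φ) (v : Plane) :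
    HasCompactSupport (fun x => fderiv ℝ φ x v) :=
  h.mono' (subset_closure.trans (tsupport_fderiv_apply_subset ℝ v))

theorem contDiff_fderiv_apply {φ : Plane → ℝ} {m n : WithTop ℕ∞} (h : ContDiff ℝ n φ)
    (hmn : m + 1 ≤ n) (v : Plane) : ContDiff ℝ m (fun x => fderiv ℝ φ x v) :=
  (h.fderiv_right hmn).clm_apply contDiff_const

theorem fderiv_fderiv_apply_comm {φ : Plane → ℝ} (h : ContDiff ℝ 2 φ) (v w x : Plane) :
    fderiv ℝ (fun y => fderiv ℝ φ y v) x w = fderiv ℝ (fun y => fderiv ℝ φ y w) x v := by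
  have hd : DifferentiableAt ℝ (fderiv ℝ φ) x :=
    ((h.fderiv_right (m := 1) (by norm_num)).differentiable (by norm_num)) x
  rw [fderiv_clm_apply hd (differentiableAt_const _), fderiv_clm_apply hd (differentiableAt_const _)]
  simp only [fderiv_fun_const, Pi.zero_apply, ContinuousLinearMap.comp_zero, zero_add,
    ContinuousLinearMap.flip_apply]
  have := (h.contDiffAt (x := x)).isSymmSndFDerivAt (by simp)
  exact this w v

namespace IsWeakPartial

variable {U V : Set Plane} {i j : Fin 2} {w w' g g' : Plane → ℝ}

/-- The difference integrates to zero against every test function, so the fundamental lemma of the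
calculus of variations applies. This is what makes the choice in `weakPartial` harmless. -/
theorem ae_eq (hU : IsOpen U) (h : IsWeakPartial U i w g) (h' : IsWeakPartial U i w g') :
    g =ᵐ[volume.restrict U] g' := by
  rw [Filter.EventuallyEq, ae_restrict_iff' hU.measurableSet]
  have key := hU.ae_eq_zero_of_integral_contDiff_smul_eq_zero (μ := volume) (f := g - g')
    (h.2.1.sub h'.2.1) (by
      intro φ hφ hc hs
      have e1 := h.2.2 φ hφ hc hs
      have e2 := h'.2.2 φ hφ hc hs
      have e3 := e1.symm.trans e2
      rw [neg_inj, setIntegral_mul_eq_integral_of_tsupport_subset hs,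
        setIntegral_mul_eq_integral_of_tsupport_subset hs] at e3
      have i1 := h.2.1.integrableOn_mul_of_tsupport_subset hφ.continuous hc hs
      have i2 := h'.2.1.integrableOn_mul_of_tsupport_subset hφ.continuous hc hs
      calc ∫ x, φ x • (g - g') x = ∫ x, (g x * φ x - g' x * φ x) := by
            congr 1; ext x; simp only [Pi.sub_apply, smul_eq_mul]; ring
        _ = 0 := by rw [integral_sub i1 i2, e3, sub_self])
  filter_upwards [key] with x hx hxU
  exact sub_eq_zero.1 (hx hxU)

theorem congr (h : IsWeakPartial U i w g) (hw : w =ᵐ[volume.restrict U] w')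
    (hg : g =ᵐ[volume.restrict U] g') : IsWeakPartial U i w' g' := by
  refine ⟨h.1.congr_ae_restrict hw, h.2.1.congr_ae_restrict hg, fun φ hφ hc hs => ?_⟩
  have := h.2.2 φ hφ hc hs
  have e1 : ∫ x in U, w x * fderiv ℝ φ x (basisVec i) = ∫ x in U, w' x * fderiv ℝ φ x (basisVec i) :=
    integral_congr_ae (by filter_upwards [hw] with x hx using by rw [hx])
  have e2 : ∫ x in U, g x * φ x = ∫ x in U, g' x * φ x :=
    integral_congr_ae (by filter_upwards [hg] with x hx using by rw [hx])
  rw [← e1, ← e2, this]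

/-- A test function for `V` is one for `U`, and because of its support all the integrals are
integrals over the plane. -/
theorem mono (h : IsWeakPartial U i w g) (hVU : V ⊆ U) : IsWeakPartial V i w g := by
  refine ⟨h.1.mono_set hVU, h.2.1.mono_set hVU, fun φ hφ hc hs => ?_⟩
  have := h.2.2 φ hφ hc (hs.trans hVU)
  rw [setIntegral_mul_eq_integral_of_tsupport_subset (hs.trans hVU),
    setIntegral_mul_eq_integral_of_tsupport_subset
      (((tsupport_fderiv_apply_subset ℝ _).trans hs).trans hVU)] at this
  rw [setIntegral_mul_eq_integral_of_tsupport_subset hs,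
    setIntegral_mul_eq_integral_of_tsupport_subset
      ((tsupport_fderiv_apply_subset ℝ _).trans hs), this]

theorem sub (h : IsWeakPartial U i w g) (h' : IsWeakPartial U i w' g') :
    IsWeakPartial U i (w - w') (g - g') := by
  refine ⟨h.1.sub h'.1, h.2.1.sub h'.2.1, fun φ hφ hc hs => ?_⟩
  have hs' := (tsupport_fderiv_apply_subset ℝ (basisVec i)).trans hs
  have hφ' := (contDiff_fderiv_apply (m := 0) hφ (by simp) (basisVec i)).continuous
  have hc' := hasCompactSupport_fderiv_apply hc (basisVec i)
  simp only [Pi.sub_apply, sub_mul]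
  rw [integral_sub, integral_sub, h.2.2 φ hφ hc hs, h'.2.2 φ hφ hc hs]
  · ring
  · exact (h.2.1.integrableOn_mul_of_tsupport_subset hφ.continuous hc hs).integrableOn
  · exact (h'.2.1.integrableOn_mul_of_tsupport_subset hφ.continuous hc hs).integrableOn
  · exact (h.1.integrableOn_mul_of_tsupport_subset hφ' hc' hs').integrableOn
  · exact (h'.1.integrableOn_mul_of_tsupport_subset hφ' hc' hs').integrableOn

theorem add (h : IsWeakPartial U i w g) (h' : IsWeakPartial U i w' g') :
    IsWeakPartial U i (w + w') (g + g') := by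
  refine ⟨h.1.add h'.1, h.2.1.add h'.2.1, fun φ hφ hc hs => ?_⟩
  have hs' := (tsupport_fderiv_apply_subset ℝ (basisVec i)).trans hs
  have hφ' := (contDiff_fderiv_apply (m := 0) hφ (by simp) (basisVec i)).continuous
  have hc' := hasCompactSupport_fderiv_apply hc (basisVec i)
  simp only [Pi.add_apply, add_mul]
  rw [integral_add, integral_add, h.2.2 φ hφ hc hs, h'.2.2 φ hφ hc hs]
  · ring
  · exact (h.2.1.integrableOn_mul_of_tsupport_subset hφ.continuous hc hs).integrableOn
  · exact (h'.2.1.integrableOn_mul_of_tsupport_subset hφ.continuous hc hs).integrableOn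
  · exact (h.1.integrableOn_mul_of_tsupport_subset hφ' hc' hs').integrableOn
  · exact (h'.1.integrableOn_mul_of_tsupport_subset hφ' hc' hs').integrableOn

theorem of_contDiff (hφ : ContDiff ℝ 1 w) (i : Fin 2) :
    IsWeakPartial U i w (fun x => fderiv ℝ w x (basisVec i)) := by
  have hw' : Continuous (fun x => fderiv ℝ w x (basisVec i)) :=
    (contDiff_fderiv_apply (m := 0) hφ (by simp) _).continuous
  refine ⟨(hφ.continuous.locallyIntegrable).locallyIntegrableOn _,
    (hw'.locallyIntegrable).locallyIntegrableOn _, fun φ hφs hc hs => ?_⟩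
  have hs' := (tsupport_fderiv_apply_subset ℝ (basisVec i)).trans hs
  have hφ' := (contDiff_fderiv_apply (m := 0) hφs (by simp) (basisVec i)).continuous
  have hc' := hasCompactSupport_fderiv_apply hc (basisVec i)
  rw [setIntegral_mul_eq_integral_of_tsupport_subset hs',
    setIntegral_mul_eq_integral_of_tsupport_subset hs]
  apply integral_mul_fderiv_eq_neg_fderiv_mul_of_integrable
  · exact (hw'.mul hφs.continuous).integrable_of_hasCompactSupport hc.mul_left
  · exact (hφ.continuous.mul hφ').integrable_of_hasCompactSupport hc'.mul_left
  · exact (hφ.continuous.mul hφs.continuous).integrable_of_hasCompactSupport hc.mul_left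
  · exact fun x _ => hφ.differentiable (by norm_num) x
  · exact fun x _ => hφs.differentiable (by simp) x

/-- Testing the two first derivatives with `∂_i φ` and `∂_j φ` reduces the claim to the symmetry of
the second derivatives of the smooth function `φ`. -/
theorem comm {a b c : Plane → ℝ} (hU : IsOpen U) (hi : IsWeakPartial U i w g)
    (hji : IsWeakPartial U j g a) (hj : IsWeakPartial U j w b) (hij : IsWeakPartial U i b c) :
    a =ᵐ[volume.restrict U] c := by
  have hd : IsWeakPartial U i b a := by
    refine ⟨hij.1, hji.2.1, fun φ hφ hc hs => ?_⟩
    have e1 := hj.2.2 _ (contDiff_fderiv_apply hφ (by simp) (basisVec i))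
      (hasCompactSupport_fderiv_apply hc _) ((tsupport_fderiv_apply_subset ℝ _).trans hs)
    have e2 := hi.2.2 _ (contDiff_fderiv_apply hφ (by simp) (basisVec j))
      (hasCompactSupport_fderiv_apply hc _) ((tsupport_fderiv_apply_subset ℝ _).trans hs)
    have e3 := hji.2.2 φ hφ hc hs
    have hφ2 : ContDiff ℝ 2 φ := contDiff_infty.1 hφ 2
    simp only [fderiv_fderiv_apply_comm hφ2 (basisVec i) (basisVec j)] at e1
    linarith
  exact hd.ae_eq hU hij

end IsWeakPartial

theorem weakPartial_spec {U : Set Plane} {i : Fin 2} {w g : Plane → ℝ}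
    (h : IsWeakPartial U i w g) : IsWeakPartial U i w (weakPartial U i w) := by
  have hex : ∃ g, IsWeakPartial U i w g := ⟨g, h⟩
  rw [weakPartial, dif_pos hex]
  exact hex.choose_spec

theorem IsWeakPartial.weakPartial_ae_eq {U : Set Plane} {i : Fin 2} {w g : Plane → ℝ}
    (hU : IsOpen U) (h : IsWeakPartial U i w g) :
    weakPartial U i w =ᵐ[volume.restrict U] g :=
  (weakPartial_spec h).ae_eq hU h

/-- The predicates `IsWeakPartial U i w` and `IsWeakPartial U i w'` are equal, so `choose` returns
the same function. The genuine equality allows rewriting inside nested weak derivatives and traces.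
-/
theorem weakPartial_congr {U : Set Plane} {i : Fin 2} {w w' : Plane → ℝ}
    (h : w =ᵐ[volume.restrict U] w') : weakPartial U i w = weakPartial U i w' := by
  have : IsWeakPartial U i w = IsWeakPartial U i w' := by
    ext g
    exact ⟨fun hg => hg.congr h (EventuallyEq.refl _ _),
      fun hg => hg.congr h.symm (EventuallyEq.refl _ _)⟩
  unfold weakPartial
  rw [this]

/-! ### Sobolev functions -/

theorem Continuous.memLp_two_restrict_of_isBounded {U : Set Plane} (hU : Bornology.IsBounded U)
    {w : Plane → ℝ} (hw : Continuous w) : MemLp w 2 (volume.restrict U) := by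
  obtain ⟨C, hC⟩ := (hU.isCompact_closure.image hw).isBounded.exists_norm_le
  have : IsFiniteMeasure (volume.restrict U) :=
    ⟨by rw [Measure.restrict_apply_univ]; exact hU.measure_lt_top⟩
  have : IsFiniteMeasure (volume.restrict (closure U)) :=
    ⟨by rw [Measure.restrict_apply_univ]; exact hU.isCompact_closure.measure_lt_top⟩
  have : MemLp w 2 (volume.restrict (closure U)) := by
    refine MemLp.of_bound hw.aestronglyMeasurable C ?_
    filter_upwards [ae_restrict_mem isClosed_closure.measurableSet] with x hx
    exact hC _ ⟨x, hx, rfl⟩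
  exact this.mono_measure (Measure.restrict_mono subset_closure le_rfl)

namespace MemSobolev

variable {U V : Set Plane} {m : ℕ} {w w' : Plane → ℝ}

theorem memLp (h : MemSobolev m U w) : MemLp w 2 (volume.restrict U) := by
  cases m with
  | zero => exact h
  | succ m => exact h.1

theorem congr (h : MemSobolev m U w) (hw : w =ᵐ[volume.restrict U] w') : MemSobolev m U w' := by
  cases m with
  | zero => exact (memLp_congr_ae hw).1 h
  | succ m =>
    refine ⟨(memLp_congr_ae hw).1 h.1, fun i => ?_⟩
    obtain ⟨g, hg, hgm⟩ := h.2 i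
    exact ⟨g, hg.congr hw (EventuallyEq.refl _ _), hgm⟩

theorem isWeakPartial (h : MemSobolev (m + 1) U w) (i : Fin 2) :
    IsWeakPartial U i w (weakPartial U i w) :=
  weakPartial_spec (h.2 i).choose_spec.1

theorem weakPartial (h : MemSobolev (m + 1) U w) (hU : IsOpen U) (i : Fin 2) :
    MemSobolev m U (weakPartial U i w) := by
  obtain ⟨g, hg, hgm⟩ := h.2 i
  exact hgm.congr (hg.weakPartial_ae_eq hU).symm

theorem mono (h : MemSobolev m U w) (hVU : V ⊆ U) : MemSobolev m V w := by
  induction m generalizing w with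
  | zero => exact MemLp.mono_measure (Measure.restrict_mono hVU le_rfl) h
  | succ m ih =>
    refine ⟨h.1.mono_measure (Measure.restrict_mono hVU le_rfl), fun i => ?_⟩
    obtain ⟨g, hg, hgm⟩ := h.2 i
    exact ⟨g, hg.mono hVU, ih hgm⟩

theorem sub (h : MemSobolev m U w) (h' : MemSobolev m U w') : MemSobolev m U (w - w') := by
  induction m generalizing w w' with
  | zero => exact MemLp.sub h h'
  | succ m ih =>
    refine ⟨h.1.sub h'.1, fun i => ?_⟩
    obtain ⟨g, hg, hgm⟩ := h.2 i
    obtain ⟨g', hg', hgm'⟩ := h'.2 i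
    exact ⟨g - g', hg.sub hg', ih hgm hgm'⟩

theorem add (h : MemSobolev m U w) (h' : MemSobolev m U w') : MemSobolev m U (w + w') := by
  induction m generalizing w w' with
  | zero => exact MemLp.add h h'
  | succ m ih =>
    refine ⟨h.1.add h'.1, fun i => ?_⟩
    obtain ⟨g, hg, hgm⟩ := h.2 i
    obtain ⟨g', hg', hgm'⟩ := h'.2 i
    exact ⟨g + g', hg.add hg', ih hgm hgm'⟩

theorem of_le {n : ℕ} (h : MemSobolev n U w) (hmn : m ≤ n) : MemSobolev m U w := by
  induction m generalizing n w with
  | zero => exact h.memLp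
  | succ m ih =>
    obtain ⟨n, rfl⟩ : ∃ k, n = k + 1 := ⟨n - 1, by omega⟩
    refine ⟨h.1, fun i => ?_⟩
    obtain ⟨g, hg, hgm⟩ := h.2 i
    exact ⟨g, hg, ih hgm (by omega)⟩

theorem of_contDiff (hU : Bornology.IsBounded U) (hw : ContDiff ℝ ((⊤ : ℕ∞) : WithTop ℕ∞) w) :
    MemSobolev m U w := by
  induction m generalizing w with
  | zero => exact hw.continuous.memLp_two_restrict_of_isBounded hU
  | succ m ih =>
    exact ⟨hw.continuous.memLp_two_restrict_of_isBounded hU, fun i => ⟨_, IsWeakPartial.of_contDiff (hw.of_le (by simp)) i,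
      ih (contDiff_fderiv_apply hw (by simp) _)⟩⟩

end MemSobolev

theorem weakPartial_sub_ae {U : Set Plane} (hU : IsOpen U) {w w' : Plane → ℝ}
    (h : MemSobolev 1 U w) (h' : MemSobolev 1 U w') (i : Fin 2) :
    weakPartial U i (w - w') =ᵐ[volume.restrict U] weakPartial U i w - weakPartial U i w' :=
  ((h.isWeakPartial i).sub (h'.isWeakPartial i)).weakPartial_ae_eq hU

theorem weakPartial_mono_ae {U V : Set Plane} (hV : IsOpen V) (hVU : V ⊆ U) {w : Plane → ℝ}
    (h : MemSobolev 1 U w) (i : Fin 2) :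
    weakPartial V i w =ᵐ[volume.restrict V] weakPartial U i w :=
  ((h.isWeakPartial i).mono hVU).weakPartial_ae_eq hV

theorem weakPartial_comm_ae {U : Set Plane} (hU : IsOpen U) {w : Plane → ℝ}
    (h : MemSobolev 2 U w) (i j : Fin 2) :
    weakPartial U j (weakPartial U i w) =ᵐ[volume.restrict U]
      weakPartial U i (weakPartial U j w) :=
  (h.isWeakPartial i).comm hU ((h.weakPartial hU i).isWeakPartial j) (h.isWeakPartial j)
    ((h.weakPartial hU j).isWeakPartial i)

/-! ### The reference triangle -/

theorem isClosed_refTriangle : IsClosed refTriangle := by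
  have h0 : IsClosed {x : Plane | 0 ≤ x 0} := isClosed_le (by fun_prop) (by fun_prop)
  have h1 : IsClosed {x : Plane | 0 ≤ x 1} := isClosed_le (by fun_prop) (by fun_prop)
  have h2 : IsClosed {x : Plane | x 0 + x 1 ≤ 1} := isClosed_le (by fun_prop) (by fun_prop)
  exact h0.inter (h1.inter h2)

theorem isOpen_refOpenTriangle : IsOpen refOpenTriangle := by
  have h0 : IsOpen {x : Plane | 0 < x 0} := isOpen_lt (by fun_prop) (by fun_prop)
  have h1 : IsOpen {x : Plane | 0 < x 1} := isOpen_lt (by fun_prop) (by fun_prop)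
  have h2 : IsOpen {x : Plane | x 0 + x 1 < 1} := isOpen_lt (by fun_prop) (by fun_prop)
  exact h0.inter (h1.inter h2)

theorem refOpenTriangle_subset : refOpenTriangle ⊆ refTriangle :=
  fun _ hx => ⟨hx.1.le, hx.2.1.le, hx.2.2.le⟩

theorem isBounded_refTriangle : Bornology.IsBounded refTriangle := by
  rw [isBounded_iff_forall_norm_le]
  refine ⟨2, fun x hx => ?_⟩
  obtain ⟨h0, h1, h2⟩ := hx
  rw [EuclideanSpace.norm_eq]
  apply Real.sqrt_le_iff.2
  simp only [Fin.sum_univ_two, Real.norm_eq_abs, sq_abs]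
  constructor
  · norm_num
  · nlinarith

theorem isCompact_refTriangle : IsCompact refTriangle :=
  Metric.isCompact_of_isClosed_isBounded isClosed_refTriangle isBounded_refTriangle

theorem refSide_zero (t : ℝ) : refSide 0 t = !₂[t, 0] := by
  ext i; fin_cases i <;> simp [refSide, refVertex]

theorem refSide_one (t : ℝ) : refSide 1 t = !₂[1 - t, t] := by
  ext i; fin_cases i <;> simp [refSide, refVertex]

theorem refSide_two (t : ℝ) : refSide 2 t = !₂[0, 1 - t] := by
  ext i; fin_cases i <;> simp [refSide, refVertex]

theorem refSide_mem {t : ℝ} (ht : t ∈ Set.Icc (0 : ℝ) 1) (j : Fin 3) :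
    refSide j t ∈ refTriangle := by
  obtain ⟨h0, h1⟩ := ht
  fin_cases j
  · simp [refSide_zero, refTriangle, h0, h1]
  · simp [refSide_one, refTriangle, h0, h1]
  · simp [refSide_two, refTriangle, h0, h1]

theorem refVertex_mem (j : Fin 3) : refVertex j ∈ refTriangle := by
  have := refSide_mem (t := 0) (by simp) j
  simpa [refSide] using this

theorem refSide_injective (j : Fin 3) : Function.Injective (refSide j) := by
  intro a b hab
  have h0 := congrArg (fun x : Plane => x 0) hab
  have h1 := congrArg (fun x : Plane => x 1) hab
  fin_cases j
  · simpa [refSide_zero] using h0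
  · simpa [refSide_one] using h1
  · simpa [refSide_two] using h1

/-- The boundary of the reference triangle is the union of its sides. -/
theorem mem_refTriangle_sdiff_iff {x : Plane} :
    x ∈ refTriangle \ refOpenTriangle ↔ ∃ j, ∃ t ∈ Set.Icc (0 : ℝ) 1, x = refSide j t := by
  constructor
  · rintro ⟨⟨h0, h1, h2⟩, hn⟩
    by_cases e0 : x 0 = 0
    · refine ⟨2, 1 - x 1, ⟨by linarith, by linarith⟩, ?_⟩
      rw [refSide_two]; ext i; fin_cases i <;> simp [e0]
    by_cases e1 : x 1 = 0
    · refine ⟨0, x 0, ⟨by linarith, by linarith⟩, ?_⟩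
      rw [refSide_zero]; ext i; fin_cases i <;> simp [e1]
    have e2 : x 0 + x 1 = 1 := by
      by_contra h
      exact hn ⟨lt_of_le_of_ne h0 (Ne.symm e0), lt_of_le_of_ne h1 (Ne.symm e1),
        lt_of_le_of_ne h2 h⟩
    refine ⟨1, x 1, ⟨by linarith, by linarith⟩, ?_⟩
    rw [refSide_one]; ext i; fin_cases i
    · simp; linarith
    · simp
  · rintro ⟨j, t, ht, rfl⟩
    refine ⟨refSide_mem ht j, ?_⟩
    rintro ⟨h0, h1, h2⟩
    fin_cases j <;> simp [refSide_zero, refSide_one, refSide_two] at h0 h1 h2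

theorem volume_refTriangle_sdiff : volume (refTriangle \ refOpenTriangle) = 0 := by
  have hline : ∀ (a b : Plane), volume (Set.range fun t : ℝ => a + t • b) = 0 := by
    intro a b
    -- The span of one vector has dimension at most one, so it is a proper subspace of the plane and
    -- hence null.
    have hne : (ℝ ∙ b : Submodule ℝ Plane) ≠ ⊤ := by
      intro h
      have h2 := finrank_span_le_card (R := ℝ) ({b} : Set Plane)
      rw [h] at h2
      simp at h2
    have h0 : volume ((ℝ ∙ b : Submodule ℝ Plane) : Set Plane) = 0 :=
      Measure.addHaar_submodule volume _ hne
    have : (Set.range fun t : ℝ => a + t • b) = (fun x => a + x) '' (ℝ ∙ b : Submodule ℝ Plane) := by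
      ext x
      simp only [Set.mem_range, Set.image_add_left, Set.mem_preimage, SetLike.mem_coe,
        Submodule.mem_span_singleton, eq_neg_add_iff_add_eq]
    rw [this, Set.image_add_left, measure_preimage_add]
    exact h0
  refine measure_mono_null (t := ⋃ j : Fin 3,
    Set.range fun t : ℝ => refVertex j + t • (refVertex (j + 1) - refVertex j)) ?_ ?_
  · intro x hx
    obtain ⟨j, t, -, rfl⟩ := mem_refTriangle_sdiff_iff.1 hx
    refine Set.mem_iUnion.2 ⟨j, t, ?_⟩
    simp only [refSide, smul_sub, sub_smul, one_smul]
    abel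
  · exact measure_iUnion_null fun j => hline _ _

theorem restrict_refOpenTriangle :
    (volume : Measure Plane).restrict refOpenTriangle = volume.restrict refTriangle := by
  apply Measure.restrict_congr_set
  rw [ae_eq_set]
  exact ⟨by rw [Set.sdiff_eq_empty.2 refOpenTriangle_subset, measure_empty],
    volume_refTriangle_sdiff⟩

/-! ### Iterated integrals over the reference triangle and its divergence theorem. -/

theorem measurePreserving_plane :
    MeasurePreserving (fun z : ℝ × ℝ => (!₂[z.1, z.2] : Plane)) volume volume := by
  have h1 := (volume_preserving_finTwoArrow ℝ).symm
  have h2 := (EuclideanSpace.volume_preserving_symm_measurableEquiv_toLp (Fin 2)).symm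
  have h3 := h2.comp h1
  have e : (fun z : ℝ × ℝ => (!₂[z.1, z.2] : Plane)) =
      (MeasurableEquiv.toLp 2 (Fin 2 → ℝ)).symm.symm ∘ MeasurableEquiv.finTwoArrow.symm := by
    ext z i; fin_cases i <;> rfl
  rw [e]
  exact h3

theorem measurableEmbedding_plane :
    MeasurableEmbedding (fun z : ℝ × ℝ => (!₂[z.1, z.2] : Plane)) := by
  have h1 := ((MeasurableEquiv.finTwoArrow (α := ℝ)).symm.trans
    (MeasurableEquiv.toLp 2 (Fin 2 → ℝ))).measurableEmbedding
  have e : (fun z : ℝ × ℝ => (!₂[z.1, z.2] : Plane)) =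
      (MeasurableEquiv.finTwoArrow.symm.trans (MeasurableEquiv.toLp 2 (Fin 2 → ℝ))) := by
    ext z i; fin_cases i <;> rfl
  rw [e]
  exact h1

theorem setIntegral_refTriangle {F : Plane → ℝ} (hF : Continuous F) :
    ∫ x in refTriangle, F x = ∫ b in (0:ℝ)..1, ∫ a in (0:ℝ)..(1 - b), F !₂[a, b] := by
  set S : Set (ℝ × ℝ) := {z | 0 ≤ z.1 ∧ 0 ≤ z.2 ∧ z.1 + z.2 ≤ 1} with hS
  have hpre : (fun z : ℝ × ℝ => (!₂[z.1, z.2] : Plane)) ⁻¹' refTriangle = S := by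
    ext z; simp [refTriangle, hS]
  have hSm : MeasurableSet S := by
    rw [← hpre]
    exact measurableEmbedding_plane.measurable isClosed_refTriangle.measurableSet
  have hint : IntegrableOn (fun z : ℝ × ℝ => F !₂[z.1, z.2]) S volume := by
    rw [← hpre]
    exact (measurePreserving_plane.integrableOn_comp_preimage measurableEmbedding_plane).2
      (hF.continuousOn.integrableOn_compact isCompact_refTriangle)
  rw [← measurePreserving_plane.setIntegral_preimage_emb measurableEmbedding_plane, hpre,
    ← integral_indicator hSm]
  have hint' := hint.integrable_indicator hSm
  rw [Measure.volume_eq_prod] at hint' ⊢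
  rw [integral_prod_symm _ hint', intervalIntegral.integral_of_le zero_le_one,
    ← integral_Icc_eq_integral_Ioc, ← integral_indicator measurableSet_Icc]
  congr 1
  ext b
  by_cases hb : b ∈ Set.Icc (0 : ℝ) 1
  · rw [Set.indicator_of_mem hb, intervalIntegral.integral_of_le (by linarith [hb.2]),
      ← integral_Icc_eq_integral_Ioc, ← integral_indicator measurableSet_Icc]
    congr 1
    ext a
    by_cases ha : a ∈ Set.Icc (0 : ℝ) (1 - b)
    · rw [Set.indicator_of_mem ha, Set.indicator_of_mem]
      exact ⟨ha.1, hb.1, by linarith [ha.2]⟩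
    · rw [Set.indicator_of_notMem ha, Set.indicator_of_notMem]
      exact fun h => ha ⟨h.1, by linarith [h.2.2]⟩
  · rw [Set.indicator_of_notMem hb]
    have : ∀ a : ℝ, S.indicator (fun z : ℝ × ℝ => F !₂[z.1, z.2]) (a, b) = 0 := by
      intro a
      rw [Set.indicator_of_notMem]
      rintro ⟨h0, h1, h2⟩
      simp only at h0 h1 h2
      exact hb ⟨h1, by linarith⟩
    simp [this]

/-- The other order of integration comes from the reflection that swaps the coordinates: an isometry
that preserves the triangle. -/
theorem setIntegral_refTriangle' {F : Plane → ℝ} (hF : Continuous F) :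
    ∫ x in refTriangle, F x = ∫ a in (0:ℝ)..1, ∫ b in (0:ℝ)..(1 - a), F !₂[a, b] := by
  let e : Plane ≃ₗᵢ[ℝ] Plane := LinearIsometryEquiv.piLpCongrLeft 2 ℝ ℝ (Equiv.swap 0 1)
  have he : ∀ a b : ℝ, e !₂[a, b] = !₂[b, a] := by
    intro a b
    ext i
    fin_cases i <;> simp [e, LinearIsometryEquiv.piLpCongrLeft_apply]
  have he' : ∀ x, e x = !₂[x 1, x 0] := by
    intro x
    rw [← he]
    congr 1
    ext i; fin_cases i <;> simp
  have hpre : e ⁻¹' refTriangle = refTriangle := by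
    ext x
    simp only [Set.mem_preimage, he', refTriangle, Set.mem_ofPred_eq]
    simp only [Matrix.cons_val_zero, Matrix.cons_val_one, Matrix.cons_val_fin_one]
    constructor <;> rintro ⟨h0, h1, h2⟩ <;> exact ⟨h1, h0, by linarith⟩
  have h1 := e.measurePreserving.setIntegral_preimage_emb
    e.toHomeomorph.measurableEmbedding F refTriangle
  rw [hpre] at h1
  rw [← h1, setIntegral_refTriangle (F := fun x => F (e x)) (hF.comp e.continuous)]
  simp only [he]

theorem hasDerivAt_comp_fst {A : Plane → ℝ} (hA : ContDiff ℝ 1 A) (a b : ℝ) :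
    HasDerivAt (fun s : ℝ => A !₂[s, b]) (fderiv ℝ A !₂[a, b] (basisVec 0)) a := by
  have hl : HasDerivAt (fun s : ℝ => (!₂[s, b] : Plane)) (basisVec 0) a := by
    have h2 := ((hasDerivAt_id a).smul_const (basisVec 0)).add_const (!₂[0, b] : Plane)
    have e : (fun s : ℝ => (!₂[s, b] : Plane)) = fun s => id s • basisVec 0 + !₂[0, b] := by
      funext s; ext i; fin_cases i <;> simp [basisVec]
    rw [e]
    simpa only [one_smul] using h2
  exact ((hA.differentiable (by norm_num) _).hasFDerivAt).comp_hasDerivAt a hl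

theorem hasDerivAt_comp_snd {A : Plane → ℝ} (hA : ContDiff ℝ 1 A) (a b : ℝ) :
    HasDerivAt (fun s : ℝ => A !₂[a, s]) (fderiv ℝ A !₂[a, b] (basisVec 1)) b := by
  have hl : HasDerivAt (fun s : ℝ => (!₂[a, s] : Plane)) (basisVec 1) b := by
    have h2 := ((hasDerivAt_id b).smul_const (basisVec 1)).add_const (!₂[a, 0] : Plane)
    have e : (fun s : ℝ => (!₂[a, s] : Plane)) = fun s => id s • basisVec 1 + !₂[a, 0] := by
      funext s; ext i; fin_cases i <;> simp [basisVec]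
    rw [e]
    simpa only [one_smul] using h2
  exact ((hA.differentiable (by norm_num) _).hasFDerivAt).comp_hasDerivAt b hl

theorem continuous_plane_mk {X : Type*} [TopologicalSpace X] {f g : X → ℝ} (hf : Continuous f)
    (hg : Continuous g) : Continuous (fun x => (!₂[f x, g x] : Plane)) := by
  refine (PiLp.continuous_toLp 2 _).comp (continuous_pi fun i => ?_)
  fin_cases i <;> simpa

theorem continuous_refSide (j : Fin 3) : Continuous (refSide j) := by
  unfold refSide; fun_prop

/-- The divergence theorem on the reference triangle. -/
theorem refTriangle_divergence {A : Fin 2 → Plane → ℝ} (hA : ∀ l, ContDiff ℝ 1 (A l)) :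
    ∫ x in refTriangle, ∑ l, fderiv ℝ (A l) x (basisVec l) =
      ∑ j : Fin 3, ∫ t in (0 : ℝ)..1, ∑ l, A l (refSide j t) * refNormal j l := by
  have hc : ∀ l, Continuous fun x => fderiv ℝ (A l) x (basisVec l) := fun l =>
    (contDiff_fderiv_apply (m := 0) (hA l) (by simp) _).continuous
  have hi : ∀ l, IntegrableOn (fun x => fderiv ℝ (A l) x (basisVec l)) refTriangle volume :=
    fun l => (hc l).continuousOn.integrableOn_compact isCompact_refTriangle
  have c0 := (hA 0).continuous
  have c1 := (hA 1).continuous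
  have e0 : ∫ x in refTriangle, fderiv ℝ (A 0) x (basisVec 0) =
      ∫ b in (0:ℝ)..1, (A 0 !₂[1 - b, b] - A 0 !₂[0, b]) := by
    rw [setIntegral_refTriangle (hc 0)]
    congr 1
    ext b
    exact intervalIntegral.integral_eq_sub_of_hasDerivAt
      (fun a _ => hasDerivAt_comp_fst (hA 0) a b)
      (((hc 0).comp (continuous_plane_mk continuous_id continuous_const)).intervalIntegrable _ _)
  have e1 : ∫ x in refTriangle, fderiv ℝ (A 1) x (basisVec 1) =
      ∫ a in (0:ℝ)..1, (A 1 !₂[a, 1 - a] - A 1 !₂[a, 0]) := by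
    rw [setIntegral_refTriangle' (hc 1)]
    congr 1
    ext a
    exact intervalIntegral.integral_eq_sub_of_hasDerivAt
      (fun b _ => hasDerivAt_comp_snd (hA 1) a b)
      (((hc 1).comp (continuous_plane_mk continuous_const continuous_id)).intervalIntegrable _ _)
  have k1 : Continuous fun t : ℝ => A 0 !₂[1 - t, t] :=
    c0.comp (continuous_plane_mk (by fun_prop) (by fun_prop))
  have k2 : Continuous fun t : ℝ => A 0 !₂[0, t] :=
    c0.comp (continuous_plane_mk (by fun_prop) (by fun_prop))
  have k3 : Continuous fun t : ℝ => A 1 !₂[t, 1 - t] :=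
    c1.comp (continuous_plane_mk (by fun_prop) (by fun_prop))
  have k4 : Continuous fun t : ℝ => A 1 !₂[t, 0] :=
    c1.comp (continuous_plane_mk (by fun_prop) (by fun_prop))
  have k5 : Continuous fun t : ℝ => A 1 !₂[1 - t, t] :=
    c1.comp (continuous_plane_mk (by fun_prop) (by fun_prop))
  simp only [Fin.sum_univ_two, Fin.sum_univ_three, refSide_zero, refSide_one, refSide_two,
    refNormal, Matrix.cons_val_zero, Matrix.cons_val_one, Matrix.cons_val_fin_one]
  rw [integral_add (hi 0) (hi 1), e0, e1,
    intervalIntegral.integral_sub (k1.intervalIntegrable _ _) (k2.intervalIntegrable _ _),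
    intervalIntegral.integral_sub (k3.intervalIntegrable _ _) (k4.intervalIntegrable _ _)]
  -- The boundary is run through counterclockwise, by `(1 - t, t)` and `(0, 1 - t)`, whereas the
  -- fundamental theorem of calculus produced `(t, 1 - t)` and `(0, t)`. The substitution `t ↦ 1 -
  -- t` reconciles them.
  have s1 : ∫ t in (0:ℝ)..1, A 1 !₂[t, 1 - t] = ∫ t in (0:ℝ)..1, A 1 !₂[1 - t, t] := by
    have := intervalIntegral.integral_comp_sub_left (a := 0) (b := 1)
      (fun t => A 1 !₂[t, 1 - t]) 1
    simp only [sub_sub_cancel, sub_self, sub_zero] at this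
    exact this.symm
  have s2 : ∫ t in (0:ℝ)..1, A 0 !₂[0, 1 - t] = ∫ t in (0:ℝ)..1, A 0 !₂[0, t] := by
    have := intervalIntegral.integral_comp_sub_left (a := 0) (b := 1)
      (fun t => A 0 !₂[0, t]) 1
    simpa using this
  simp only [mul_zero, zero_add, mul_neg, mul_one, add_zero, intervalIntegral.integral_neg]
  rw [intervalIntegral.integral_add (k1.intervalIntegrable _ _) (k5.intervalIntegrable _ _),
    s1, s2]
  ring

/-! ### Elemental maps -/

theorem contDiff_mvPolynomial_eval {n : WithTop ℕ∞} (q : MvPolynomial (Fin 2) ℝ) :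
    ContDiff ℝ n (fun x : Plane => MvPolynomial.eval (fun j => x j) q) := by
  induction q using MvPolynomial.induction_on with
  | C a => simpa using contDiff_const
  | add p q hp hq => simpa using hp.add hq
  | mul_X p i hp =>
    simp only [map_mul, MvPolynomial.eval_X]
    exact hp.mul (by fun_prop)

theorem fderiv_mvPolynomial_eval (q : MvPolynomial (Fin 2) ℝ) (x v : Plane) :
    fderiv ℝ (fun x : Plane => MvPolynomial.eval (fun j => x j) q) x v =
      ∑ j, MvPolynomial.eval (fun l => x l) (MvPolynomial.pderiv j q) * v j := by
  have hd : ∀ q : MvPolynomial (Fin 2) ℝ, DifferentiableAt ℝ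
      (fun x : Plane => MvPolynomial.eval (fun j => x j) q) x := fun q =>
    (contDiff_mvPolynomial_eval (n := 1) q).differentiable (by norm_num) x
  induction q using MvPolynomial.induction_on with
  | C a => simp
  | add p q hp hq =>
    simp only [map_add, add_mul, Finset.sum_add_distrib]
    rw [← hp, ← hq, fderiv_fun_add (hd p) (hd q)]
    rfl
  | mul_X p i hp =>
    simp only [map_mul, MvPolynomial.eval_X]
    have hx : DifferentiableAt ℝ (fun x : Plane => x i) x := by fun_prop
    have hx' : fderiv ℝ (fun x : Plane => x i) x v = v i := by
      have : (fun x : Plane => x i) = (EuclideanSpace.proj i : Plane →L[ℝ] ℝ) := rfl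
      rw [this, ContinuousLinearMap.fderiv]; rfl
    rw [fderiv_fun_mul (hd p) hx]
    simp only [add_apply, smul_apply, hx', hp,
      smul_eq_mul, Derivation.leibniz, MvPolynomial.pderiv_X, map_add, map_mul,
      MvPolynomial.eval_X, Fin.sum_univ_two]
    fin_cases i <;> simp <;> ring

theorem contDiff_polyMap {n : WithTop ℕ∞} (p : PolyPair) : ContDiff ℝ n (polyMap p) := by
  rw [contDiff_piLp]
  exact fun i => contDiff_mvPolynomial_eval (p i)

theorem continuous_polyMap (p : PolyPair) : Continuous (polyMap p) :=
  (contDiff_polyMap (n := 0) p).continuous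

theorem contDiff_polyJacobian {n : WithTop ℕ∞} (p : PolyPair) (i j : Fin 2) :
    ContDiff ℝ n (fun x => polyJacobian p x i j) :=
  contDiff_mvPolynomial_eval _

/-- The derivative of the polynomial map as a continuous linear map. -/
def polyDeriv (p : PolyPair) (x : Plane) : Plane →L[ℝ] Plane :=
  Matrix.toEuclideanCLM (n := Fin 2) (𝕜 := ℝ) (polyJacobian p x)

theorem polyDeriv_apply (p : PolyPair) (x v : Plane) (i : Fin 2) :
    polyDeriv p x v i = ∑ j, polyJacobian p x i j * v j := rfl

theorem polyDeriv_basisVec (p : PolyPair) (x : Plane) (i l : Fin 2) :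
    polyDeriv p x (basisVec l) i = polyJacobian p x i l := by
  rw [polyDeriv_apply]
  fin_cases l <;> simp [basisVec]

theorem det_polyDeriv (p : PolyPair) (x : Plane) :
    (polyDeriv p x).det = (polyJacobian p x).det := by
  unfold ContinuousLinearMap.det polyDeriv
  rw [Matrix.coe_toEuclideanCLM_eq_toEuclideanLin, Matrix.toEuclideanLin_eq_toLin_orthonormal,
    LinearMap.det_toLin]

theorem hasFDerivAt_polyMap (p : PolyPair) (x : Plane) :
    HasFDerivAt (polyMap p) (polyDeriv p x) x := by
  rw [← hasFDerivWithinAt_univ, hasFDerivWithinAt_euclidean]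
  intro i
  rw [hasFDerivWithinAt_univ]
  have h := ((contDiff_mvPolynomial_eval (n := 1) (p i)).differentiable (by norm_num) x).hasFDerivAt
  have e : fderiv ℝ (fun x : Plane => MvPolynomial.eval (fun j => x j) (p i)) x =
      (PiLp.proj 2 (fun _ => ℝ) i : Plane →L[ℝ] ℝ) ∘L polyDeriv p x := by
    refine ContinuousLinearMap.ext fun v => ?_
    rw [fderiv_mvPolynomial_eval]
    rfl
  rw [e] at h
  exact h

theorem continuous_polyDeriv (p : PolyPair) : Continuous (polyDeriv p) := by
  have h : polyDeriv p = fderiv ℝ (polyMap p) := funext fun x => (hasFDerivAt_polyMap p x).fderiv.symm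
  rw [h]
  exact (contDiff_polyMap (n := 1) p).continuous_fderiv (by norm_num)

theorem continuous_det_polyJacobian (p : PolyPair) :
    Continuous fun x => (polyJacobian p x).det := by
  simp only [Matrix.det_fin_two]
  have := fun i j => (contDiff_polyJacobian (n := 0) p i j).continuous
  exact ((this 0 0).mul (this 1 1)).sub ((this 0 1).mul (this 1 0))

/-- The derivative at a point with nonvanishing Jacobian as an equivalence. -/
def polyDerivEquiv (p : PolyPair) (x : Plane) (hx : (polyJacobian p x).det ≠ 0) :
    Plane ≃L[ℝ] Plane :=
  (polyDeriv p x).toContinuousLinearEquivOfDetNeZero (by rwa [det_polyDeriv])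

theorem hasFDerivAt_polyMap_equiv (p : PolyPair) (x : Plane) (hx : (polyJacobian p x).det ≠ 0) :
    HasFDerivAt (polyMap p) (polyDerivEquiv p x hx : Plane →L[ℝ] Plane) x := by
  rw [polyDerivEquiv, ContinuousLinearMap.coe_toContinuousLinearEquivOfDetNeZero]
  exact hasFDerivAt_polyMap p x

/-- This is the inverse function theorem. Besides openness of images it serves to rewrite statements
near `ψ(x)` as statements near `x`. -/
theorem map_nhds_polyMap (p : PolyPair) (x : Plane) (hx : (polyJacobian p x).det ≠ 0) :
    map (polyMap p) (𝓝 x) = 𝓝 (polyMap p x) :=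
  ((contDiff_polyMap (n := 1) p).contDiffAt.hasStrictFDerivAt'
    (hasFDerivAt_polyMap_equiv p x hx) (by norm_num)).map_nhds_eq_of_equiv

theorem isOpen_polyMap_image (p : PolyPair) {N : Set Plane} (hN : IsOpen N)
    (hdet : ∀ x ∈ N, (polyJacobian p x).det ≠ 0) : IsOpen (polyMap p '' N) := by
  rw [isOpen_iff_mem_nhds]
  rintro _ ⟨x, hx, rfl⟩
  rw [← map_nhds_polyMap p x (hdet x hx)]
  exact image_mem_map (hN.mem_nhds hx)

theorem isCompact_element (p : PolyPair) : IsCompact (element p) :=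
  isCompact_refTriangle.image (continuous_polyMap p)

theorem openElement_subset_element (p : PolyPair) : openElement p ⊆ element p :=
  Set.image_mono refOpenTriangle_subset

namespace IsElementMap

variable {p : PolyPair}

theorem isOpen_openElement (hp : IsElementMap p) : IsOpen (openElement p) :=
  isOpen_polyMap_image p isOpen_refOpenTriangle fun x hx => hp.2 x (refOpenTriangle_subset hx)

/-- A map that is injective on a compact set and locally injective at each of its points is
injective on a neighbourhood of the set. -/
theorem exists_injOn_nhds (hp : IsElementMap p) : ∃ N : Set Plane, IsOpen N ∧ refTriangle ⊆ N ∧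
    Set.InjOn (polyMap p) N ∧ ∀ x ∈ N, (polyJacobian p x).det ≠ 0 := by
  obtain ⟨t, ht, hinj⟩ := hp.1.exists_mem_nhdsSet isCompact_refTriangle
    (fun x _ => (continuous_polyMap p).continuousAt) (fun x hx => by
      let f := (contDiff_polyMap (n := 1) p).contDiffAt.toOpenPartialHomeomorph (polyMap p)
        (hasFDerivAt_polyMap_equiv p x (hp.2 x hx)) (by norm_num)
      exact ⟨f.source, f.open_source.mem_nhds (ContDiffAt.mem_toOpenPartialHomeomorph_source _ _ _),
        f.injOn⟩)
  obtain ⟨O, hO, hTO, hOt⟩ := mem_nhdsSet_iff_exists.1 ht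
  have hd : IsOpen {x | (polyJacobian p x).det ≠ 0} :=
    isOpen_ne_fun (continuous_det_polyJacobian p) continuous_const
  exact ⟨O ∩ {x | (polyJacobian p x).det ≠ 0}, hO.inter hd, fun x hx => ⟨hTO hx, hp.2 x hx⟩,
    hinj.mono (Set.inter_subset_left.trans hOt), fun x hx => hx.2⟩

/-- The inverse of an elemental map extends to a smooth map of the plane. -/
theorem exists_smooth_leftInverse (hp : IsElementMap p) : ∃ G : Plane → Plane,
    ContDiff ℝ ((⊤ : ℕ∞) : WithTop ℕ∞) G ∧ ∀ᶠ x in 𝓝ˢ refTriangle, G (polyMap p x) = x := by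
  obtain ⟨N, hN, hTN, hinj, hdet⟩ := hp.exists_injOn_nhds
  set W := polyMap p '' N with hW
  have hWo : IsOpen W := isOpen_polyMap_image p hN hdet
  set G₀ := Function.invFunOn (polyMap p) N with hG₀
  have hG₀l : ∀ x ∈ N, G₀ (polyMap p x) = x := fun x hx => hinj.leftInvOn_invFunOn hx
  have hG₀s : ∀ y ∈ W, ContDiffAt ℝ ((⊤ : ℕ∞) : WithTop ℕ∞) G₀ y := by
    rintro _ ⟨x, hx, rfl⟩
    have hf := (contDiff_polyMap (n := ((⊤ : ℕ∞) : WithTop ℕ∞)) p).contDiffAt (x := x)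
    have hf' := hasFDerivAt_polyMap_equiv p x (hdet x hx)
    -- Near `ψ(x)` the global inverse coincides with the smooth local inverse of the inverse
    -- function theorem.
    have hL := hf.to_localInverse hf' (by simp)
    refine hL.congr_of_eventuallyEq ?_
    rw [← map_nhds_polyMap p x (hdet x hx), Filter.EventuallyEq, eventually_map]
    have hl := (hf.hasStrictFDerivAt' hf' (by simp)).eventually_left_inverse
    filter_upwards [hl, hN.mem_nhds hx] with y hy hyN
    rw [hG₀l y hyN]
    exact hy.symm
  -- A cutoff that vanishes near the complement of `W` and equals one near the element makes the
  -- inverse smooth on the whole plane without changing it near the element.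
  obtain ⟨χ, h0, h1, -⟩ := exists_contMDiffMap_zero_one_nhds_of_isClosed (n := ⊤)
    (modelWithCornersSelf ℝ Plane) hWo.isClosed_compl (isCompact_element p).isClosed
    (Set.disjoint_compl_left_iff_subset.2 (Set.image_mono hTN))
  refine ⟨fun y => χ y • G₀ y, ?_, ?_⟩
  · rw [contDiff_iff_contDiffAt]
    intro y
    by_cases hy : y ∈ W
    · exact χ.contMDiff.contDiff.contDiffAt.smul (hG₀s y hy)
    · have : ∀ᶠ z in 𝓝 y, χ z = 0 := eventually_nhdsSet_iff_forall.1 h0 y hy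
      refine (contDiffAt_const (c := (0 : Plane))).congr_of_eventuallyEq ?_
      filter_upwards [this] with z hz
      rw [hz, zero_smul]
  · rw [eventually_nhdsSet_iff_forall]
    intro x hx
    have h2 : ∀ᶠ z in 𝓝 (polyMap p x), χ z = 1 :=
      eventually_nhdsSet_iff_forall.1 h1 _ ⟨x, hx, rfl⟩
    filter_upwards [(continuous_polyMap p).continuousAt.eventually h2, hN.mem_nhds (hTN hx)]
      with z hz hzN
    rw [hz, one_smul, hG₀l z hzN]

/-! ### Change of variables between the element and the reference triangle. -/

theorem injOn_openTriangle (hp : IsElementMap p) : Set.InjOn (polyMap p) refOpenTriangle :=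
  hp.1.mono refOpenTriangle_subset

theorem volume_element_sdiff (p : PolyPair) :
    volume (element p \ openElement p) = 0 := by
  refine measure_mono_null (t := polyMap p '' (refTriangle \ refOpenTriangle)) ?_ ?_
  · rintro _ ⟨⟨x, hx, rfl⟩, hn⟩
    exact ⟨x, ⟨hx, fun h => hn ⟨x, h, rfl⟩⟩, rfl⟩
  · exact addHaar_image_eq_zero_of_differentiableOn_of_addHaar_eq_zero _
      ((contDiff_polyMap (n := 1) p).differentiable (by norm_num)).differentiableOn
      volume_refTriangle_sdiff

theorem setIntegral_openElement (hp : IsElementMap p) (F : Plane → ℝ) :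
    ∫ x in openElement p, F x =
      ∫ x in refTriangle, |(polyJacobian p x).det| * F (polyMap p x) := by
  rw [openElement, integral_image_eq_integral_abs_det_fderiv_smul volume
    isOpen_refOpenTriangle.measurableSet
    (fun x _ => (hasFDerivAt_polyMap p x).hasFDerivWithinAt) hp.injOn_openTriangle,
    restrict_refOpenTriangle]
  simp only [det_polyDeriv, smul_eq_mul]

theorem setLIntegral_openElement (hp : IsElementMap p) (F : Plane → ENNReal) :
    ∫⁻ x in openElement p, F x =
      ∫⁻ x in refTriangle, ENNReal.ofReal |(polyJacobian p x).det| * F (polyMap p x) := by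
  rw [openElement, lintegral_image_eq_lintegral_abs_det_fderiv_mul volume
    isOpen_refOpenTriangle.measurableSet
    (fun x _ => (hasFDerivAt_polyMap p x).hasFDerivWithinAt) hp.injOn_openTriangle,
    restrict_refOpenTriangle]
  simp only [det_polyDeriv]

/-- Differentiable maps of the plane send null sets to null sets. Membership in the discrete space
is stated on the reference triangle and reaches the element this way. -/
theorem ae_openElement_of_ae_refTriangle (hp : IsElementMap p) {P : Plane → Prop}
    (h : ∀ᵐ x ∂(volume.restrict refTriangle), P (polyMap p x)) :
    ∀ᵐ y ∂(volume.restrict (openElement p)), P y := by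
  rw [ae_iff] at h
  have h1 : volume ({x | ¬ P (polyMap p x)} ∩ refOpenTriangle) = 0 := by
    rw [← restrict_refOpenTriangle, Measure.restrict_apply₀'
      isOpen_refOpenTriangle.measurableSet.nullMeasurableSet] at h
    exact h
  have h2 := addHaar_image_eq_zero_of_differentiableOn_of_addHaar_eq_zero volume
    ((contDiff_polyMap (n := 1) p).differentiable (by norm_num)).differentiableOn h1
  have h3 : volume ({y | ¬ P y} ∩ openElement p) = 0 := by
    refine measure_mono_null ?_ h2
    rintro _ ⟨hy, x, hx, rfl⟩
    exact ⟨x, ⟨hy, hx⟩, rfl⟩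
  rw [ae_restrict_iff' hp.isOpen_openElement.measurableSet, ae_iff]
  refine measure_mono_null (fun y hy => ?_) h3
  simp only [Set.mem_ofPred_eq, Classical.not_imp] at hy
  exact ⟨hy.2, hy.1⟩

theorem exists_le_abs_det (hp : IsElementMap p) :
    ∃ c > 0, ∀ x ∈ refTriangle, c ≤ |(polyJacobian p x).det| := by
  obtain ⟨x, hx, hmin⟩ := isCompact_refTriangle.exists_isMinOn ⟨_, refVertex_mem 0⟩
    (continuous_det_polyJacobian p).abs.continuousOn
  exact ⟨_, abs_pos.2 (hp.2 x hx), fun y hy => hmin hy⟩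

end IsElementMap

/-! ### Arc length and normals on the sides of an element -/

/-- The tangent vector of the reference side `j`. -/
def refTangent (j : Fin 3) : Plane := refVertex (j + 1) - refVertex j

/-- The tangent vector `Dψ τ̂` of the side `j`, at the image of the point `x`. -/
def sideTangent (p : PolyPair) (j : Fin 3) (x : Plane) : Plane := polyDeriv p x (refTangent j)

theorem hasDerivAt_refSide (j : Fin 3) (t : ℝ) : HasDerivAt (refSide j) (refTangent j) t := by
  have h1 := ((hasDerivAt_id t).const_sub 1).smul_const (refVertex j)
  have h2 := (hasDerivAt_id t).smul_const (refVertex (j + 1))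
  have h3 := h1.add h2
  have e : (-1 : ℝ) • refVertex j + (1 : ℝ) • refVertex (j + 1) = refTangent j := by
    simp [refTangent, sub_eq_add_neg, add_comm]
  rw [e] at h3
  exact h3

theorem hasDerivAt_side (p : PolyPair) (j : Fin 3) (t : ℝ) :
    HasDerivAt (fun s => polyMap p (refSide j s)) (sideTangent p j (refSide j t)) t :=
  (hasFDerivAt_polyMap p (refSide j t)).comp_hasDerivAt t (hasDerivAt_refSide j t)

theorem refTangent_ne_zero (j : Fin 3) : refTangent j ≠ 0 := by
  intro h
  have h0 := congrArg (fun x : Plane => x 0) h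
  have h1 := congrArg (fun x : Plane => x 1) h
  fin_cases j <;> simp [refTangent, refVertex] at h0 h1

/-- The vertices are numbered counterclockwise, so a quarter turn of the tangent, `rot`, is exactly
`refNormal j`, length included. -/
theorem refTangent_apply_zero (j : Fin 3) : refTangent j 0 = -refNormal j 1 := by
  fin_cases j <;> simp [refTangent, refVertex, refNormal]

theorem refTangent_apply_one (j : Fin 3) : refTangent j 1 = refNormal j 0 := by
  fin_cases j <;> simp [refTangent, refVertex, refNormal]

theorem sideTangent_ne_zero {p : PolyPair} {x : Plane} (hx : (polyJacobian p x).det ≠ 0)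
    (j : Fin 3) : sideTangent p j x ≠ 0 := by
  intro h
  have : polyDerivEquiv p x hx (refTangent j) = 0 := h
  exact refTangent_ne_zero j ((polyDerivEquiv p x hx).map_eq_zero_iff.1 this)

theorem continuous_sideTangent (p : PolyPair) (j : Fin 3) : Continuous (sideTangent p j) :=
  (continuous_polyDeriv p).clm_apply continuous_const

theorem continuous_side (p : PolyPair) (j : Fin 3) :
    Continuous fun t => polyMap p (refSide j t) :=
  (continuous_polyMap p).comp (continuous_refSide j)

theorem continuous_speed (p : PolyPair) (j : Fin 3) :
    Continuous fun t => ‖sideTangent p j (refSide j t)‖ :=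
  ((continuous_sideTangent p j).comp (continuous_refSide j)).norm

/-- Rotation by a right angle. -/
def rot (w : Plane) : Plane := !₂[w 1, -w 0]

theorem norm_rot (w : Plane) : ‖rot w‖ = ‖w‖ := by
  simp [rot, EuclideanSpace.norm_eq, Fin.sum_univ_two, add_comm]

theorem continuous_rot : Continuous rot := continuous_plane_mk (by fun_prop) (by fun_prop)

theorem sideMeasure_eq (p : PolyPair) (j : Fin 3) : sideMeasure p j =
    Measure.map (fun t => polyMap p (refSide j t))
      ((volume.restrict (Set.Icc (0 : ℝ) 1)).withDensity fun t =>
        ENNReal.ofReal ‖sideTangent p j (refSide j t)‖) := by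
  unfold sideMeasure
  simp only [fun t => (hasDerivAt_side p j t).deriv]

theorem isCompact_side (p : PolyPair) (j : Fin 3) : IsCompact (side p j) :=
  isCompact_Icc.image (continuous_side p j)

theorem side_subset_element (p : PolyPair) (j : Fin 3) : side p j ⊆ element p := by
  rintro _ ⟨t, ht, rfl⟩
  exact ⟨_, refSide_mem ht j, rfl⟩

theorem openSide_subset_side (p : PolyPair) (j : Fin 3) : openSide p j ⊆ side p j :=
  Set.image_mono Set.Ioo_subset_Icc_self

instance isFiniteMeasure_sideMeasure (p : PolyPair) (j : Fin 3) :
    IsFiniteMeasure (sideMeasure p j) := by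
  rw [sideMeasure_eq]
  have hi : Integrable (fun t => ‖sideTangent p j (refSide j t)‖)
      (volume.restrict (Set.Icc (0 : ℝ) 1)) :=
    (continuous_speed p j).continuousOn.integrableOn_compact isCompact_Icc
  have := isFiniteMeasure_withDensity_ofReal hi.2
  infer_instance

/-- Only the two endpoints have to be discarded. `P` need not be measurable, so the argument goes
through two Borel sets: the compact side, and the finite set of endpoints off the open side.
Removing `openSide p j` from that set is needed since `ψ` is not assumed injective here. -/
theorem ae_sideMeasure_of_forall_openSide (p : PolyPair) (j : Fin 3) {P : Plane → Prop}
    (h : ∀ x ∈ openSide p j, P x) : ∀ᵐ x ∂(sideMeasure p j), P x := by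
  set c := fun t => polyMap p (refSide j t) with hc
  have h1 : ∀ᵐ x ∂(sideMeasure p j), x ∈ openSide p j ∪ {c 0, c 1} := by
    have : ∀ᵐ x ∂(sideMeasure p j), x ∈ side p j := by
      rw [sideMeasure_eq]
      refine (ae_map_iff (p := fun x => x ∈ side p j) (continuous_side p j).aemeasurable
        (isCompact_side p j).isClosed.measurableSet).2 ?_
      refine (withDensity_absolutelyContinuous _ _).ae_le ?_
      filter_upwards [ae_restrict_mem measurableSet_Icc] with t ht
      exact ⟨t, ht, rfl⟩
    filter_upwards [this] with x hx
    obtain ⟨t, ht, rfl⟩ := hx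
    rcases eq_or_lt_of_le ht.1 with h0 | h0
    · right; left; simp [hc, ← h0]
    rcases eq_or_lt_of_le ht.2 with h1 | h1
    · right; right; simp [hc, h1]
    · exact Or.inl ⟨t, ⟨h0, h1⟩, rfl⟩
  have h2 : ∀ᵐ x ∂(sideMeasure p j), x ∈ (({c 0, c 1} : Set Plane) \ openSide p j)ᶜ := by
    have hfin : ((({c 0, c 1} : Set Plane) \ openSide p j)).Finite :=
      (((Set.finite_singleton _).insert _)).subset Set.sdiff_subset
    rw [sideMeasure_eq]
    refine (ae_map_iff (p := fun x => x ∈ (({c 0, c 1} : Set Plane) \ openSide p j)ᶜ)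
      (continuous_side p j).aemeasurable hfin.measurableSet.compl).2 ?_
    refine (withDensity_absolutelyContinuous _ _).ae_le ?_
    have h3 : ∀ᵐ t ∂(volume.restrict (Set.Icc (0 : ℝ) 1)), t ∈ Set.Ioo (0 : ℝ) 1 := by
      rw [← restrict_Ioo_eq_restrict_Icc]
      exact ae_restrict_mem measurableSet_Ioo
    filter_upwards [h3] with t ht hmem
    exact hmem.2 ⟨t, ht, rfl⟩
  filter_upwards [h1, h2] with x hx1 hx2
  by_contra hP
  have hx3 : x ∉ openSide p j := fun hx => hP (h x hx)
  exact hx2 ⟨hx1.resolve_left hx3, hx3⟩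

theorem ae_sideMeasure_mem_openSide (p : PolyPair) (j : Fin 3) :
    ∀ᵐ x ∂(sideMeasure p j), x ∈ openSide p j :=
  ae_sideMeasure_of_forall_openSide p j fun _ hx => hx

theorem ContinuousOn.aestronglyMeasurable_sideMeasure {p : PolyPair} {j : Fin 3} {F : Plane → ℝ}
    (hF : ContinuousOn F (side p j)) : AEStronglyMeasurable F (sideMeasure p j) := by
  have hs := (isCompact_side p j).isClosed.measurableSet
  have h := hF.aestronglyMeasurable (μ := sideMeasure p j) hs
  rwa [Measure.restrict_eq_self_of_ae_mem] at h
  filter_upwards [ae_sideMeasure_mem_openSide p j] with x hx using openSide_subset_side p j hx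

theorem ContinuousOn.exists_ae_bound_sideMeasure {p : PolyPair} {j : Fin 3} {F : Plane → ℝ}
    (hF : ContinuousOn F (side p j)) : ∃ C, ∀ᵐ x ∂(sideMeasure p j), ‖F x‖ ≤ C := by
  obtain ⟨C, hC⟩ := ((isCompact_side p j).image_of_continuousOn hF).isBounded.exists_norm_le
  refine ⟨C, ?_⟩
  filter_upwards [ae_sideMeasure_mem_openSide p j] with x hx
  exact hC _ ⟨x, openSide_subset_side p j hx, rfl⟩

theorem ContinuousOn.memLp_sideMeasure {p : PolyPair} {j : Fin 3} {F : Plane → ℝ}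
    (hF : ContinuousOn F (side p j)) : MemLp F 2 (sideMeasure p j) := by
  obtain ⟨C, hC⟩ := hF.exists_ae_bound_sideMeasure
  exact MemLp.of_bound hF.aestronglyMeasurable_sideMeasure C hC

theorem integral_sideMeasure {p : PolyPair} {j : Fin 3} {F : Plane → ℝ}
    (hF : AEStronglyMeasurable F (sideMeasure p j)) :
    ∫ x, F x ∂(sideMeasure p j) =
      ∫ t in (0 : ℝ)..1, ‖sideTangent p j (refSide j t)‖ * F (polyMap p (refSide j t)) := by
  rw [sideMeasure_eq] at hF ⊢
  rw [integral_map (continuous_side p j).aemeasurable hF,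
    integral_withDensity_eq_integral_toReal_smul (by
      exact (continuous_speed p j).measurable.ennreal_ofReal) (by simp),
    intervalIntegral.integral_of_le zero_le_one, integral_Icc_eq_integral_Ioc]
  simp

/-! ### Normals -/

/-- `det Dψ` is continuous without zeros on the convex triangle, so its sign is constant. The map
may reverse the orientation; the sign `s` then enters both the area element and the normal, and
cancels in the divergence theorem. -/
theorem IsElementMap.exists_sign {p : PolyPair} (hp : IsElementMap p) :
    ∃ s : ℝ, (s = 1 ∨ s = -1) ∧ ∀ x ∈ refTriangle,
      |(polyJacobian p x).det| = s * (polyJacobian p x).det ∧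
      |(polyJacobian p x).det|⁻¹ * (polyJacobian p x).det = s := by
  have hconv : Convex ℝ refTriangle := by
    intro x hx y hy a b ha hb hab
    obtain ⟨x0, x1, x2⟩ := hx
    obtain ⟨y0, y1, y2⟩ := hy
    refine ⟨?_, ?_, ?_⟩ <;> simp only [PiLp.add_apply, PiLp.smul_apply, smul_eq_mul]
    · positivity
    · positivity
    · nlinarith
  have hpre : IsPreconnected ((fun x => (polyJacobian p x).det) '' refTriangle) :=
    hconv.isPreconnected.image _ (continuous_det_polyJacobian p).continuousOn
  have h0 := hp.2 _ (refVertex_mem 0)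
  have hm0 : (polyJacobian p (refVertex 0)).det ∈
    (fun x => (polyJacobian p x).det) '' refTriangle := ⟨_, refVertex_mem 0, rfl⟩
  rcases lt_or_gt_of_ne h0 with h | h
  · refine ⟨-1, Or.inr rfl, fun x hx => ?_⟩
    have : (polyJacobian p x).det < 0 := by
      by_contra hn
      obtain ⟨z, hz, hz0⟩ := hpre.Icc_subset hm0 ⟨x, hx, rfl⟩ ⟨h.le, not_lt.1 hn⟩
      exact hp.2 z hz hz0
    rw [abs_of_neg this]
    exact ⟨by ring, by rw [inv_neg, neg_mul, inv_mul_cancel₀ this.ne]⟩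
  · refine ⟨1, Or.inl rfl, fun x hx => ?_⟩
    have : 0 < (polyJacobian p x).det := by
      by_contra hn
      obtain ⟨z, hz, hz0⟩ := hpre.Icc_subset ⟨x, hx, rfl⟩ hm0 ⟨not_lt.1 hn, h.le⟩
      exact hp.2 z hz hz0
    rw [abs_of_pos this]
    constructor
    · ring
    · field_simp

/-- `Dψ^{-T}` is the cofactor matrix divided by the determinant, and in the plane the cofactor
matrix applied to a rotated vector is the rotated image of that vector. Normals are thus expressed
by tangents. -/
theorem mulVec_inv_transpose_refNormal (p : PolyPair) (j : Fin 3) (x : Plane) :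
    (WithLp.toLp 2 (Matrix.mulVec ((polyJacobian p x)⁻¹).transpose (refNormal j)) : Plane) =
      ((polyJacobian p x).det)⁻¹ • rot (sideTangent p j x) := by
  rw [Matrix.inv_def, Ring.inverse_eq_inv', Matrix.adjugate_fin_two]
  ext i
  fin_cases i <;>
  · simp [Matrix.mulVec, dotProduct, Fin.sum_univ_two, rot, sideTangent, polyDeriv_apply,
      refTangent_apply_zero, refTangent_apply_one]
    ring

theorem sideNormal_polyMap {p : PolyPair} (hp : IsElementMap p) (j : Fin 3) {x : Plane}
    (hx : x ∈ refTriangle) : sideNormal p j (polyMap p x) =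
      (|(polyJacobian p x).det|⁻¹ * (polyJacobian p x).det * ‖sideTangent p j x‖⁻¹) •
        rot (sideTangent p j x) := by
  have hinv : Function.invFunOn (polyMap p) refTriangle (polyMap p x) = x :=
    hp.1.leftInvOn_invFunOn hx
  simp only [sideNormal, hinv, mulVec_inv_transpose_refNormal, norm_smul, norm_rot, smul_smul]
  have hd := hp.2 x hx
  have ht := norm_ne_zero_iff.2 (sideTangent_ne_zero hd j)
  congr 1
  rw [Real.norm_eq_abs, abs_inv]
  rcases abs_choice (polyJacobian p x).det with h | h <;> rw [h] <;> field_simp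

theorem norm_sideNormal_polyMap {p : PolyPair} (hp : IsElementMap p) (j : Fin 3) {x : Plane}
    (hx : x ∈ refTriangle) : ‖sideNormal p j (polyMap p x)‖ = 1 := by
  have hd := hp.2 x hx
  have ht := norm_ne_zero_iff.2 (sideTangent_ne_zero hd j)
  have hd' := abs_ne_zero.2 hd
  rw [sideNormal_polyMap hp j hx, norm_smul, norm_rot]
  simp only [norm_mul, norm_inv, Real.norm_eq_abs, abs_abs, abs_norm]
  field_simp

/-- `Function.invFunOn` is merely a choice and carries no continuity. On the element it agrees with
the smooth left inverse, and the formula of `sideNormal_polyMap` becomes continuous by composition.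
-/
theorem IsElementMap.continuousOn_sideNormal {p : PolyPair} (hp : IsElementMap p) (j : Fin 3)
    (i : Fin 2) : ContinuousOn (fun x => sideNormal p j x i) (element p) := by
  obtain ⟨G, hG, hGl⟩ := hp.exists_smooth_leftInverse
  have hGl' : ∀ x ∈ refTriangle, G (polyMap p x) = x := fun x hx =>
    hGl.self_of_nhdsSet x hx
  have h1 : ContinuousOn (fun x : Plane => ((|(polyJacobian p x).det|⁻¹ * (polyJacobian p x).det *
      ‖sideTangent p j x‖⁻¹) • rot (sideTangent p j x)) i) refTriangle := by
    have c1 := (continuous_det_polyJacobian p).continuousOn (s := refTriangle)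
    have c2 := (continuous_sideTangent p j).continuousOn (s := refTriangle)
    have c3 : ContinuousOn (fun x => rot (sideTangent p j x) i) refTriangle :=
      ((by fun_prop : Continuous fun x : Plane => x i).comp
        (continuous_rot.comp (continuous_sideTangent p j))).continuousOn
    simp only [PiLp.smul_apply, smul_eq_mul]
    refine (((c1.abs.inv₀ fun x hx => abs_ne_zero.2 (hp.2 x hx)).mul c1).mul
      (c2.norm.inv₀ fun x hx => norm_ne_zero_iff.2 (sideTangent_ne_zero (hp.2 x hx) j))).mul c3
  have h2 : Set.MapsTo G (element p) refTriangle := by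
    rintro _ ⟨x, hx, rfl⟩
    rwa [hGl' x hx]
  refine (h1.comp hG.continuous.continuousOn h2).congr ?_
  rintro _ ⟨x, hx, rfl⟩
  simp only [Function.comp_apply, hGl' x hx, sideNormal_polyMap hp j hx]

/-! ### The divergence theorem on an element -/

theorem fderiv_comp_polyMap {F : Plane → ℝ} (hF : ContDiff ℝ 1 F) (p : PolyPair) (x : Plane)
    (l : Fin 2) : fderiv ℝ (fun y => F (polyMap p y)) x (basisVec l) =
      ∑ i, fderiv ℝ F (polyMap p x) (basisVec i) * polyJacobian p x i l := by
  have h := ((hF.differentiable (by norm_num) (polyMap p x)).hasFDerivAt).comp x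
    (hasFDerivAt_polyMap p x)
  have h2 : fderiv ℝ (fun y => F (polyMap p y)) x =
    (fderiv ℝ F (polyMap p x)).comp (polyDeriv p x) := h.fderiv
  rw [h2, ContinuousLinearMap.comp_apply]
  have e : polyDeriv p x (basisVec l) = ∑ i, polyJacobian p x i l • basisVec i := by
    ext m
    rw [polyDeriv_basisVec]
    fin_cases m <;> simp [basisVec, Fin.sum_univ_two]
  rw [e, map_sum]
  simp [mul_comm]

/-- The cofactor matrix of the Jacobian. -/
def polyCofactor (p : PolyPair) (x : Plane) : Matrix (Fin 2) (Fin 2) ℝ :=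
  !![polyJacobian p x 1 1, -polyJacobian p x 1 0; -polyJacobian p x 0 1, polyJacobian p x 0 0]

theorem contDiff_polyCofactor {n : WithTop ℕ∞} (p : PolyPair) (i l : Fin 2) :
    ContDiff ℝ n (fun x => polyCofactor p x i l) := by
  fin_cases i <;> fin_cases l
  · exact contDiff_polyJacobian p 1 1
  · exact (contDiff_polyJacobian p 1 0).neg
  · exact (contDiff_polyJacobian p 0 1).neg
  · exact contDiff_polyJacobian p 0 0

theorem fderiv_polyJacobian_comm (p : PolyPair) (i j l : Fin 2) (x : Plane) :
    fderiv ℝ (fun x => polyJacobian p x i j) x (basisVec l) =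
      fderiv ℝ (fun x => polyJacobian p x i l) x (basisVec j) := by
  have h : ∀ j, (fun x => polyJacobian p x i j) = fun x =>
      fderiv ℝ (fun x : Plane => MvPolynomial.eval (fun j => x j) (p i)) x (basisVec j) := by
    intro j
    ext x
    rw [fderiv_mvPolynomial_eval]
    fin_cases j <;> simp [basisVec, polyJacobian]
  rw [h, h, fderiv_fderiv_apply_comm (contDiff_mvPolynomial_eval (p i))]

/-- Piola's identity: the rows of the cofactor matrix are rotated gradients, hence divergence free
by the symmetry of second derivatives. -/
theorem sum_fderiv_polyCofactor (p : PolyPair) (i : Fin 2) (x : Plane) :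
    ∑ l, fderiv ℝ (fun x => polyCofactor p x i l) x (basisVec l) = 0 := by
  rw [Fin.sum_univ_two]
  fin_cases i
  · have e0 : (fun x => polyCofactor p x 0 0) = fun x => polyJacobian p x 1 1 := rfl
    have e1 : (fun x => polyCofactor p x 0 1) = fun x => -polyJacobian p x 1 0 := rfl
    simp only [Fin.zero_eta, e0, e1, fderiv_fun_neg, neg_apply]
    rw [fderiv_polyJacobian_comm p 1 1 0]
    ring
  · have e0 : (fun x => polyCofactor p x 1 0) = fun x => -polyJacobian p x 0 1 := rfl
    have e1 : (fun x => polyCofactor p x 1 1) = fun x => polyJacobian p x 0 0 := rfl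
    simp only [Fin.mk_one, e0, e1, fderiv_fun_neg, neg_apply]
    rw [fderiv_polyJacobian_comm p 0 1 0]
    ring

theorem sum_polyCofactor_mul_refNormal (p : PolyPair) (j : Fin 3) (x : Plane) (i : Fin 2) :
    ∑ l, polyCofactor p x i l * refNormal j l = rot (sideTangent p j x) i := by
  fin_cases i <;>
  · simp [polyCofactor, rot, sideTangent, polyDeriv_apply, Fin.sum_univ_two,
      refTangent_apply_zero, refTangent_apply_one]
    try ring

/-- The pulled back field with components `(F ∘ ψ) cof_{il}` has divergence `det Dψ · (∂_i F) ∘ ψ`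
by Piola's identity, and its flux density on a reference side is, up to the orientation sign, `F`
times the normal component times the speed of the curve. -/
theorem IsElementMap.integral_fderiv {p : PolyPair} (hp : IsElementMap p) {F : Plane → ℝ}
    (hF : ContDiff ℝ 1 F) (i : Fin 2) :
    ∫ x in openElement p, fderiv ℝ F x (basisVec i) =
      ∑ j, ∫ x, F x * sideNormal p j x i ∂(sideMeasure p j) := by
  obtain ⟨s, -, hs⟩ := hp.exists_sign
  have hFψ : ContDiff ℝ 1 fun x => F (polyMap p x) := hF.comp (contDiff_polyMap p)
  have hA : ∀ l, ContDiff ℝ 1 fun x => F (polyMap p x) * polyCofactor p x i l := fun l =>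
    hFψ.mul (contDiff_polyCofactor p i l)
  have hpiola : ∀ x, ∑ l, fderiv ℝ (fun x => F (polyMap p x) * polyCofactor p x i l) x
      (basisVec l) = (polyJacobian p x).det * fderiv ℝ F (polyMap p x) (basisVec i) := by
    intro x
    have h1 : ∀ l, fderiv ℝ (fun x => F (polyMap p x) * polyCofactor p x i l) x (basisVec l) =
        F (polyMap p x) * fderiv ℝ (fun x => polyCofactor p x i l) x (basisVec l) +
        polyCofactor p x i l * ∑ m, fderiv ℝ F (polyMap p x) (basisVec m) * polyJacobian p x m l := by
      intro l
      rw [fderiv_fun_mul (hFψ.differentiable (by norm_num) x)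
        ((contDiff_polyCofactor (n := 1) p i l).differentiable (by norm_num) x),
        ← fderiv_comp_polyMap hF]
      rfl
    simp only [h1, Finset.sum_add_distrib]
    rw [← Finset.mul_sum, sum_fderiv_polyCofactor, mul_zero, zero_add]
    simp only [Fin.sum_univ_two, Matrix.det_fin_two]
    fin_cases i <;> simp [polyCofactor] <;> ring
  have hdiv := refTriangle_divergence hA
  simp only [hpiola] at hdiv
  have hL : ∫ x in openElement p, fderiv ℝ F x (basisVec i) =
      s * ∫ x in refTriangle, (polyJacobian p x).det * fderiv ℝ F (polyMap p x) (basisVec i) := by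
    rw [hp.setIntegral_openElement, ← integral_const_mul]
    refine setIntegral_congr_fun isClosed_refTriangle.measurableSet fun x hx => ?_
    simp only [(hs x hx).1]
    ring
  rw [hL, hdiv, Finset.mul_sum]
  refine Finset.sum_congr rfl fun j _ => ?_
  have hm : AEStronglyMeasurable (fun x => F x * sideNormal p j x i) (sideMeasure p j) :=
    (hF.continuous.continuousOn.mul ((hp.continuousOn_sideNormal j i).mono
      (side_subset_element p j))).aestronglyMeasurable_sideMeasure
  rw [integral_sideMeasure hm, ← intervalIntegral.integral_const_mul]
  refine intervalIntegral.integral_congr fun t ht => ?_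
  rw [Set.uIcc_of_le zero_le_one] at ht
  have hx := refSide_mem ht j
  have hne := norm_ne_zero_iff.2 (sideTangent_ne_zero (hp.2 _ hx) j)
  simp only [sideNormal_polyMap hp j hx, (hs _ hx).2, PiLp.smul_apply, smul_eq_mul, mul_assoc,
    ← Finset.mul_sum, sum_polyCofactor_mul_refNormal]
  field_simp

/-! ### The trace inequality -/

theorem hasDerivAt_sq_mul_sub {φ : Plane → ℝ} (hφ : ContDiff ℝ 1 φ) (a x : Plane) (l : Fin 2) :
    fderiv ℝ (fun x => φ x ^ 2 * (x l - a l)) x (basisVec l) =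
      2 * φ x * fderiv ℝ φ x (basisVec l) * (x l - a l) + φ x ^ 2 := by
  have hφ' : DifferentiableAt ℝ φ x := hφ.differentiable (by norm_num) x
  have h1 : HasFDerivAt (fun x : Plane => x l - a l) (EuclideanSpace.proj l : Plane →L[ℝ] ℝ) x :=
    (EuclideanSpace.proj l : Plane →L[ℝ] ℝ).hasFDerivAt.sub_const _
  have h2 := (hφ'.hasFDerivAt.pow 2).mul h1
  have h3 : fderiv ℝ (fun x => φ x ^ 2 * (x l - a l)) x = _ := h2.fderiv
  rw [h3]
  simp [basisVec]
  ring

/-- The divergence theorem is applied to `φ² (x - a)`, where `a` is the vertex `j + 2` opposite to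
the side `j`. The field is tangential on the two sides through `a`, and `(x - a) · refNormal j = 1`
on the side `j`. Young's inequality bounds each of the two summands of the divergence by `2 φ² +
(∂_l φ)²`, whence the factor 4. -/
theorem refTriangle_trace_le {φ : Plane → ℝ} (hφ : ContDiff ℝ 1 φ) (j : Fin 3) :
    ∫ t in (0 : ℝ)..1, φ (refSide j t) ^ 2 ≤
      ∫ x in refTriangle, (4 * φ x ^ 2 + ∑ l, fderiv ℝ φ x (basisVec l) ^ 2) := by
  have hA : ∀ l : Fin 2, ContDiff ℝ 1 fun x : Plane => φ x ^ 2 * (x l - refVertex (j + 2) l) :=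
    fun l => (hφ.pow 2).mul (by fun_prop)
  have hdiv := refTriangle_divergence hA
  have hb : ∑ j' : Fin 3, ∫ t in (0 : ℝ)..1, ∑ l, φ (refSide j' t) ^ 2 *
      (refSide j' t l - refVertex (j + 2) l) * refNormal j' l =
        ∫ t in (0 : ℝ)..1, φ (refSide j t) ^ 2 := by
    rw [← Finset.sum_subset (Finset.subset_univ {j}), Finset.sum_singleton]
    · congr 1
      ext t
      fin_cases j <;>
        simp [Fin.sum_univ_two, refSide_zero, refSide_one, refSide_two, refVertex, refNormal] <;>
        ring
    · intro j' _ hj'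
      have : ∀ t, ∑ l, φ (refSide j' t) ^ 2 *
          (refSide j' t l - refVertex (j + 2) l) * refNormal j' l = 0 := by
        intro t
        fin_cases j <;> fin_cases j' <;>
          simp [Fin.sum_univ_two, refSide_zero, refSide_one, refSide_two, refVertex,
            refNormal] at hj' ⊢ <;> ring
      simp [this]
  rw [← hb, ← hdiv]
  have hc : ∀ l, Continuous fun x => fderiv ℝ φ x (basisVec l) := fun l =>
    (contDiff_fderiv_apply (m := 0) hφ (by simp) _).continuous
  have hφc := hφ.continuous
  simp only [hasDerivAt_sq_mul_sub hφ]
  refine setIntegral_mono_on ?_ ?_ isClosed_refTriangle.measurableSet ?_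
  · exact Continuous.continuousOn (by fun_prop) |>.integrableOn_compact isCompact_refTriangle
  · exact Continuous.continuousOn (by fun_prop) |>.integrableOn_compact isCompact_refTriangle
  · intro x hx
    have hd : ∀ l, (x l - refVertex (j + 2) l) ^ 2 ≤ 1 := by
      intro l
      obtain ⟨h0, h1, h2⟩ := hx
      rw [sq_le_one_iff_abs_le_one, abs_le]
      fin_cases j <;> fin_cases l <;> simp [refVertex] <;> first | linarith | (constructor <;> linarith)
    have hl : ∀ l, 2 * φ x * fderiv ℝ φ x (basisVec l) * (x l - refVertex (j + 2) l) ≤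
        φ x ^ 2 + fderiv ℝ φ x (basisVec l) ^ 2 := by
      intro l
      nlinarith [sq_nonneg (φ x * (x l - refVertex (j + 2) l) - fderiv ℝ φ x (basisVec l)),
        mul_nonneg (sq_nonneg (φ x)) (sub_nonneg.2 (hd l))]
    simp only [Fin.sum_univ_two]
    linarith [hl 0, hl 1]

theorem IsElementMap.trace_le {p : PolyPair} (hp : IsElementMap p) (j : Fin 3) :
    ∃ C : ℝ, 0 ≤ C ∧ ∀ φ : Plane → ℝ, ContDiff ℝ 1 φ →
      ∫ x, φ x ^ 2 ∂(sideMeasure p j) ≤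
        C * ∫ x in openElement p, (φ x ^ 2 + ∑ i, fderiv ℝ φ x (basisVec i) ^ 2) := by
  obtain ⟨c, hc, hcJ⟩ := hp.exists_le_abs_det
  obtain ⟨S, hS⟩ := ((isCompact_Icc (a := (0 : ℝ)) (b := 1)).image
    (continuous_speed p j)).isBounded.exists_norm_le
  have hK : ∀ i l, ∃ K, ∀ x ∈ refTriangle, ‖polyJacobian p x i l‖ ≤ K := fun i l => by
    obtain ⟨K, hK⟩ := (isCompact_refTriangle.image
      (contDiff_polyJacobian (n := 0) p i l).continuous).isBounded.exists_norm_le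
    exact ⟨K, fun x hx => hK _ ⟨x, hx, rfl⟩⟩
  choose K hK using hK
  set L : ℝ := ∑ i, ∑ l, K i l ^ 2 with hL
  have hL0 : 0 ≤ L := by positivity
  have hS0 : 0 ≤ S := (norm_nonneg _).trans (hS _ ⟨0, by simp, rfl⟩)
  -- `S` bounds the speed of the side, `L` the squared entries of `Dψ` in total, and `c` bounds
  -- `|det Dψ|` from below. The factor 2 in front of `L` is slack.
  refine ⟨S * (4 + 2 * L) / c, by positivity, fun φ hφ => ?_⟩
  have hφc := hφ.continuous
  have hψc := continuous_polyMap p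
  have hdc : ∀ l, Continuous fun x => fderiv ℝ φ x (basisVec l) := fun l =>
    (contDiff_fderiv_apply (m := 0) hφ (by simp) _).continuous
  have hφψ : ContDiff ℝ 1 fun x => φ (polyMap p x) := hφ.comp (contDiff_polyMap p)
  have hdψc : ∀ l, Continuous fun x => fderiv ℝ (fun x => φ (polyMap p x)) x (basisVec l) :=
    fun l => (contDiff_fderiv_apply (m := 0) hφψ (by simp) _).continuous
  have hdet := continuous_det_polyJacobian p
  rw [integral_sideMeasure (F := fun x => φ x ^ 2)
    (hφc.pow 2).continuousOn.aestronglyMeasurable_sideMeasure, hp.setIntegral_openElement]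
  calc ∫ t in (0 : ℝ)..1, ‖sideTangent p j (refSide j t)‖ * φ (polyMap p (refSide j t)) ^ 2
      ≤ ∫ t in (0 : ℝ)..1, S * φ (polyMap p (refSide j t)) ^ 2 := by
        have k1 := continuous_speed p j
        have k2 := hφc.comp (continuous_side p j)
        refine intervalIntegral.integral_mono_on zero_le_one
          ((k1.mul (k2.pow 2)).intervalIntegrable _ _)
          ((continuous_const.mul (k2.pow 2)).intervalIntegrable _ _) fun t ht => ?_
        refine mul_le_mul_of_nonneg_right ?_ (sq_nonneg _)
        simpa using hS _ ⟨t, ht, rfl⟩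
    _ = S * ∫ t in (0 : ℝ)..1, φ (polyMap p (refSide j t)) ^ 2 :=
        intervalIntegral.integral_const_mul _ _
    _ ≤ S * ∫ x in refTriangle, (4 * φ (polyMap p x) ^ 2 +
          ∑ l, fderiv ℝ (fun x => φ (polyMap p x)) x (basisVec l) ^ 2) :=
        mul_le_mul_of_nonneg_left (refTriangle_trace_le hφψ j) hS0
    _ = ∫ x in refTriangle, S * (4 * φ (polyMap p x) ^ 2 +
          ∑ l, fderiv ℝ (fun x => φ (polyMap p x)) x (basisVec l) ^ 2) :=
        (integral_const_mul _ _).symm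
    _ ≤ ∫ x in refTriangle, S * (4 + 2 * L) / c * (|(polyJacobian p x).det| *
          (φ (polyMap p x) ^ 2 + ∑ i, fderiv ℝ φ (polyMap p x) (basisVec i) ^ 2)) := by
        refine setIntegral_mono_on ?_ ?_ isClosed_refTriangle.measurableSet ?_
        · exact Continuous.continuousOn (by fun_prop) |>.integrableOn_compact isCompact_refTriangle
        · refine Continuous.continuousOn ?_ |>.integrableOn_compact isCompact_refTriangle
          exact continuous_const.mul (hdet.abs.mul (((hφc.comp hψc).pow 2).add
            (continuous_finsetSum _ fun i _ => ((hdc i).comp hψc).pow 2)))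
        · intro x hx
          set E := φ (polyMap p x) ^ 2 + ∑ i, fderiv ℝ φ (polyMap p x) (basisVec i) ^ 2 with hE
          have hE0 : 0 ≤ E := by positivity
          have h1 : ∑ l, fderiv ℝ (fun x => φ (polyMap p x)) x (basisVec l) ^ 2 ≤
              2 * L * ∑ i, fderiv ℝ φ (polyMap p x) (basisVec i) ^ 2 := by
            have hK2 : ∀ i l, polyJacobian p x i l ^ 2 ≤ K i l ^ 2 := fun i l =>
              sq_le_sq' (by linarith [abs_le.1 (hK i l x hx)]) (abs_le.1 (hK i l x hx)).2
            have h2 : ∀ l, fderiv ℝ (fun x => φ (polyMap p x)) x (basisVec l) ^ 2 ≤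
                (∑ i, fderiv ℝ φ (polyMap p x) (basisVec i) ^ 2) * ∑ i, K i l ^ 2 := by
              intro l
              rw [fderiv_comp_polyMap hφ]
              refine (Finset.sum_mul_sq_le_sq_mul_sq _ _ _).trans ?_
              exact mul_le_mul_of_nonneg_left (Finset.sum_le_sum fun i _ => hK2 i l)
                (by positivity)
            refine (Finset.sum_le_sum fun l _ => h2 l).trans ?_
            rw [← Finset.mul_sum, Finset.sum_comm, ← hL, mul_comm]
            have : 0 ≤ L * ∑ i, fderiv ℝ φ (polyMap p x) (basisVec i) ^ 2 := by positivity
            linarith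
          have h3 : 4 * φ (polyMap p x) ^ 2 +
              ∑ l, fderiv ℝ (fun x => φ (polyMap p x)) x (basisVec l) ^ 2 ≤ (4 + 2 * L) * E := by
            have i1 : 0 ≤ ∑ i, fderiv ℝ φ (polyMap p x) (basisVec i) ^ 2 := by positivity
            have i2 : 0 ≤ L * φ (polyMap p x) ^ 2 := by positivity
            rw [hE]
            nlinarith
          have h4 : E ≤ |(polyJacobian p x).det| * E / c := by
            rw [le_div_iff₀ hc, mul_comm]
            exact mul_le_mul_of_nonneg_right (hcJ x hx) hE0
          calc S * (4 * φ (polyMap p x) ^ 2 +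
              ∑ l, fderiv ℝ (fun x => φ (polyMap p x)) x (basisVec l) ^ 2)
              ≤ S * ((4 + 2 * L) * (|(polyJacobian p x).det| * E / c)) :=
                mul_le_mul_of_nonneg_left (h3.trans
                  (mul_le_mul_of_nonneg_left h4 (by positivity))) hS0
            _ = S * (4 + 2 * L) / c * (|(polyJacobian p x).det| * E) := by ring
    _ = _ := integral_const_mul _ _

theorem sqrt_add_le_add_sqrt {a b : ℝ} (ha : 0 ≤ a) (hb : 0 ≤ b) : √(a + b) ≤ √a + √b := by
  refine Real.sqrt_le_iff.2 ⟨by positivity, ?_⟩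
  have h : 0 ≤ √a * √b := by positivity
  nlinarith [Real.sq_sqrt ha, Real.sq_sqrt hb]

theorem eLpNorm_two_eq_ofReal_sqrt {α : Type*} [MeasurableSpace α] {μ : Measure α} {f : α → ℝ}
    (hf : MemLp f 2 μ) : eLpNorm f 2 μ = ENNReal.ofReal (√(∫ x, f x ^ 2 ∂μ)) := by
  rw [hf.eLpNorm_eq_integral_rpow_norm (by norm_num) (by norm_num), Real.sqrt_eq_rpow]
  simp

theorem isBounded_openElement (p : PolyPair) : Bornology.IsBounded (openElement p) :=
  (isCompact_element p).isBounded.subset (openElement_subset_element p)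

/-- In this form the trace inequality says that restriction to a side is continuous from the `H¹`
norm of the element to `L²` of the side. -/
theorem IsElementMap.eLpNorm_trace_le {p : PolyPair} (hp : IsElementMap p) (j : Fin 3) :
    ∃ C : ENNReal, C ≠ ⊤ ∧ ∀ φ : Plane → ℝ, ContDiff ℝ 1 φ →
      eLpNorm φ 2 (sideMeasure p j) ≤ C * (eLpNorm φ 2 (volume.restrict (openElement p)) +
        ∑ i, eLpNorm (fun x => fderiv ℝ φ x (basisVec i)) 2 (volume.restrict (openElement p))) := by
  obtain ⟨C, hC, hle⟩ := hp.trace_le j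
  refine ⟨ENNReal.ofReal (√C), ENNReal.ofReal_ne_top, fun φ hφ => ?_⟩
  have hb := isBounded_openElement p
  have hdc : ∀ l, Continuous fun x => fderiv ℝ φ x (basisVec l) := fun l =>
    (contDiff_fderiv_apply (m := 0) hφ (by simp) _).continuous
  have m1 := hφ.continuous.memLp_two_restrict_of_isBounded hb
  have m2 := fun i => (hdc i).memLp_two_restrict_of_isBounded hb
  rw [eLpNorm_two_eq_ofReal_sqrt hφ.continuous.continuousOn.memLp_sideMeasure,
    eLpNorm_two_eq_ofReal_sqrt m1]
  simp only [fun i => eLpNorm_two_eq_ofReal_sqrt (m2 i), Fin.sum_univ_two]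
  rw [← ENNReal.ofReal_add (by positivity) (by positivity),
    ← ENNReal.ofReal_add (by positivity) (by positivity), ← ENNReal.ofReal_mul (by positivity)]
  refine ENNReal.ofReal_le_ofReal ?_
  refine (Real.sqrt_le_sqrt (hle φ hφ)).trans ?_
  rw [Real.sqrt_mul hC]
  refine mul_le_mul_of_nonneg_left ?_ (Real.sqrt_nonneg _)
  have i1 := m1.integrable_sq
  have i2 := fun i => (m2 i).integrable_sq
  simp only [Fin.sum_univ_two]
  rw [integral_add (g := fun x => fderiv ℝ φ x (basisVec 0) ^ 2 + fderiv ℝ φ x (basisVec 1) ^ 2)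
    i1 ((i2 0).add (i2 1)), integral_add (i2 0) (i2 1)]
  have n : ∀ f : Plane → ℝ, 0 ≤ ∫ x in openElement p, f x ^ 2 := fun f =>
    integral_nonneg fun x => sq_nonneg _
  exact (sqrt_add_le_add_sqrt (n _) (add_nonneg (n _) (n _))).trans
    (add_le_add le_rfl (sqrt_add_le_add_sqrt (n _) (n _)))

/-! ### Mollification -/

/-- The mollification of `w` with the kernel `ρ`. -/
def mollify (ρ : ContDiffBump (0 : Plane)) (w : Plane → ℝ) (x : Plane) : ℝ :=
  ∫ t, ρ.normed volume t * w (x - t)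

theorem mollify_eq_convolution (ρ : ContDiffBump (0 : Plane)) (w : Plane → ℝ) :
    mollify ρ w = convolution (ρ.normed volume) w (ContinuousLinearMap.lsmul ℝ ℝ) volume := rfl

theorem contDiff_mollify (ρ : ContDiffBump (0 : Plane)) {w : Plane → ℝ}
    (hw : LocallyIntegrable w volume) : ContDiff ℝ ((⊤ : ℕ∞) : WithTop ℕ∞) (mollify ρ w) := by
  rw [mollify_eq_convolution]
  exact ρ.hasCompactSupport_normed.contDiff_convolution_left _ ρ.contDiff_normed hw

theorem mollify_sub (ρ : ContDiffBump (0 : Plane)) {w w' : Plane → ℝ}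
    (hw : LocallyIntegrable w volume) (hw' : LocallyIntegrable w' volume) (x : Plane) :
    mollify ρ (w - w') x = mollify ρ w x - mollify ρ w' x := by
  have h := fun (w : Plane → ℝ) (hw : LocallyIntegrable w volume) =>
    (ρ.hasCompactSupport_normed (μ := volume)).convolutionExists_left
      (ContinuousLinearMap.lsmul ℝ ℝ) ρ.continuous_normed (μ := volume) hw x
  unfold mollify
  rw [← integral_sub]
  · congr 1
    ext t
    simp only [Pi.sub_apply]
    ring
  · exact h w hw
  · exact h w' hw'

/-- The derivative first falls on the kernel. Since the ball around `x` lies in `U`, the shifted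
kernel is a test function in `U`, and the definition of the weak derivative moves the derivative on
to `w`. Near the boundary this fails, as the extension by zero need not be weakly differentiable. -/
theorem fderiv_mollify (ρ : ContDiffBump (0 : Plane)) {U : Set Plane} (hU : IsOpen U)
    {w g : Plane → ℝ} {i : Fin 2} (hw : LocallyIntegrable (U.indicator w) volume)
    (h : IsWeakPartial U i w g) {x : Plane} (hx : Metric.closedBall x ρ.rOut ⊆ U) :
    fderiv ℝ (mollify ρ (U.indicator w)) x (basisVec i) = mollify ρ (U.indicator g) x := by
  set r : Plane → ℝ := ρ.normed volume with hr
  have hrs : ContDiff ℝ ((⊤ : ℕ∞) : WithTop ℕ∞) r := ρ.contDiff_normed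
  have hrc : HasCompactSupport r := ρ.hasCompactSupport_normed
  have h1 := hrc.hasFDerivAt_convolution_left (ContinuousLinearMap.lsmul ℝ ℝ)
    (hrs.of_le (by simp)) hw x
  have hd' : Continuous (fderiv ℝ r) := hrs.continuous_fderiv (by simp)
  have hint := (hrc.fderiv ℝ).convolutionExists_left
    ((ContinuousLinearMap.lsmul ℝ ℝ : ℝ →L[ℝ] ℝ →L[ℝ] ℝ).precompL Plane) hd' hw x
  have h2 : fderiv ℝ (mollify ρ (U.indicator w)) x (basisVec i) =
      ∫ t, fderiv ℝ r t (basisVec i) * U.indicator w (x - t) := by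
    have h3 : fderiv ℝ (mollify ρ (U.indicator w)) x = _ := h1.fderiv
    rw [h3, convolution_def, ContinuousLinearMap.integral_apply hint]
    rfl
  set φ : Plane → ℝ := fun s => r (x - s) with hφ
  have hφs : ContDiff ℝ ((⊤ : ℕ∞) : WithTop ℕ∞) φ := hrs.comp (contDiff_const.sub contDiff_id)
  have hφd : ∀ s, fderiv ℝ φ s (basisVec i) = -fderiv ℝ r (x - s) (basisVec i) := by
    intro s
    have e1 : HasFDerivAt (fun s : Plane => x - s) (-ContinuousLinearMap.id ℝ Plane) s :=
      (hasFDerivAt_id s).const_sub x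
    have e2 := ((hrs.differentiable (by simp)) (x - s)).hasFDerivAt.comp s e1
    have e3 : fderiv ℝ φ s = _ := e2.fderiv
    rw [e3]
    simp
  have hsupp : ∀ s, s ∉ Metric.closedBall x ρ.rOut → φ s = 0 := by
    intro s hs
    apply image_eq_zero_of_notMem_tsupport (f := r)
    rw [hr, ρ.tsupport_normed_eq]
    intro hm
    apply hs
    rw [mem_closedBall_zero_iff] at hm
    rwa [Metric.mem_closedBall, dist_comm, dist_eq_norm]
  have hts : tsupport φ ⊆ Metric.closedBall x ρ.rOut := by
    refine closure_minimal (fun s hs => ?_) Metric.isClosed_closedBall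
    by_contra hn
    exact hs (hsupp s hn)
  have hφc : HasCompactSupport φ :=
    HasCompactSupport.of_support_subset_isCompact (isCompact_closedBall x ρ.rOut)
      (subset_closure.trans hts)
  have key := h.2.2 φ hφs hφc (hts.trans hx)
  have swap : ∀ F : Plane → Plane → ℝ, ∫ t, F t (x - t) = ∫ s, F (x - s) s := by
    intro F
    have := integral_sub_left_eq_self (fun t => F t (x - t)) volume x
    rw [← this]
    simp
  rw [h2, swap fun t s => fderiv ℝ r t (basisVec i) * U.indicator w s]
  unfold mollify
  rw [swap fun t s => r t * U.indicator g s]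
  have e1 : ∫ s, fderiv ℝ r (x - s) (basisVec i) * U.indicator w s =
      -∫ s in U, w s * fderiv ℝ φ s (basisVec i) := by
    rw [← integral_indicator hU.measurableSet, ← integral_neg]
    congr 1
    ext s
    by_cases hs : s ∈ U
    · simp only [Set.indicator_of_mem hs, hφd]; ring
    · simp [Set.indicator_of_notMem hs]
  have e2 : ∫ s, r (x - s) * U.indicator g s = ∫ s in U, g s * φ s := by
    rw [← integral_indicator hU.measurableSet]
    congr 1
    ext s
    by_cases hs : s ∈ U
    · simp only [Set.indicator_of_mem hs, hφ]; ring
    · simp [Set.indicator_of_notMem hs]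
  rw [e1, e2, key, neg_neg]

theorem eLpNorm_two_sq {α : Type*} [MeasurableSpace α] (μ : Measure α) (f : α → ℝ) :
    eLpNorm f 2 μ ^ 2 = ∫⁻ x, ‖f x‖ₑ ^ 2 ∂μ := by
  rw [eLpNorm_eq_lintegral_rpow_enorm_toReal (by norm_num) (by norm_num)]
  simp only [ENNReal.toReal_ofNat, ENNReal.rpow_ofNat]
  rw [← ENNReal.rpow_natCast, ← ENNReal.rpow_mul]
  simp

/-- Mollification averages translates of `w` with respect to a probability measure: Jensen's
inequality, in the form `L¹ ≤ L²`, then Tonelli and translation invariance. -/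
theorem eLpNorm_mollify_le (ρ : ContDiffBump (0 : Plane)) {w : Plane → ℝ} (hw : Measurable w) :
    eLpNorm (mollify ρ w) 2 volume ≤ eLpNorm w 2 volume := by
  set ν : Measure Plane := volume.withDensity fun t => ENNReal.ofReal (ρ.normed volume t) with hν
  have hmeas : Measurable fun t => ENNReal.ofReal (ρ.normed volume t) :=
    ρ.continuous_normed.measurable.ennreal_ofReal
  have hprob : IsProbabilityMeasure ν := by
    constructor
    rw [hν, withDensity_apply _ MeasurableSet.univ, Measure.restrict_univ,
      ← ofReal_integral_eq_lintegral_ofReal ρ.integrable_normed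
        (Eventually.of_forall ρ.nonneg_normed), ρ.integral_normed, ENNReal.ofReal_one]
  have hmol : ∀ x, mollify ρ w x = ∫ t, w (x - t) ∂ν := by
    intro x
    rw [hν, integral_withDensity_eq_integral_toReal_smul hmeas (by simp)]
    unfold mollify
    congr 1
    ext t
    rw [ENNReal.toReal_ofReal (ρ.nonneg_normed t), smul_eq_mul]
  have hpt : ∀ x, ‖mollify ρ w x‖ₑ ^ 2 ≤ ∫⁻ t, ‖w (x - t)‖ₑ ^ 2 ∂ν := by
    intro x
    have hm : Measurable fun t => w (x - t) := hw.comp (measurable_const.sub measurable_id)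
    rw [hmol x, ← eLpNorm_two_sq]
    refine pow_le_pow_left' ?_ 2
    calc ‖∫ t, w (x - t) ∂ν‖ₑ ≤ ∫⁻ t, ‖w (x - t)‖ₑ ∂ν := enorm_integral_le_lintegral_enorm _
      _ = eLpNorm (fun t => w (x - t)) 1 ν := eLpNorm_one_eq_lintegral_enorm.symm
      _ ≤ _ := eLpNorm_le_eLpNorm_of_exponent_le (by norm_num) hm.aestronglyMeasurable
  have h2 : eLpNorm (mollify ρ w) 2 volume ^ 2 ≤ eLpNorm w 2 volume ^ 2 := by
    rw [eLpNorm_two_sq, eLpNorm_two_sq]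
    calc ∫⁻ x, ‖mollify ρ w x‖ₑ ^ 2 ≤ ∫⁻ x, (∫⁻ t, ‖w (x - t)‖ₑ ^ 2 ∂ν) := lintegral_mono hpt
      _ = ∫⁻ t, (∫⁻ x, ‖w (x - t)‖ₑ ^ 2) ∂ν := by
          refine lintegral_lintegral_swap ?_
          refine Measurable.aemeasurable ?_
          exact ((hw.comp (measurable_fst.sub measurable_snd)).enorm).pow_const 2
      _ = ∫⁻ _, (∫⁻ x, ‖w x‖ₑ ^ 2) ∂ν := by
          congr 1
          ext t
          exact lintegral_sub_right_eq_self (fun x => ‖w x‖ₑ ^ 2) t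
      _ = ∫⁻ x, ‖w x‖ₑ ^ 2 := by simp
  exact (ENNReal.pow_le_pow_left_iff (by norm_num)).1 h2

/-- Dominated convergence for the squares, with majorant `K² |f|²`. -/
theorem tendsto_eLpNorm_mul_of_bounded {α : Type*} [MeasurableSpace α] {μ : Measure α}
    {f : α → ℝ} (hf : MemLp f 2 μ) {b : ℕ → α → ℝ} {K : ℝ}
    (hb : ∀ m, AEStronglyMeasurable (b m) μ) (hK : ∀ m, ∀ᵐ x ∂μ, ‖b m x‖ ≤ K)
    (hlim : ∀ᵐ x ∂μ, Tendsto (fun m => b m x) atTop (𝓝 0)) :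
    Tendsto (fun m => eLpNorm (fun x => b m x * f x) 2 μ) atTop (𝓝 0) := by
  have key : Tendsto (fun m => ∫⁻ x, ‖b m x * f x‖ₑ ^ 2 ∂μ) atTop (𝓝 (∫⁻ _, 0 ∂μ)) := by
    refine tendsto_lintegral_of_dominated_convergence'
      (fun x => (ENNReal.ofReal K * ‖f x‖ₑ) ^ 2) ?_ ?_ ?_ ?_
    · intro m
      exact ((hb m).mul hf.1).enorm.pow_const 2
    · intro m
      filter_upwards [hK m] with x hx
      rw [enorm_mul]
      refine pow_le_pow_left' (mul_le_mul_left ?_ _) 2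
      rw [← ofReal_norm]
      exact ENNReal.ofReal_le_ofReal hx
    · simp only [mul_pow]
      rw [lintegral_const_mul' _ _ (by finiteness), ← eLpNorm_two_sq]
      exact ENNReal.mul_ne_top (by finiteness) (ENNReal.pow_ne_top hf.2.ne)
    · filter_upwards [hlim] with x hx
      have h1 : Tendsto (fun m => ‖b m x * f x‖ₑ ^ 2) atTop (𝓝 (‖(0 : ℝ) * f x‖ₑ ^ 2)) :=
        ((ENNReal.continuous_pow 2).comp continuous_enorm).continuousAt.tendsto.comp
          (hx.mul_const (f x))
      simpa using h1
  simp only [lintegral_zero, ← eLpNorm_two_sq] at key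
  have h2 := key.ennrpow_const (1 / 2 : ℝ)
  simp only [← ENNReal.rpow_natCast, ← ENNReal.rpow_mul] at h2
  simpa using h2

/-! ### Density of functions that are smooth up to the boundary -/

/-- The dilation of the plane about the centroid of the reference triangle. -/
def dilate (l : ℝ) (x : Plane) : Plane := (1 - l) • (!₂[1 / 3, 1 / 3] : Plane) + l • x

theorem dilate_one (x : Plane) : dilate 1 x = x := by simp [dilate]

theorem continuous_dilate : Continuous fun z : ℝ × Plane => dilate z.1 z.2 := by
  unfold dilate; fun_prop

theorem dilate_mem {l : ℝ} (h0 : 0 ≤ l) (h1 : l < 1) {x : Plane} (hx : x ∈ refTriangle) :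
    dilate l x ∈ refOpenTriangle := by
  obtain ⟨x0, x1, x2⟩ := hx
  have e0 : 0 ≤ l * x 0 := by positivity
  have e1 : 0 ≤ l * x 1 := by positivity
  refine ⟨?_, ?_, ?_⟩ <;> simp [dilate] <;> nlinarith

theorem dilate_injective {l : ℝ} (h0 : l ≠ 0) : Function.Injective (dilate l) := by
  intro x y h
  simpa [dilate, h0] using h

theorem hasFDerivAt_polyMap_dilate (p : PolyPair) (l : ℝ) (x : Plane) :
    HasFDerivAt (fun x => polyMap p (dilate l x)) (l • polyDeriv p (dilate l x)) x := by
  have h1 : HasFDerivAt (dilate l) (l • ContinuousLinearMap.id ℝ Plane) x :=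
    ((hasFDerivAt_id x).const_smul l).const_add _
  have h2 := (hasFDerivAt_polyMap p (dilate l x)).comp x h1
  have e : (polyDeriv p (dilate l x)).comp (l • ContinuousLinearMap.id ℝ Plane) =
      l • polyDeriv p (dilate l x) := by
    ext v i; simp
  rwa [e] at h2

theorem eLpNorm_comp_le {Ψ : Plane → Plane} {Ψ' : Plane → Plane →L[ℝ] Plane}
    (hΨ : ∀ x ∈ refOpenTriangle, HasFDerivAt Ψ (Ψ' x) x) (hinj : Set.InjOn Ψ refOpenTriangle)
    {c : ℝ} (hc : 0 < c) (hdet : ∀ x ∈ refOpenTriangle, c ≤ |(Ψ' x).det|) (H : Plane → ℝ) :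
    eLpNorm (fun x => H (Ψ x)) 2 (volume.restrict refTriangle) ≤
      ENNReal.ofReal (√c⁻¹) * eLpNorm H 2 volume := by
  refine (ENNReal.pow_le_pow_left_iff (n := 2) (by norm_num)).1 ?_
  rw [mul_pow, ← ENNReal.ofReal_pow (Real.sqrt_nonneg _), Real.sq_sqrt (by positivity),
    eLpNorm_two_sq, eLpNorm_two_sq, ← restrict_refOpenTriangle]
  have hm := isOpen_refOpenTriangle.measurableSet
  calc ∫⁻ x in refOpenTriangle, ‖H (Ψ x)‖ₑ ^ 2
      ≤ ∫⁻ x in refOpenTriangle, ENNReal.ofReal c⁻¹ *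
          (ENNReal.ofReal |(Ψ' x).det| * ‖H (Ψ x)‖ₑ ^ 2) := by
        refine setLIntegral_mono' hm fun x hx => ?_
        rw [← mul_assoc, ← ENNReal.ofReal_mul (by positivity)]
        refine le_mul_of_one_le_left (by positivity) ?_
        rw [← ENNReal.ofReal_one]
        refine ENNReal.ofReal_le_ofReal ?_
        rw [inv_mul_eq_div, le_div_iff₀ hc, one_mul]
        exact hdet x hx
    _ = ENNReal.ofReal c⁻¹ * ∫⁻ x in Ψ '' refOpenTriangle, ‖H x‖ₑ ^ 2 := by
        rw [lintegral_const_mul' _ _ ENNReal.ofReal_ne_top,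
          lintegral_image_eq_lintegral_abs_det_fderiv_mul volume hm
            (fun x hx => (hΨ x hx).hasFDerivWithinAt) hinj]
    _ ≤ ENNReal.ofReal c⁻¹ * ∫⁻ x, ‖H x‖ₑ ^ 2 := by
        gcongr
        exact Measure.restrict_le_self

theorem IsElementMap.exists_eLpNorm_le_comp {p : PolyPair} (hp : IsElementMap p) :
    ∃ C : ENNReal, C ≠ ⊤ ∧ ∀ H : Plane → ℝ, eLpNorm H 2 (volume.restrict (openElement p)) ≤
      C * eLpNorm (fun x => H (polyMap p x)) 2 (volume.restrict refTriangle) := by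
  obtain ⟨K, hK⟩ := (isCompact_refTriangle.image
    (continuous_det_polyJacobian p)).isBounded.exists_norm_le
  have hK0 : 0 ≤ K := (norm_nonneg _).trans (hK _ ⟨_, refVertex_mem 0, rfl⟩)
  refine ⟨ENNReal.ofReal (√K), ENNReal.ofReal_ne_top, fun H => ?_⟩
  refine (ENNReal.pow_le_pow_left_iff (n := 2) (by norm_num)).1 ?_
  rw [mul_pow, ← ENNReal.ofReal_pow (Real.sqrt_nonneg _), Real.sq_sqrt hK0,
    eLpNorm_two_sq, eLpNorm_two_sq, hp.setLIntegral_openElement,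
    ← lintegral_const_mul' _ _ ENNReal.ofReal_ne_top]
  refine setLIntegral_mono' isClosed_refTriangle.measurableSet fun x hx => ?_
  gcongr
  exact hK _ ⟨x, hx, rfl⟩

/-- A dilation by a factor below one maps the closed triangle into the open one. The image under `ψ`
is a compact subset of the open element, which leaves room for a kernel of positive radius. -/
theorem IsElementMap.exists_mollifiers {p : PolyPair} (hp : IsElementMap p) :
    ∃ (l : ℕ → ℝ) (ρ : ℕ → ContDiffBump (0 : Plane)), (∀ m, 1 / 2 ≤ l m ∧ l m < 1) ∧
      Tendsto l atTop (𝓝 1) ∧ Tendsto (fun m => (ρ m).rOut) atTop (𝓝 0) ∧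
      ∀ m, ∀ x ∈ refTriangle,
        Metric.closedBall (polyMap p (dilate (l m) x)) (ρ m).rOut ⊆ openElement p := by
  -- The denominator starts at 2, so that `l m ≥ 1 / 2` and the Jacobians of the dilations stay
  -- bounded away from zero.
  set l : ℕ → ℝ := fun m => 1 - 1 / ((m : ℝ) + 1 + 1) with hl
  have hlb : ∀ m, 1 / 2 ≤ l m ∧ l m < 1 := by
    intro m
    have h2 : (0 : ℝ) < (m : ℝ) + 1 + 1 := by positivity
    have h3 : 1 / ((m : ℝ) + 1 + 1) ≤ 1 / 2 := by
      apply one_div_le_one_div_of_le (by norm_num)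
      have : (0 : ℝ) ≤ m := Nat.cast_nonneg m
      linarith
    have h4 : 0 < 1 / ((m : ℝ) + 1 + 1) := by positivity
    simp only [hl]
    constructor <;> linarith
  have hr : ∀ m : ℕ, ∃ r : ℝ, 0 < r ∧ r ≤ 1 / ((m : ℝ) + 1) ∧ ∀ x ∈ refTriangle,
      Metric.closedBall (polyMap p (dilate (l m) x)) r ⊆ openElement p := by
    intro m
    have hK : IsCompact ((fun x => polyMap p (dilate (l m) x)) '' refTriangle) :=
      isCompact_refTriangle.image ((continuous_polyMap p).comp
        (continuous_dilate.comp (continuous_const.prodMk continuous_id)))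
    obtain ⟨δ, hδ, hsub⟩ := hK.exists_cthickening_subset_open hp.isOpen_openElement (by
      rintro _ ⟨x, hx, rfl⟩
      exact ⟨_, dilate_mem (by linarith [(hlb m).1]) (hlb m).2 hx, rfl⟩)
    refine ⟨min δ (1 / ((m : ℝ) + 1)), by positivity, min_le_right _ _, ?_⟩
    intro x hx
    have hmem : polyMap p (dilate (l m) x) ∈
        (fun x => polyMap p (dilate (l m) x)) '' refTriangle := ⟨x, hx, rfl⟩
    have hsub2 := (Metric.closedBall_subset_cthickening hmem δ).trans hsub
    refine Set.Subset.trans ?_ hsub2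
    exact Metric.closedBall_subset_closedBall (min_le_left _ _)
  choose r hr0 hr1 hr2 using hr
  refine ⟨l, fun m => ⟨r m / 2, r m, by linarith [hr0 m], by linarith [hr0 m]⟩, hlb, ?_, ?_, hr2⟩
  · have h := (tendsto_one_div_add_atTop_nhds_zero_nat (𝕜 := ℝ)).comp (tendsto_add_atTop_nat 1)
    have h2 := h.const_sub 1
    simp only [sub_zero] at h2
    refine h2.congr fun m => ?_
    simp [hl]
  · exact squeeze_zero (fun m => (hr0 m).le) hr1 tendsto_one_div_add_atTop_nhds_zero_nat

/-- Mollifying and then composing with `ψ ∘ dilate` is bounded on `L²` uniformly in `m`. It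
therefore suffices to treat continuous functions `k` with compact support, for which the convergence
is pointwise and bounded; the rest is an `ε / 3` argument. -/
theorem IsElementMap.tendsto_mollify_dilate {p : PolyPair} (hp : IsElementMap p) {l : ℕ → ℝ}
    {ρ : ℕ → ContDiffBump (0 : Plane)} (hl : ∀ m, 1 / 2 ≤ l m ∧ l m < 1)
    (hl1 : Tendsto l atTop (𝓝 1)) (hρ : Tendsto (fun m => (ρ m).rOut) atTop (𝓝 0))
    {h : Plane → ℝ} (hm : Measurable h) (hh : MemLp h 2 volume) :
    Tendsto (fun m => eLpNorm (fun x => mollify (ρ m) h (polyMap p (dilate (l m) x)) -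
      h (polyMap p x)) 2 (volume.restrict refTriangle)) atTop (𝓝 0) := by
  obtain ⟨c, hc, hcJ⟩ := hp.exists_le_abs_det
  -- The Jacobian of `ψ ∘ dilate l` is `l² det Dψ`, which for `l ≥ 1 / 2` is at least `c / 4` in
  -- absolute value.
  set C : ENNReal := ENNReal.ofReal (√(c / 4)⁻¹) with hC
  have hCt : C ≠ ⊤ := ENNReal.ofReal_ne_top
  have hcomp : ∀ l : ℝ, 1 / 2 ≤ l → l ≤ 1 → ∀ H : Plane → ℝ,
      eLpNorm (fun x => H (polyMap p (dilate l x))) 2 (volume.restrict refTriangle) ≤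
        C * eLpNorm H 2 volume := by
    intro l h1 h2 H
    have hmem : ∀ x ∈ refOpenTriangle, dilate l x ∈ refTriangle := by
      intro x hx
      rcases lt_or_eq_of_le h2 with h3 | h3
      · exact refOpenTriangle_subset (dilate_mem (by linarith) h3 (refOpenTriangle_subset hx))
      · rw [h3, dilate_one]; exact refOpenTriangle_subset hx
    refine eLpNorm_comp_le (fun x _ => hasFDerivAt_polyMap_dilate p l x) ?_ (by positivity) ?_ H
    · intro x hx y hy hxy
      exact dilate_injective (by linarith) (hp.1 (hmem x hx) (hmem y hy) hxy)
    · intro x hx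
      have : (l • polyDeriv p (dilate l x)).det = l ^ 2 * (polyDeriv p (dilate l x)).det := by
        unfold ContinuousLinearMap.det
        rw [ContinuousLinearMap.toLinearMap_smul, LinearMap.det_smul]
        simp
      rw [this, det_polyDeriv, abs_mul, abs_of_nonneg (sq_nonneg l)]
      have h3 := hcJ _ (hmem x hx)
      have h4 : (1 / 4 : ℝ) ≤ l ^ 2 := by nlinarith
      nlinarith
  have hloc : ∀ {f : Plane → ℝ}, MemLp f 2 volume → LocallyIntegrable f volume := fun hf =>
    hf.locallyIntegrable (by norm_num)
  have hdc : ∀ m, Continuous (dilate (l m)) := fun m =>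
    continuous_dilate.comp (continuous_const.prodMk continuous_id)
  have hRc : ∀ m (f : Plane → ℝ), MemLp f 2 volume →
      Continuous fun x => mollify (ρ m) f (polyMap p (dilate (l m) x)) := fun m f hf =>
    (contDiff_mollify (ρ m) (hloc hf)).continuous.comp ((continuous_polyMap p).comp (hdc m))
  rw [ENNReal.tendsto_nhds_zero]
  intro ε hε
  rcases eq_or_ne ε ⊤ with rfl | hεt
  · exact Eventually.of_forall fun _ => le_top
  -- Dividing by `C + 1` rather than by `C` avoids the case `C = 0`.
  obtain ⟨δ, hδ0, hδ⟩ : ∃ δ : ENNReal, δ ≠ 0 ∧ C * δ ≤ ε / 3 := by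
    refine ⟨ε / 3 / (C + 1), ?_, ?_⟩
    · exact (ENNReal.div_pos (ENNReal.div_pos hε.ne' (by norm_num)).ne' (by finiteness)).ne'
    · calc C * (ε / 3 / (C + 1)) ≤ (C + 1) * (ε / 3 / (C + 1)) := by gcongr; exact le_self_add
        _ ≤ ε / 3 := ENNReal.mul_div_le
  obtain ⟨k, hks, hkδ, hkc, hkm⟩ := hh.exists_hasCompactSupport_eLpNorm_sub_le (by norm_num) hδ0
  have hkmeas : Measurable k := hkc.measurable
  obtain ⟨B, hB⟩ := hkc.bounded_above_of_compact_support hks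
  have hb : ∀ m x, ‖mollify (ρ m) k x‖ ≤ B := by
    intro m x
    unfold mollify
    have hi : Integrable (fun t => (ρ m).normed volume t * B) volume :=
      (ρ m).integrable_normed.mul_const B
    refine (norm_integral_le_of_norm_le hi (Eventually.of_forall fun t => ?_)).trans ?_
    · rw [norm_mul, Real.norm_of_nonneg ((ρ m).nonneg_normed t)]
      exact mul_le_mul_of_nonneg_left (hB _) ((ρ m).nonneg_normed t)
    · rw [integral_mul_const, (ρ m).integral_normed, one_mul]
  have hfin : IsFiniteMeasure (volume.restrict refTriangle) :=
    ⟨by rw [Measure.restrict_apply_univ]; exact isCompact_refTriangle.measure_lt_top⟩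
  have hmid : Tendsto (fun m => eLpNorm (fun x => (mollify (ρ m) k (polyMap p (dilate (l m) x)) -
      k (polyMap p x)) * 1) 2 (volume.restrict refTriangle)) atTop (𝓝 0) := by
    refine tendsto_eLpNorm_mul_of_bounded (K := B + B) (memLp_const 1) ?_ ?_ ?_
    · intro m
      exact ((hRc m k hkm).sub (hkc.comp (continuous_polyMap p))).aestronglyMeasurable
    · intro m
      exact Eventually.of_forall fun x => (norm_sub_le _ _).trans (add_le_add (hb _ _) (hB _))
    · refine Eventually.of_forall fun x => ?_
      rw [← sub_self (k (polyMap p x))]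
      refine Tendsto.sub_const ?_ _
      simp only [mollify_eq_convolution]
      refine ContDiffBump.convolution_tendsto_right (g := fun _ => k) hρ
        (Eventually.of_forall fun _ => hkc.aestronglyMeasurable)
        ((hkc.tendsto _).comp tendsto_snd) ?_
      have h1 : Tendsto (fun m => (l m, x)) atTop (𝓝 (1, x)) := hl1.prodMk_nhds tendsto_const_nhds
      have h2 := ((continuous_polyMap p).comp continuous_dilate).continuousAt.tendsto.comp h1
      simpa [Function.comp_def, dilate_one] using h2
  have hev := (ENNReal.tendsto_nhds_zero.1 hmid) (ε / 3) (ENNReal.div_pos hε.ne' (by norm_num))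
  filter_upwards [hev] with m hmε
  have hhk : MemLp (h - k) 2 volume := hh.sub hkm
  have e : (fun x => mollify (ρ m) h (polyMap p (dilate (l m) x)) - h (polyMap p x)) =
      ((fun x => mollify (ρ m) (h - k) (polyMap p (dilate (l m) x))) +
      fun x => (mollify (ρ m) k (polyMap p (dilate (l m) x)) - k (polyMap p x)) * 1) -
      fun x => (h - k) (polyMap p x) := by
    funext x
    simp only [Pi.add_apply, Pi.sub_apply, mollify_sub (ρ m) (hloc hh) (hloc hkm)]
    ring
  have hψm : AEStronglyMeasurable (fun x => (h - k) (polyMap p x)) (volume.restrict refTriangle) :=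
    ((hm.sub hkmeas).comp (continuous_polyMap p).measurable).aestronglyMeasurable
  have s1 : AEStronglyMeasurable (fun x => mollify (ρ m) (h - k) (polyMap p (dilate (l m) x)))
      (volume.restrict refTriangle) := (hRc m _ hhk).aestronglyMeasurable
  have s2 : AEStronglyMeasurable (fun x => (mollify (ρ m) k (polyMap p (dilate (l m) x)) -
      k (polyMap p x)) * 1) (volume.restrict refTriangle) :=
    (((hRc m k hkm).sub (hkc.comp (continuous_polyMap p))).mul continuous_const).aestronglyMeasurable
  rw [e]
  refine (eLpNorm_sub_le (s1.add s2) hψm (by norm_num)).trans ?_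
  have b1 : eLpNorm (fun x => mollify (ρ m) (h - k) (polyMap p (dilate (l m) x))) 2
      (volume.restrict refTriangle) ≤ ε / 3 := by
    refine (hcomp (l m) (hl m).1 (hl m).2.le _).trans (le_trans ?_ hδ)
    gcongr
    exact (eLpNorm_mollify_le _ (hm.sub hkmeas)).trans hkδ
  have b2 : eLpNorm (fun x => (h - k) (polyMap p x)) 2 (volume.restrict refTriangle) ≤ ε / 3 := by
    have := hcomp 1 (by norm_num) le_rfl (h - k)
    simp only [dilate_one] at this
    refine this.trans (le_trans ?_ hδ)
    gcongr
  calc _ ≤ (ε / 3 + ε / 3) + ε / 3 :=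
        add_le_add ((eLpNorm_add_le s1 s2 (by norm_num)).trans (add_le_add b1 hmε)) b2
    _ = ε := ENNReal.add_thirds ε

/-- `G ∘ ψ` is the identity near `x`, also at boundary points of the triangle, so the chain rule
gives one composition. The other follows because `Dψ(x)` is surjective. -/
theorem polyDeriv_fderiv_leftInverse {p : PolyPair} (hp : IsElementMap p) {G : Plane → Plane}
    (hG : ContDiff ℝ ((⊤ : ℕ∞) : WithTop ℕ∞) G)
    (hGl : ∀ᶠ x in 𝓝ˢ refTriangle, G (polyMap p x) = x) {x : Plane} (hx : x ∈ refTriangle)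
    (v : Plane) : polyDeriv p x (fderiv ℝ G (polyMap p x) v) = v ∧
      fderiv ℝ G (polyMap p x) (polyDeriv p x v) = v := by
  have h1 := ((hG.differentiable (by simp)) (polyMap p x)).hasFDerivAt.comp x
    (hasFDerivAt_polyMap p x)
  have h2 : HasFDerivAt (G ∘ polyMap p) (ContinuousLinearMap.id ℝ Plane) x := by
    refine (hasFDerivAt_id x).congr_of_eventuallyEq ?_
    exact eventually_nhdsSet_iff_forall.1 hGl x hx
  have h3 := h1.unique h2
  have hl : ∀ v, fderiv ℝ G (polyMap p x) (polyDeriv p x v) = v := fun v =>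
    congrArg (fun L : Plane →L[ℝ] Plane => L v) h3
  refine ⟨?_, hl v⟩
  obtain ⟨u, rfl⟩ := (polyDerivEquiv p x (hp.2 x hx)).surjective v
  exact congrArg _ (hl u)

theorem fderiv_apply_eq_sum {F : Plane → ℝ} (y v : Plane) :
    fderiv ℝ F y v = ∑ l, fderiv ℝ F y (basisVec l) * v l := by
  have e : v = ∑ l, v l • basisVec l := by
    ext m
    fin_cases m <;> simp [basisVec, Fin.sum_univ_two]
  conv_lhs => rw [e]
  rw [map_sum]
  simp [mul_comm]

theorem MeasureTheory.MemLp.exists_measurable_indicator {U : Set Plane} (hU : IsOpen U)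
    {w : Plane → ℝ} (hw : MemLp w 2 (volume.restrict U)) :
    ∃ w' : Plane → ℝ, w =ᵐ[volume.restrict U] w' ∧ Measurable (U.indicator w') ∧
      MemLp (U.indicator w') 2 volume := by
  refine ⟨hw.1.mk w, hw.1.ae_eq_mk, hw.1.stronglyMeasurable_mk.measurable.indicator
    hU.measurableSet, ?_⟩
  rw [memLp_indicator_iff_restrict hU.measurableSet]
  exact (memLp_congr_ae hw.1.ae_eq_mk).1 hw

/-- The approximation evaluates the mollified `w` at `ψ(dilate l (ψ⁻¹ y))`. Shrinking towards the
centroid keeps the kernel inside the open element, where weak derivatives commute with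
mollification, and the global smooth extension `G` of `ψ⁻¹` makes the result smooth on the whole
plane. -/
theorem IsElementMap.exists_contDiff_tendsto {p : PolyPair} (hp : IsElementMap p) {w : Plane → ℝ}
    (hw : MemSobolev 1 (openElement p) w) :
    ∃ φ : ℕ → Plane → ℝ, (∀ m, ContDiff ℝ 1 (φ m)) ∧
      Tendsto (fun m => eLpNorm (fun x => φ m x - w x) 2 (volume.restrict (openElement p)))
        atTop (𝓝 0) ∧
      ∀ i : Fin 2, Tendsto (fun m => eLpNorm (fun x => fderiv ℝ (φ m) x (basisVec i) -
        weakPartial (openElement p) i w x) 2 (volume.restrict (openElement p))) atTop (𝓝 0) := by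
  set U := openElement p with hUdef
  have hU : IsOpen U := hp.isOpen_openElement
  obtain ⟨w', hww', hwm, hwL⟩ := hw.memLp.exists_measurable_indicator hU
  have hex := fun i => (hw.weakPartial hU i).memLp.exists_measurable_indicator hU
  choose g hwg hgm hgL using hex
  have hwp : ∀ i, IsWeakPartial U i w' (g i) := fun i => (hw.isWeakPartial i).congr hww' (hwg i)
  obtain ⟨l, ρ, hl, hl1, hρ, hball⟩ := hp.exists_mollifiers
  obtain ⟨G, hG, hGl⟩ := hp.exists_smooth_leftInverse
  have hGl' : ∀ x ∈ refTriangle, G (polyMap p x) = x := fun x hx => hGl.self_of_nhdsSet x hx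
  obtain ⟨C, hCt, hC⟩ := hp.exists_eLpNorm_le_comp
  have hloc : LocallyIntegrable (U.indicator w') volume := hwL.locallyIntegrable (by norm_num)
  have hms := fun m => contDiff_mollify (ρ m) hloc
  have hdc : ∀ m, ContDiff ℝ ((⊤ : ℕ∞) : WithTop ℕ∞) (dilate (l m)) := fun m =>
    contDiff_const.add (contDiff_id.const_smul _)
  set φ : ℕ → Plane → ℝ := fun m y =>
    mollify (ρ m) (U.indicator w') (polyMap p (dilate (l m) (G y))) with hφ
  have hind : ∀ (f : Plane → ℝ), ∀ x ∈ refOpenTriangle,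
      U.indicator f (polyMap p x) = f (polyMap p x) := fun f x hx =>
    Set.indicator_of_mem (show polyMap p x ∈ U from ⟨x, hx, rfl⟩) f
  have hae : ∀ P : Plane → Prop, (∀ x ∈ refOpenTriangle, P x) →
      ∀ᵐ x ∂(volume.restrict refTriangle), P x := by
    intro P hP
    rw [← restrict_refOpenTriangle]
    filter_upwards [ae_restrict_mem isOpen_refOpenTriangle.measurableSet] with x hx using hP x hx
  have hφs : ∀ m, ContDiff ℝ ((⊤ : ℕ∞) : WithTop ℕ∞) (φ m) := fun m =>
    (hms m).comp ((contDiff_polyMap p).comp ((hdc m).comp hG))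
  refine ⟨φ, fun m => (hφs m).of_le (by simp), ?_, fun i => ?_⟩
  · have h1 := hp.tendsto_mollify_dilate hl hl1 hρ hwm hwL
    have h2 := ENNReal.Tendsto.const_mul h1 (Or.inr hCt)
    rw [mul_zero] at h2
    refine tendsto_of_tendsto_of_tendsto_of_le_of_le tendsto_const_nhds h2
      (fun _ => zero_le) fun m => ?_
    have e1 : eLpNorm (fun x => φ m x - w x) 2 (volume.restrict U) =
        eLpNorm (fun x => φ m x - w' x) 2 (volume.restrict U) :=
      eLpNorm_congr_ae (by filter_upwards [hww'] with x hx using by rw [hx])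
    rw [e1]
    refine (hC _).trans (mul_le_mul_right (le_of_eq (eLpNorm_congr_ae (hae _ ?_))) _)
    intro x hx
    simp only [hφ, hGl' x (refOpenTriangle_subset hx), hind _ x hx]
  -- These are the coefficients that the chain rule produces: entries of the Jacobian of `ψ ∘ dilate
  -- ∘ G`. They are uniformly bounded and tend pointwise to those of the identity.
  · set b : ℕ → Fin 2 → Plane → ℝ := fun m n x =>
      l m * polyDeriv p (dilate (l m) x) (fderiv ℝ G (polyMap p x) (basisVec i)) n with hb
    have hbc : Continuous fun z : ℝ × Plane =>
        z.1 • polyDeriv p (dilate z.1 z.2) (fderiv ℝ G (polyMap p z.2) (basisVec i)) := by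
      refine continuous_fst.smul (((continuous_polyDeriv p).comp continuous_dilate).clm_apply ?_)
      exact ((hG.continuous_fderiv (by simp)).comp
        ((continuous_polyMap p).comp continuous_snd)).clm_apply continuous_const
    have hbz : ∀ n, Continuous fun z : ℝ × Plane =>
        z.1 * polyDeriv p (dilate z.1 z.2) (fderiv ℝ G (polyMap p z.2) (basisVec i)) n := fun n =>
      (by fun_prop : Continuous fun x : Plane => x n).comp hbc
    have hbcm : ∀ m n, Continuous (b m n) := fun m n =>
      (hbz n).comp (continuous_const.prodMk continuous_id)
    have hbK : ∃ K, ∀ m n, ∀ x ∈ refTriangle, ‖b m n x‖ ≤ K := by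
      have := fun n => (((isCompact_Icc (a := (0 : ℝ)) (b := 1)).prod
        isCompact_refTriangle).image (hbz n)).isBounded.exists_norm_le
      choose K hK using this
      refine ⟨max (K 0) (K 1), fun m n x hx => ?_⟩
      have h1 := hK n _ ⟨(l m, x), ⟨⟨by linarith [(hl m).1], (hl m).2.le⟩, hx⟩, rfl⟩
      refine h1.trans ?_
      fin_cases n
      · exact le_max_left _ _
      · exact le_max_right _ _
    obtain ⟨K, hK⟩ := hbK
    have hblim : ∀ n, ∀ x ∈ refTriangle,
        Tendsto (fun m => b m n x) atTop (𝓝 (basisVec i n)) := by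
      intro n x hx
      have h1 : Tendsto (fun m => (l m, x)) atTop (𝓝 (1, x)) := hl1.prodMk_nhds tendsto_const_nhds
      have h2 := (hbz n).continuousAt.tendsto.comp h1
      simpa only [Function.comp_def, dilate_one, one_mul,
        (polyDeriv_fderiv_leftInverse hp hG hGl hx (basisVec i)).1] using h2
    have hderiv : ∀ m, ∀ x ∈ refTriangle, fderiv ℝ (φ m) (polyMap p x) (basisVec i) =
        ∑ n, b m n x * mollify (ρ m) (U.indicator (g n)) (polyMap p (dilate (l m) x)) := by
      intro m x hx
      have d1 := ((hG.differentiable (by simp)) (polyMap p x)).hasFDerivAt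
      have d2 := hasFDerivAt_polyMap_dilate p (l m) (G (polyMap p x))
      have d3 := (((hms m).differentiable (by simp))
        (polyMap p (dilate (l m) (G (polyMap p x))))).hasFDerivAt
      have d4 := d3.comp (polyMap p x) (d2.comp (polyMap p x) d1)
      have d5 : fderiv ℝ (φ m) (polyMap p x) = _ := d4.fderiv
      rw [d5]
      simp only [ContinuousLinearMap.comp_apply, hGl' x hx]
      rw [fderiv_apply_eq_sum]
      refine Finset.sum_congr rfl fun n _ => ?_
      rw [fderiv_mollify (ρ m) hU hloc (hwp n) (hball m x hx), mul_comm]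
      rfl
    have hfin : IsFiniteMeasure (volume.restrict refTriangle) :=
      ⟨by rw [Measure.restrict_apply_univ]; exact isCompact_refTriangle.measure_lt_top⟩
    have hgloc : ∀ n, LocallyIntegrable (U.indicator (g n)) volume := fun n =>
      (hgL n).locallyIntegrable (by norm_num)
    have hRc : ∀ m n, Continuous fun x =>
        mollify (ρ m) (U.indicator (g n)) (polyMap p (dilate (l m) x)) := fun m n =>
      (contDiff_mollify (ρ m) (hgloc n)).continuous.comp
        ((continuous_polyMap p).comp (hdc m).continuous)
    have hψm : ∀ n, Measurable fun x => U.indicator (g n) (polyMap p x) := fun n =>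
      (hgm n).comp (continuous_polyMap p).measurable
    have hψL : ∀ n, MemLp (fun x => U.indicator (g n) (polyMap p x)) 2
        (volume.restrict refTriangle) := by
      intro n
      refine ⟨(hψm n).aestronglyMeasurable, ?_⟩
      obtain ⟨c, hc, hcJ⟩ := hp.exists_le_abs_det
      refine (eLpNorm_comp_le (fun x _ => hasFDerivAt_polyMap p x) hp.injOn_openTriangle hc
        (fun x hx => ?_) _).trans_lt (ENNReal.mul_lt_top ENNReal.ofReal_lt_top (hgL n).2)
      rw [det_polyDeriv]
      exact hcJ x (refOpenTriangle_subset hx)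
    -- The gradient error is split as `b (R g - g) + (b - δ) g`, with `R g` the shrunk mollification
    -- of `g` and `δ` the Kronecker symbol. The first part tends to zero because `b` is bounded, the
    -- second by dominated convergence.
    set A : ℕ → Fin 2 → Plane → ℝ := fun m n x =>
      b m n x * (mollify (ρ m) (U.indicator (g n)) (polyMap p (dilate (l m) x)) -
        U.indicator (g n) (polyMap p x)) with hA
    set B : ℕ → Fin 2 → Plane → ℝ := fun m n x =>
      (b m n x - basisVec i n) * U.indicator (g n) (polyMap p x) with hB
    have hAlim : ∀ n, Tendsto (fun m => eLpNorm (A m n) 2 (volume.restrict refTriangle))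
        atTop (𝓝 0) := by
      intro n
      have h1 := hp.tendsto_mollify_dilate hl hl1 hρ (hgm n) (hgL n)
      have h2 := ENNReal.Tendsto.const_mul h1 (Or.inr (ENNReal.ofReal_ne_top (r := K)))
      rw [mul_zero] at h2
      refine tendsto_of_tendsto_of_tendsto_of_le_of_le tendsto_const_nhds h2
        (fun _ => zero_le) fun m => ?_
      refine eLpNorm_le_mul_eLpNorm_of_ae_le_mul ?_ 2
      filter_upwards [ae_restrict_mem isClosed_refTriangle.measurableSet] with x hx
      rw [hA, norm_mul]
      exact mul_le_mul_of_nonneg_right (hK m n x hx) (norm_nonneg _)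
    have hBlim : ∀ n, Tendsto (fun m => eLpNorm (B m n) 2 (volume.restrict refTriangle))
        atTop (𝓝 0) := by
      intro n
      refine tendsto_eLpNorm_mul_of_bounded (K := K + ‖basisVec i n‖) (hψL n) ?_ ?_ ?_
      · exact fun m => ((hbcm m n).sub continuous_const).aestronglyMeasurable
      · intro m
        filter_upwards [ae_restrict_mem isClosed_refTriangle.measurableSet] with x hx
        exact (norm_sub_le _ _).trans (add_le_add_left (hK m n x hx) _)
      · filter_upwards [ae_restrict_mem isClosed_refTriangle.measurableSet] with x hx
        have := (hblim n x hx).sub_const (basisVec i n)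
        rwa [sub_self] at this
    have hsum : Tendsto (fun m => C * ((eLpNorm (A m 0) 2 (volume.restrict refTriangle) +
        eLpNorm (A m 1) 2 (volume.restrict refTriangle)) +
        (eLpNorm (B m 0) 2 (volume.restrict refTriangle) +
        eLpNorm (B m 1) 2 (volume.restrict refTriangle)))) atTop (𝓝 0) := by
      have := ENNReal.Tendsto.const_mul
        (((hAlim 0).add (hAlim 1)).add ((hBlim 0).add (hBlim 1))) (Or.inr hCt)
      simpa using this
    refine tendsto_of_tendsto_of_tendsto_of_le_of_le tendsto_const_nhds hsum
      (fun _ => zero_le) fun m => ?_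
    have e1 : eLpNorm (fun x => fderiv ℝ (φ m) x (basisVec i) - weakPartial U i w x) 2
        (volume.restrict U) = eLpNorm (fun x => fderiv ℝ (φ m) x (basisVec i) - g i x) 2
        (volume.restrict U) :=
      eLpNorm_congr_ae (by filter_upwards [hwg i] with x hx using by rw [hx])
    have hAm : ∀ n, AEStronglyMeasurable (A m n) (volume.restrict refTriangle) := fun n =>
      ((hbcm m n).measurable.mul ((hRc m n).measurable.sub (hψm n))).aestronglyMeasurable
    have hBm : ∀ n, AEStronglyMeasurable (B m n) (volume.restrict refTriangle) := fun n =>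
      (((hbcm m n).measurable.sub measurable_const).mul (hψm n)).aestronglyMeasurable
    have e2 : eLpNorm (fun x => fderiv ℝ (φ m) (polyMap p x) (basisVec i) - g i (polyMap p x)) 2
        (volume.restrict refTriangle) =
        eLpNorm ((A m 0 + A m 1) + (B m 0 + B m 1)) 2 (volume.restrict refTriangle) := by
      refine eLpNorm_congr_ae (hae _ fun x hx => ?_)
      have h1 : g i (polyMap p x) = ∑ n, basisVec i n * U.indicator (g n) (polyMap p x) := by
        rw [← hind (g i) x hx]
        fin_cases i <;> simp [basisVec]
      beta_reduce
      rw [hderiv m x (refOpenTriangle_subset hx), h1]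
      simp only [hA, hB, Pi.add_apply, Fin.sum_univ_two]
      ring
    rw [e1]
    refine (hC _).trans (mul_le_mul_right ?_ _)
    rw [e2]
    refine (eLpNorm_add_le ((hAm 0).add (hAm 1)) ((hBm 0).add (hBm 1)) (by norm_num)).trans ?_
    exact add_le_add (eLpNorm_add_le (hAm 0) (hAm 1) (by norm_num))
      (eLpNorm_add_le (hBm 0) (hBm 1) (by norm_num))

/-! ### Traces -/

theorem integrable_mul_of_memLp_two {α : Type*} [MeasurableSpace α] {μ : Measure α}
    {f g : α → ℝ} (hf : MemLp f 2 μ) (hg : MemLp g 2 μ) : Integrable (fun x => f x * g x) μ :=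
  hf.integrable_mul hg

theorem tendsto_integral_mul_of_tendsto_eLpNorm {α : Type*} [MeasurableSpace α] {μ : Measure α}
    {F : ℕ → α → ℝ} {f g : α → ℝ} (hF : ∀ m, MemLp (F m) 2 μ) (hf : MemLp f 2 μ)
    (hg : MemLp g 2 μ) (h : Tendsto (fun m => eLpNorm (fun x => F m x - f x) 2 μ) atTop (𝓝 0)) :
    Tendsto (fun m => ∫ x, F m x * g x ∂μ) atTop (𝓝 (∫ x, f x * g x ∂μ)) := by
  refine tendsto_integral_of_L1' _ (integrable_mul_of_memLp_two hf hg).1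
    (Eventually.of_forall fun m => integrable_mul_of_memLp_two (hF m) hg) ?_
  have h2 := ENNReal.Tendsto.mul_const h (Or.inr hg.2.ne)
  rw [zero_mul] at h2
  refine tendsto_of_tendsto_of_tendsto_of_le_of_le tendsto_const_nhds h2
    (fun _ => zero_le) fun m => ?_
  have h3 := eLpNorm_smul_le_mul_eLpNorm (p := 2) (q := 2) (r := 1) hg.1
    (φ := fun x => F m x - f x) ((hF m).sub hf).1
  refine le_trans (le_of_eq ?_) h3
  congr 1
  ext x
  simp only [Pi.sub_apply, Pi.smul_apply', smul_eq_mul]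
  ring

theorem eLpNorm_sub_le_of_sub {α : Type*} [MeasurableSpace α] {μ : Measure α} {a b c : α → ℝ}
    (ha : AEStronglyMeasurable a μ) (hb : AEStronglyMeasurable b μ)
    (hc : AEStronglyMeasurable c μ) :
    eLpNorm (fun x => a x - b x) 2 μ ≤
      eLpNorm (fun x => a x - c x) 2 μ + eLpNorm (fun x => b x - c x) 2 μ := by
  have h := eLpNorm_sub_le (p := 2) (ha.sub hc) (hb.sub hc) (by norm_num)
  refine le_trans (le_of_eq ?_) h
  congr 1
  ext x
  simp

theorem trace_memLp (U : Set Plane) (σ : Measure Plane) (w : Plane → ℝ) :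
    MemLp (trace U σ w) 2 σ := by
  unfold trace
  split_ifs with h
  · exact h.choose_spec.1
  · exact MemLp.zero

/-- As in `weakPartial_congr`, the predicates defining the two choices are equal, so the chosen
functions are too. -/
theorem trace_congr {U : Set Plane} {σ : Measure Plane} {w w' : Plane → ℝ}
    (h : w =ᵐ[volume.restrict U] w') : trace U σ w = trace U σ w' := by
  have : HasTrace U σ w = HasTrace U σ w' := by
    ext τ
    unfold HasTrace
    have e : ∀ φ : ℕ → Plane → ℝ, (fun m => eLpNorm (fun x => φ m x - w x) 2 (volume.restrict U)) =
        fun m => eLpNorm (fun x => φ m x - w' x) 2 (volume.restrict U) := fun φ => by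
      ext m
      exact eLpNorm_congr_ae (by filter_upwards [h] with x hx using by rw [hx])
    simp only [e, fun i => weakPartial_congr (i := i) h]
  unfold trace
  rw [this]

theorem HasTrace.trace {U : Set Plane} {σ : Measure Plane} {w τ : Plane → ℝ}
    (h : HasTrace U σ w τ) : HasTrace U σ w (trace U σ w) := by
  have hex : ∃ τ, HasTrace U σ w τ := ⟨τ, h⟩
  rw [_root_.trace, dif_pos hex]
  exact hex.choose_spec

namespace IsElementMap

variable {p : PolyPair}

/-- Sequences with the same limit in `H¹` of an element have the same limits on its sides. -/
theorem tendsto_eLpNorm_side_sub (hp : IsElementMap p) {w : Plane → ℝ}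
    (hw : MemSobolev 1 (openElement p) w) {ι : Type*} {l : Filter ι} {φ φ' : ι → Plane → ℝ}
    (hφ : ∀ m, ContDiff ℝ 1 (φ m)) (hφ' : ∀ m, ContDiff ℝ 1 (φ' m))
    (h0 : Tendsto (fun m => eLpNorm (fun x => φ m x - w x) 2 (volume.restrict (openElement p)))
      l (𝓝 0))
    (h1 : ∀ i, Tendsto (fun m => eLpNorm (fun x => fderiv ℝ (φ m) x (basisVec i) -
      weakPartial (openElement p) i w x) 2 (volume.restrict (openElement p))) l (𝓝 0))
    (h0' : Tendsto (fun m => eLpNorm (fun x => φ' m x - w x) 2 (volume.restrict (openElement p)))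
      l (𝓝 0))
    (h1' : ∀ i, Tendsto (fun m => eLpNorm (fun x => fderiv ℝ (φ' m) x (basisVec i) -
      weakPartial (openElement p) i w x) 2 (volume.restrict (openElement p))) l (𝓝 0))
    (j : Fin 3) :
    Tendsto (fun m => eLpNorm (fun x => φ m x - φ' m x) 2 (sideMeasure p j)) l (𝓝 0) := by
  obtain ⟨C, hCt, hC⟩ := hp.eLpNorm_trace_le j
  have hU := hp.isOpen_openElement
  have hlim := ENNReal.Tendsto.const_mul ((h0.add h0').add
    (((h1 0).add (h1' 0)).add ((h1 1).add (h1' 1)))) (Or.inr hCt)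
  simp only [add_zero, mul_zero] at hlim
  refine tendsto_of_tendsto_of_tendsto_of_le_of_le tendsto_const_nhds hlim
    (fun _ => zero_le) fun m => ?_
  refine (hC _ ((hφ m).sub (hφ' m))).trans ?_
  have hd : ∀ i, (fun x => fderiv ℝ (fun x => φ m x - φ' m x) x (basisVec i)) =
      fun x => fderiv ℝ (φ m) x (basisVec i) - fderiv ℝ (φ' m) x (basisVec i) := by
    intro i
    ext x
    rw [fderiv_fun_sub ((hφ m).differentiable (by norm_num) x)
      ((hφ' m).differentiable (by norm_num) x)]
    rfl
  have hm : ∀ {φ : Plane → ℝ}, ContDiff ℝ 1 φ → ∀ i, AEStronglyMeasurable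
      (fun x => fderiv ℝ φ x (basisVec i)) (volume.restrict (openElement p)) := fun hφ i =>
    (contDiff_fderiv_apply (m := 0) hφ (by simp) _).continuous.aestronglyMeasurable
  have hwm := fun i => (hw.weakPartial hU i).memLp.1
  simp only [hd, Fin.sum_univ_two]
  refine mul_le_mul_right (add_le_add (eLpNorm_sub_le_of_sub
    (hφ m).continuous.aestronglyMeasurable (hφ' m).continuous.aestronglyMeasurable hw.memLp.1)
    (add_le_add ?_ ?_)) _
  · exact eLpNorm_sub_le_of_sub (hm (hφ m) 0) (hm (hφ' m) 0) (hwm 0)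
  · exact eLpNorm_sub_le_of_sub (hm (hφ m) 1) (hm (hφ' m) 1) (hwm 1)

/-- The distance of `τ` and `τ'` is at most the sum of the distances along the chain `τ`, `φ m`, `φ'
m`, `τ'`, and all three tend to zero, the middle one by the trace inequality. -/
theorem hasTrace_unique (hp : IsElementMap p) {w τ τ' : Plane → ℝ}
    (hw : MemSobolev 1 (openElement p) w) {j : Fin 3}
    (h : HasTrace (openElement p) (sideMeasure p j) w τ)
    (h' : HasTrace (openElement p) (sideMeasure p j) w τ') : τ =ᵐ[sideMeasure p j] τ' := by
  obtain ⟨hτ, φ, hφ, h0, h1, h2⟩ := h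
  obtain ⟨hτ', φ', hφ', h0', h1', h2'⟩ := h'
  have key := hp.tendsto_eLpNorm_side_sub hw hφ hφ' h0 h1 h0' h1' j
  have hm : ∀ {φ : Plane → ℝ}, ContDiff ℝ 1 φ → AEStronglyMeasurable φ (sideMeasure p j) :=
    fun hφ => hφ.continuous.aestronglyMeasurable
  have hlim := (h2.add key).add h2'
  simp only [add_zero] at hlim
  have hz : eLpNorm (fun x => τ x - τ' x) 2 (sideMeasure p j) = 0 := by
    refine le_antisymm (ge_of_tendsto' hlim fun m => ?_) zero_le
    have e1 := eLpNorm_sub_le_of_sub (c := φ m) hτ.1 hτ'.1 (hm (hφ m))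
    have e2 := eLpNorm_sub_le_of_sub (c := φ' m) hτ'.1 (hm (hφ m)) (hm (hφ' m))
    have s : ∀ a b : Plane → ℝ, eLpNorm (fun x => a x - b x) 2 (sideMeasure p j) =
        eLpNorm (fun x => b x - a x) 2 (sideMeasure p j) := fun a b =>
      eLpNorm_sub_comm a b 2 _
    rw [s τ (φ m)] at e1
    rw [s τ' (φ' m)] at e2
    refine e1.trans ?_
    rw [add_assoc, add_comm (eLpNorm (fun x => φ m x - φ' m x) 2 (sideMeasure p j))]
    exact add_le_add le_rfl e2
  filter_upwards [(eLpNorm_eq_zero_iff (hτ.1.sub hτ'.1) (by norm_num)).1 hz] with x hx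
  exact sub_eq_zero.1 hx

/-- A single approximating sequence serves all three sides: its restrictions are Cauchy in `L²` of
each side by the trace inequality, and each limit is the chosen trace by uniqueness. -/
theorem exists_traces (hp : IsElementMap p) {w : Plane → ℝ}
    (hw : MemSobolev 1 (openElement p) w) :
    ∃ φ : ℕ → Plane → ℝ, (∀ m, ContDiff ℝ 1 (φ m)) ∧
      Tendsto (fun m => eLpNorm (fun x => φ m x - w x) 2 (volume.restrict (openElement p)))
        atTop (𝓝 0) ∧
      (∀ i : Fin 2, Tendsto (fun m => eLpNorm (fun x => fderiv ℝ (φ m) x (basisVec i) -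
        weakPartial (openElement p) i w x) 2 (volume.restrict (openElement p))) atTop (𝓝 0)) ∧
      ∀ j, Tendsto (fun m => eLpNorm (fun x => φ m x -
        trace (openElement p) (sideMeasure p j) w x) 2 (sideMeasure p j)) atTop (𝓝 0) := by
  obtain ⟨φ, hφ, h0, h1⟩ := hp.exists_contDiff_tendsto hw
  refine ⟨φ, hφ, h0, h1, fun j => ?_⟩
  have hL : ∀ m, MemLp (φ m) 2 (sideMeasure p j) := fun m =>
    (hφ m).continuous.continuousOn.memLp_sideMeasure
  have hfst : Tendsto (Prod.fst : ℕ × ℕ → ℕ) atTop atTop := by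
    rw [← prod_atTop_atTop_eq]; exact tendsto_fst
  have hsnd : Tendsto (Prod.snd : ℕ × ℕ → ℕ) atTop atTop := by
    rw [← prod_atTop_atTop_eq]; exact tendsto_snd
  have hc : CauchySeq fun m => (hL m).toLp (φ m) := by
    rw [Lp.cauchySeq_Lp_iff_cauchySeq_eLpNorm]
    have := hp.tendsto_eLpNorm_side_sub hw (l := (atTop : Filter (ℕ × ℕ)))
      (φ := fun n => φ n.1) (φ' := fun n => φ n.2) (fun m => hφ _) (fun m => hφ _)
      (h0.comp hfst) (fun i => (h1 i).comp hfst) (h0.comp hsnd) (fun i => (h1 i).comp hsnd) j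
    refine this.congr fun n => eLpNorm_congr_ae ?_
    filter_upwards [(hL n.1).coeFn_toLp, (hL n.2).coeFn_toLp] with x hx1 hx2
    simp only [Pi.sub_apply, hx1, hx2]
  obtain ⟨τ, hτ⟩ := cauchySeq_tendsto_of_complete hc
  rw [Lp.tendsto_Lp_iff_tendsto_eLpNorm'] at hτ
  have hτ' : Tendsto (fun m => eLpNorm (fun x => φ m x - τ x) 2 (sideMeasure p j))
      atTop (𝓝 0) := by
    refine hτ.congr fun n => eLpNorm_congr_ae ?_
    filter_upwards [(hL n).coeFn_toLp] with x hx
    simp only [Pi.sub_apply, hx]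
  have htr : HasTrace (openElement p) (sideMeasure p j) w τ :=
    ⟨Lp.memLp τ, φ, hφ, h0, h1, hτ'⟩
  have hae := hp.hasTrace_unique hw htr htr.trace
  refine hτ'.congr fun n => eLpNorm_congr_ae ?_
  filter_upwards [hae] with x hx
  rw [hx]

theorem hasTrace_trace (hp : IsElementMap p) {w : Plane → ℝ}
    (hw : MemSobolev 1 (openElement p) w) (j : Fin 3) :
    HasTrace (openElement p) (sideMeasure p j) w (trace (openElement p) (sideMeasure p j) w) := by
  obtain ⟨φ, hφ, h0, h1, h2⟩ := hp.exists_traces hw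
  exact ⟨trace_memLp _ _ _, φ, hφ, h0, h1, h2 j⟩

theorem trace_sub (hp : IsElementMap p) {w w' : Plane → ℝ}
    (hw : MemSobolev 1 (openElement p) w) (hw' : MemSobolev 1 (openElement p) w') (j : Fin 3) :
    trace (openElement p) (sideMeasure p j) (w - w') =ᵐ[sideMeasure p j]
      trace (openElement p) (sideMeasure p j) w - trace (openElement p) (sideMeasure p j) w' := by
  have hU := hp.isOpen_openElement
  refine hp.hasTrace_unique (hw.sub hw') (hp.hasTrace_trace (hw.sub hw') j) ?_
  obtain ⟨hτ, φ, hφ, h0, h1, h2⟩ := hp.hasTrace_trace hw j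
  obtain ⟨hτ', φ', hφ', h0', h1', h2'⟩ := hp.hasTrace_trace hw' j
  have aux : ∀ {μ : Measure Plane} {a a' b b' : ℕ → Plane → ℝ},
      (∀ m, AEStronglyMeasurable (fun x => a m x - b m x) μ) →
      (∀ m, AEStronglyMeasurable (fun x => a' m x - b' m x) μ) →
      Tendsto (fun m => eLpNorm (fun x => a m x - b m x) 2 μ) atTop (𝓝 0) →
      Tendsto (fun m => eLpNorm (fun x => a' m x - b' m x) 2 μ) atTop (𝓝 0) →
      Tendsto (fun m => eLpNorm (fun x => (a m x - a' m x) - (b m x - b' m x)) 2 μ) atTop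
        (𝓝 0) := by
    intro μ a a' b b' m1 m2 t1 t2
    have t3 := t1.add t2
    rw [add_zero] at t3
    refine tendsto_of_tendsto_of_tendsto_of_le_of_le tendsto_const_nhds t3
      (fun _ => zero_le) fun m => ?_
    refine le_trans (le_of_eq ?_) (eLpNorm_sub_le (m1 m) (m2 m) (by norm_num))
    congr 1
    ext x
    simp only [Pi.sub_apply]
    ring
  have hm : ∀ {φ : Plane → ℝ} {μ : Measure Plane}, ContDiff ℝ 1 φ → AEStronglyMeasurable φ μ :=
    fun hφ => hφ.continuous.aestronglyMeasurable
  have hm' : ∀ {φ : Plane → ℝ} {μ : Measure Plane}, ContDiff ℝ 1 φ → ∀ i, AEStronglyMeasurable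
      (fun x => fderiv ℝ φ x (basisVec i)) μ := fun hφ i =>
    (contDiff_fderiv_apply (m := 0) hφ (by simp) _).continuous.aestronglyMeasurable
  have hwm := fun i => (hw.weakPartial hU i).memLp.1
  have hwm' := fun i => (hw'.weakPartial hU i).memLp.1
  refine ⟨hτ.sub hτ', fun m => φ m - φ' m, fun m => (hφ m).sub (hφ' m), ?_, fun i => ?_, ?_⟩
  · exact aux (b := fun _ => w) (b' := fun _ => w') (fun m => (hm (hφ m)).sub hw.memLp.1)
      (fun m => (hm (hφ' m)).sub hw'.memLp.1) h0 h0'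
  · have := aux (b := fun _ => weakPartial (openElement p) i w)
      (b' := fun _ => weakPartial (openElement p) i w') (fun m => (hm' (hφ m) i).sub (hwm i))
      (fun m => (hm' (hφ' m) i).sub (hwm' i)) (h1 i) (h1' i)
    refine this.congr fun m => eLpNorm_congr_ae ?_
    filter_upwards [weakPartial_sub_ae hU hw hw' i] with x hx
    rw [hx, fderiv_sub ((hφ m).differentiable (by norm_num) x)
      ((hφ' m).differentiable (by norm_num) x)]
    rfl
  · exact aux (b := fun _ => _) (b' := fun _ => _) (fun m => (hm (hφ m)).sub hτ.1)
      (fun m => (hm (hφ' m)).sub hτ'.1) h2 h2'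

theorem trace_of_contDiff (hp : IsElementMap p) {w : Plane → ℝ}
    (hw : ContDiff ℝ ((⊤ : ℕ∞) : WithTop ℕ∞) w) (j : Fin 3) :
    trace (openElement p) (sideMeasure p j) w =ᵐ[sideMeasure p j] w := by
  have hw1 : ContDiff ℝ 1 w := hw.of_le (by simp)
  have hS := MemSobolev.of_contDiff (m := 1) (isBounded_openElement p) hw
  refine hp.hasTrace_unique hS (hp.hasTrace_trace hS j)
    ⟨hw.continuous.continuousOn.memLp_sideMeasure, fun _ => w, fun _ => hw1, ?_, fun i => ?_, ?_⟩
  · simp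
  · have : eLpNorm (fun x => fderiv ℝ w x (basisVec i) - weakPartial (openElement p) i w x) 2
        (volume.restrict (openElement p)) = 0 := by
      rw [eLpNorm_congr_ae (g := fun _ => (0 : ℝ)), eLpNorm_zero']
      filter_upwards [(IsWeakPartial.of_contDiff hw1 i).weakPartial_ae_eq
        hp.isOpen_openElement] with x hx
      rw [hx, sub_self]
    simp [this]
  · simp

/-- Integration by parts on an element. -/
theorem integral_weakPartial_mul (hp : IsElementMap p) {w v : Plane → ℝ}
    (hw : MemSobolev 1 (openElement p) w) (hv : ContDiff ℝ 1 v) (i : Fin 2) :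
    ∫ x in openElement p, weakPartial (openElement p) i w x * v x =
      ∑ j, ∫ x, trace (openElement p) (sideMeasure p j) w x * (v x * sideNormal p j x i)
        ∂(sideMeasure p j) - ∫ x in openElement p, w x * fderiv ℝ v x (basisVec i) := by
  obtain ⟨φ, hφ, h0, h1, h2⟩ := hp.exists_traces hw
  have hb := isBounded_openElement p
  have hU := hp.isOpen_openElement
  have hdc : ∀ {φ : Plane → ℝ}, ContDiff ℝ 1 φ → Continuous fun x => fderiv ℝ φ x (basisVec i) :=
    fun hφ => (contDiff_fderiv_apply (m := 0) hφ (by simp) _).continuous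
  have hL : ∀ {f : Plane → ℝ}, Continuous f → MemLp f 2 (volume.restrict (openElement p)) :=
    fun hf => hf.memLp_two_restrict_of_isBounded hb
  have t1 := tendsto_integral_mul_of_tendsto_eLpNorm (fun m => hL (hdc (hφ m)))
    (hw.weakPartial hU i).memLp (hL hv.continuous) (h1 i)
  have t2 := tendsto_integral_mul_of_tendsto_eLpNorm (fun m => hL (hφ m).continuous)
    hw.memLp (hL (hdc hv)) h0
  have t3 := fun j => tendsto_integral_mul_of_tendsto_eLpNorm
    (g := fun x => v x * sideNormal p j x i)
    (fun m => (hφ m).continuous.continuousOn.memLp_sideMeasure (p := p) (j := j))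
    (trace_memLp (openElement p) (sideMeasure p j) w)
    ((hv.continuous.continuousOn.mul ((hp.continuousOn_sideNormal j i).mono
      (side_subset_element p j))).memLp_sideMeasure) (h2 j)
  refine tendsto_nhds_unique t1 ?_
  have t4 := (tendsto_finsetSum Finset.univ fun j _ => t3 j).sub t2
  -- For `φ m` the identity is the divergence theorem applied to `φ m * v`; every term passes to the
  -- limit.
  refine t4.congr fun m => ?_
  have hg := hp.integral_fderiv ((hφ m).mul hv) i
  have hprod : ∀ x, fderiv ℝ (fun x => φ m x * v x) x (basisVec i) =
      φ m x * fderiv ℝ v x (basisVec i) + fderiv ℝ (φ m) x (basisVec i) * v x := by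
    intro x
    rw [fderiv_fun_mul ((hφ m).differentiable (by norm_num) x) (hv.differentiable (by norm_num) x)]
    simp [mul_comm]
  simp only [hprod] at hg
  rw [integral_add (integrable_mul_of_memLp_two (hL (hφ m).continuous) (hL (hdc hv)))
    (integrable_mul_of_memLp_two (hL (hdc (hφ m))) (hL hv.continuous))] at hg
  simp only [mul_assoc] at hg
  rw [← hg]
  ring

end IsElementMap

/-! ### Geometry of the sides -/

/-- The barycentric coordinate on the reference triangle that vanishes on the side `j`. -/
def refDist (j : Fin 3) (z : Plane) : ℝ := ![0, 1, 0] j - (refNormal j 0 * z 0 + refNormal j 1 * z 1)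

theorem mem_refOpenTriangle_iff {z : Plane} : z ∈ refOpenTriangle ↔ ∀ j, 0 < refDist j z := by
  simp only [refOpenTriangle, refDist, refNormal, Fin.forall_fin_succ]
  simp
  constructor <;> rintro ⟨h0, h1, h2⟩ <;> exact ⟨by linarith, by linarith, by linarith⟩

theorem refDist_refSide_self (j : Fin 3) (t : ℝ) : refDist j (refSide j t) = 0 := by
  fin_cases j
  · simp [refDist, refSide_zero, refNormal]
  · simp [refDist, refSide_one, refNormal]
  · simp [refDist, refSide_two, refNormal]

theorem refDist_refSide_pos {i j : Fin 3} (hij : i ≠ j) {t : ℝ} (ht : t ∈ Set.Ioo (0 : ℝ) 1) :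
    0 < refDist j (refSide i t) := by
  obtain ⟨h0, h1⟩ := ht
  fin_cases i <;> fin_cases j <;>
    simp [refDist, refSide_zero, refSide_one, refSide_two, refNormal] at hij ⊢ <;> linarith

theorem eq_of_refSide_eq {i j : Fin 3} {t s : ℝ} (ht : t ∈ Set.Ioo (0 : ℝ) 1)
    (h : refSide i t = refSide j s) : i = j := by
  by_contra hij
  have := refDist_refSide_pos hij ht
  rw [h, refDist_refSide_self] at this
  exact lt_irrefl _ this

theorem refSide_notMem_refOpenTriangle (j : Fin 3) (t : ℝ) : refSide j t ∉ refOpenTriangle := by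
  rw [mem_refOpenTriangle_iff]
  intro h
  have := h j
  rw [refDist_refSide_self] at this
  exact lt_irrefl _ this

theorem refVertex_eq_refSide (j : Fin 3) : refVertex j = refSide j 0 := by simp [refSide]

theorem refVertex_ne_refSide {t : ℝ} (ht : t ∈ Set.Ioo (0 : ℝ) 1) (i j : Fin 3) :
    refSide i t ≠ refVertex j := by
  intro h
  rw [refVertex_eq_refSide] at h
  obtain rfl := eq_of_refSide_eq ht h
  exact ht.1.ne' (refSide_injective i h)

/-! ### Common sides of two elements: reparametrization, arc length and normals. -/

namespace IsElementMap

variable {p q r : PolyPair}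

theorem disjoint_openElement_side (hp : IsElementMap p) (j : Fin 3) :
    Disjoint (openElement p) (side p j) := by
  rw [Set.disjoint_left]
  rintro _ ⟨z, hz, rfl⟩ ⟨t, ht, h⟩
  have := hp.1 (refSide_mem ht j) (refOpenTriangle_subset hz) h
  exact refSide_notMem_refOpenTriangle j t (this ▸ hz)

theorem eq_of_mem_side (hp : IsElementMap p) {i j : Fin 3} {x : Plane} (hi : x ∈ openSide p i)
    (hj : x ∈ side p j) : i = j := by
  obtain ⟨t, ht, rfl⟩ := hi
  obtain ⟨s, hs, h⟩ := hj
  exact eq_of_refSide_eq ht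
    (hp.1 (refSide_mem hs j) (refSide_mem (Set.Ioo_subset_Icc_self ht) i) h).symm

theorem vertex_notMem_openSide (hp : IsElementMap p) (i j : Fin 3) :
    polyMap p (refVertex j) ∉ openSide p i := by
  rintro ⟨t, ht, h⟩
  exact refVertex_ne_refSide ht i j
    (hp.1 (refSide_mem (Set.Ioo_subset_Icc_self ht) i) (refVertex_mem j) h)

/-- Two parametrizations of the same side differ by a change of parameters. -/
theorem exists_reparametrization (hp : IsElementMap p) (hq : IsElementMap q) {i j : Fin 3}
    (h : side p i = side q j) : ∃ θ θ' : ℝ → ℝ, (∀ t, HasDerivAt θ (θ' t) t) ∧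
      Set.InjOn θ (Set.Icc 0 1) ∧ θ '' Set.Icc 0 1 = Set.Icc 0 1 ∧
      ∀ t ∈ Set.Icc (0 : ℝ) 1, polyMap q (refSide j (θ t)) = polyMap p (refSide i t) ∧
        sideTangent p i (refSide i t) = θ' t • sideTangent q j (refSide j (θ t)) := by
  obtain ⟨G, hG, hGl⟩ := hq.exists_smooth_leftInverse
  have hGl' : ∀ x ∈ refTriangle, G (polyMap q x) = x := fun x hx => hGl.self_of_nhdsSet x hx
  -- This functional reads off the parameter of a point on the reference side. With the globally
  -- smooth `G` it gives a change of parameters `θ` that is differentiable on all of `ℝ`.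
  let L : Plane →L[ℝ] ℝ := (‖refTangent j‖ ^ 2)⁻¹ • innerSL ℝ (refTangent j)
  have hL : ∀ t, L (refSide j t - refVertex j) = t := by
    intro t
    have e : refSide j t - refVertex j = t • refTangent j := by
      simp only [refSide, refTangent, smul_sub, sub_smul, one_smul]; abel
    have hn := norm_ne_zero_iff.2 (refTangent_ne_zero j)
    have hLt : L (refTangent j) = (‖refTangent j‖ ^ 2)⁻¹ * ‖refTangent j‖ ^ 2 := by
      nth_rewrite 2 [← real_inner_self_eq_norm_sq]; rfl
    rw [e, map_smul, smul_eq_mul, hLt]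
    field_simp
  let θ : ℝ → ℝ := fun t => L (G (polyMap p (refSide i t)) - refVertex j)
  have hdiff : Differentiable ℝ θ := by
    have h1 : Differentiable ℝ fun t => polyMap p (refSide i t) :=
      fun t => (hasDerivAt_side p i t).differentiableAt
    exact L.differentiable.comp (((hG.differentiable (by simp)).comp h1).sub_const _)
  have hval : ∀ t s, s ∈ Set.Icc (0 : ℝ) 1 → polyMap q (refSide j s) = polyMap p (refSide i t) →
      θ t = s := by
    intro t s hs hts
    simp only [θ, ← hts, hGl' _ (refSide_mem hs j), hL]
  have hex : ∀ t ∈ Set.Icc (0 : ℝ) 1, θ t ∈ Set.Icc (0 : ℝ) 1 ∧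
      polyMap q (refSide j (θ t)) = polyMap p (refSide i t) := by
    intro t ht
    have hm : polyMap p (refSide i t) ∈ side q j := h ▸ ⟨t, ht, rfl⟩
    obtain ⟨s, hs, hst⟩ := hm
    have hst' : polyMap q (refSide j s) = polyMap p (refSide i t) := hst
    rw [hval t s hs hst']
    exact ⟨hs, hst'⟩
  refine ⟨θ, deriv θ, fun t => (hdiff t).hasDerivAt, ?_, ?_, fun t ht => ⟨(hex t ht).2, ?_⟩⟩
  · intro t ht s hs hts
    have e1 := (hex t ht).2
    rw [hts, (hex s hs).2] at e1
    exact (refSide_injective i (hp.1 (refSide_mem hs i) (refSide_mem ht i) e1)).symm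
  · apply Set.Subset.antisymm
    · rintro _ ⟨t, ht, rfl⟩
      exact (hex t ht).1
    · intro s hs
      have hm : polyMap q (refSide j s) ∈ side p i := h ▸ ⟨s, hs, rfl⟩
      obtain ⟨t, ht, hst⟩ := hm
      exact ⟨t, ht, hval t s hs hst.symm⟩
  -- The two curves agree only on `[0, 1]`, so derivatives within the interval are compared; they
  -- are unique also at its endpoints.
  · have h1 := (hasDerivAt_side p i t).hasDerivWithinAt (s := Set.Icc 0 1)
    have h2 : HasDerivAt (fun t => polyMap q (refSide j (θ t))) (deriv θ t •
      sideTangent q j (refSide j (θ t))) t :=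
      (hasDerivAt_side q j (θ t)).scomp t (hdiff t).hasDerivAt
    have h3 := h2.hasDerivWithinAt (s := Set.Icc 0 1)
    have h4 := h3.congr (fun s hs => ((hex s hs).2).symm) ((hex t ht).2).symm
    exact (uniqueDiffOn_Icc zero_lt_one t ht).eq_deriv _ h1 h4

/-- Arc length does not depend on the parametrization: the substitution rule for the injective `θ`,
whose absolute derivative also covers a reversed direction. -/
theorem sideMeasure_congr (hp : IsElementMap p) (hq : IsElementMap q) {i j : Fin 3}
    (h : side p i = side q j) : sideMeasure p i = sideMeasure q j := by
  obtain ⟨θ, θ', hθ, hinj, himg, hc⟩ := hp.exists_reparametrization hq h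
  ext B hB
  have hform : ∀ (p : PolyPair) (i : Fin 3), sideMeasure p i B = ∫⁻ t in Set.Icc (0 : ℝ) 1,
      ENNReal.ofReal ‖sideTangent p i (refSide i t)‖ *
        B.indicator 1 (polyMap p (refSide i t)) := by
    intro p i
    rw [sideMeasure_eq, ← lintegral_indicator_one hB,
      lintegral_map (measurable_one.indicator hB) (continuous_side p i).measurable]
    exact lintegral_withDensity_eq_lintegral_mul _
      (continuous_speed p i).measurable.ennreal_ofReal
      ((measurable_one.indicator hB).comp (continuous_side p i).measurable)
  rw [hform, hform]
  conv_rhs => rw [← himg]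
  rw [lintegral_image_eq_lintegral_abs_deriv_mul measurableSet_Icc
    (fun t _ => (hθ t).hasDerivWithinAt) hinj]
  refine setLIntegral_congr_fun measurableSet_Icc fun t ht => ?_
  simp only [(hc t ht).1, (hc t ht).2, norm_smul, Real.norm_eq_abs]
  rw [ENNReal.ofReal_mul (abs_nonneg _), mul_assoc]

/-- A continuous injective `θ` on an interval is strictly monotone, so it maps interior parameters
to interior parameters. -/
theorem openSide_subset (hp : IsElementMap p) (hq : IsElementMap q) {i j : Fin 3}
    (h : side p i = side q j) : openSide p i ⊆ openSide q j := by
  obtain ⟨θ, θ', hθ, hinj, himg, hc⟩ := hp.exists_reparametrization hq h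
  have hcont : ContinuousOn θ (Set.Icc 0 1) := fun t _ => (hθ t).continuousAt.continuousWithinAt
  have hm : ∀ t ∈ Set.Icc (0 : ℝ) 1, θ t ∈ Set.Icc (0 : ℝ) 1 := fun t ht =>
    himg ▸ Set.mem_image_of_mem θ ht
  have h0 : (0 : ℝ) ∈ Set.Icc (0 : ℝ) 1 := by simp
  have h1 : (1 : ℝ) ∈ Set.Icc (0 : ℝ) 1 := by simp
  rintro _ ⟨t, ht, rfl⟩
  have ht' := Set.Ioo_subset_Icc_self ht
  refine ⟨θ t, ?_, (hc t ht').1⟩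
  rcases hcont.strictMonoOn_of_injOn_Icc' zero_le_one hinj with hmono | hanti
  · exact ⟨(hm 0 h0).1.trans_lt (hmono h0 ht' ht.1), (hmono ht' h1 ht.2).trans_le (hm 1 h1).2⟩
  · exact ⟨(hm 1 h1).1.trans_lt (hanti ht' h1 ht.2), (hanti h0 ht' ht.1).trans_le (hm 0 h0).2⟩

theorem openSide_congr (hp : IsElementMap p) (hq : IsElementMap q) {i j : Fin 3}
    (h : side p i = side q j) : openSide p i = openSide q j :=
  Set.Subset.antisymm (hp.openSide_subset hq h) (hq.openSide_subset hp h.symm)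

/-- Up to sign, both normals are rotated unit tangents, and the tangents of the two parametrizations
are parallel. -/
theorem sideNormal_eq_or_neg (hp : IsElementMap p) (hq : IsElementMap q) {i j : Fin 3}
    (h : side p i = side q j) {x : Plane} (hx : x ∈ side p i) :
    sideNormal q j x = sideNormal p i x ∨ sideNormal q j x = -sideNormal p i x := by
  obtain ⟨θ, θ', hθ, hinj, himg, hc⟩ := hp.exists_reparametrization hq h
  obtain ⟨t, ht, rfl⟩ := hx
  obtain ⟨hc1, hc2⟩ := hc t ht
  have hm : θ t ∈ Set.Icc (0 : ℝ) 1 := himg ▸ Set.mem_image_of_mem θ ht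
  have hzp := refSide_mem ht i
  have hzq := refSide_mem hm j
  have hpar : ∃ c : ℝ, sideNormal q j (polyMap p (refSide i t)) =
      c • sideNormal p i (polyMap p (refSide i t)) := by
    rw [sideNormal_polyMap hp i hzp, ← hc1, sideNormal_polyMap hq j hzq, hc2]
    have hθ0 : θ' t ≠ 0 := by
      intro h0
      rw [h0, zero_smul] at hc2
      exact sideTangent_ne_zero (hp.2 _ hzp) i hc2
    have hrot : rot (θ' t • sideTangent q j (refSide j (θ t))) =
        θ' t • rot (sideTangent q j (refSide j (θ t))) := by
      ext l; fin_cases l <;> simp [rot]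
    rw [hrot, norm_smul]
    have hn := norm_ne_zero_iff.2 (sideTangent_ne_zero (hq.2 _ hzq) j)
    have hdp := hp.2 _ hzp
    have hadp := abs_ne_zero.2 hdp
    have hθa := norm_ne_zero_iff.2 hθ0
    refine ⟨(|(polyJacobian q (refSide j (θ t))).det|⁻¹ * (polyJacobian q (refSide j (θ t))).det) *
      (|(polyJacobian p (refSide i t)).det| * (polyJacobian p (refSide i t)).det⁻¹ *
      ‖θ' t‖ * (θ' t)⁻¹), ?_⟩
    simp only [smul_smul]
    congr 1
    field_simp
  obtain ⟨c, hcn⟩ := hpar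
  have hnq : ‖sideNormal q j (polyMap p (refSide i t))‖ = 1 := by
    rw [← hc1]; exact norm_sideNormal_polyMap hq j hzq
  have hnp := norm_sideNormal_polyMap hp i hzp
  rw [hcn, norm_smul, hnp, mul_one, Real.norm_eq_abs] at hnq
  rcases abs_eq_abs.1 (hnq.trans abs_one.symm) with rfl | rfl
  · exact Or.inl (by simpa using hcn)
  · exact Or.inr (by simpa using hcn)

/-- The normal points out of the element. -/
theorem eventually_sub_smul_sideNormal_mem (hp : IsElementMap p) {j : Fin 3} {x : Plane}
    (hx : x ∈ openSide p j) :
    ∀ᶠ ε : ℝ in 𝓝[>] 0, x - ε • sideNormal p j x ∈ openElement p := by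
  obtain ⟨t, ht, rfl⟩ := hx
  obtain ⟨G, hG, hGl⟩ := hp.exists_smooth_leftInverse
  set z := refSide j t with hz
  have hzm : z ∈ refTriangle := refSide_mem (Set.Ioo_subset_Icc_self ht) j
  have hGz : G (polyMap p z) = z := hGl.self_of_nhdsSet z hzm
  simp only [← hz]
  set n := sideNormal p j (polyMap p z) with hn
  have hline : Continuous fun ε : ℝ => polyMap p z - ε • n := by fun_prop
  -- `G` is also a right inverse near `ψ(z)`, since `ψ` maps neighbourhoods of `z` onto
  -- neighbourhoods of `ψ(z)`.
  have hright : ∀ᶠ ε : ℝ in 𝓝 0, polyMap p (G (polyMap p z - ε • n)) = polyMap p z - ε • n := by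
    have h1 : ∀ᶠ y in 𝓝 (polyMap p z), polyMap p (G y) = y := by
      rw [← map_nhds_polyMap p z (hp.2 z hzm), eventually_map]
      filter_upwards [hGl.filter_mono (nhds_le_nhdsSet hzm)] with y hy
      rw [hy]
    have h2 := hline.tendsto 0
    simp only [zero_smul, sub_zero] at h2
    exact h2.eventually h1
  have hGc : Continuous fun ε : ℝ => G (polyMap p z - ε • n) := hG.continuous.comp hline
  have hdc : ∀ i, Continuous (refDist i) := fun i => by unfold refDist; fun_prop
  have hothers : ∀ i, i ≠ j → ∀ᶠ ε : ℝ in 𝓝 0, 0 < refDist i (G (polyMap p z - ε • n)) := by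
    intro i hij
    have h2 := ((hdc i).comp hGc).tendsto 0
    simp only [Function.comp_apply, zero_smul, sub_zero, hGz] at h2
    exact h2.eventually (lt_mem_nhds (refDist_refSide_pos hij.symm ht))
  -- On its own side the barycentric coordinate is zero, so its sign is decided by the derivative
  -- along `-n`. The other two coordinates are already positive at the point.
  have hself : ∀ᶠ ε : ℝ in 𝓝[>] 0, 0 < refDist j (G (polyMap p z - ε • n)) := by
    have hd1 : HasDerivAt (fun ε : ℝ => polyMap p z - ε • n) (-n) 0 := by
      have := ((hasDerivAt_id (0 : ℝ)).smul_const n).const_sub (polyMap p z)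
      simpa using this
    have hG' : HasFDerivAt G (fderiv ℝ G (polyMap p z)) (polyMap p z - (0 : ℝ) • n) := by
      rw [zero_smul, sub_zero]
      exact (hG.differentiable (by simp) _).hasFDerivAt
    have hd2 := hG'.comp_hasDerivAt 0 hd1
    let ℓ : Plane →L[ℝ] ℝ := refNormal j 0 • EuclideanSpace.proj 0 +
      refNormal j 1 • EuclideanSpace.proj 1
    have hℓ : ∀ y, refDist j y = ![0, 1, 0] j - ℓ y := fun y => by simp [refDist, ℓ]
    have hd3 : HasDerivAt (fun ε : ℝ => refDist j (G (polyMap p z - ε • n)))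
        (ℓ (fderiv ℝ G (polyMap p z) n)) 0 := by
      have h4 := (ℓ.hasFDerivAt.comp_hasDerivAt 0 hd2).const_sub (![0, 1, 0] j)
      simp only [map_neg, neg_neg] at h4
      exact h4.congr_of_eventuallyEq (Eventually.of_forall fun ε => hℓ _)
    have hpos : 0 < ℓ (fderiv ℝ G (polyMap p z) n) := by
      have hdet := hp.2 z hzm
      set m := fderiv ℝ G (polyMap p z) n with hm
      have hDm : polyDeriv p z m = n := (polyDeriv_fderiv_leftInverse hp hG hGl hzm n).1
      have hcoef := sideNormal_polyMap hp j hzm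
      rw [← hn] at hcoef
      have hin : (1 : ℝ) = n 0 * n 0 + n 1 * n 1 := by
        have := norm_sideNormal_polyMap hp j hzm
        rw [← hn, EuclideanSpace.norm_eq, Real.sqrt_eq_one, Fin.sum_univ_two] at this
        simpa [sq] using this.symm
      set c := |(polyJacobian p z).det|⁻¹ * (polyJacobian p z).det * ‖sideTangent p j z‖⁻¹ with hc
      have e0 : n 0 = c * sideTangent p j z 1 := by rw [hcoef]; simp [rot]
      have e1 : n 1 = -(c * sideTangent p j z 0) := by rw [hcoef]; simp [rot]
      have d0 : n 0 = polyJacobian p z 0 0 * m 0 + polyJacobian p z 0 1 * m 1 := by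
        rw [← hDm, polyDeriv_apply]; simp [Fin.sum_univ_two]
      have d1 : n 1 = polyJacobian p z 1 0 * m 0 + polyJacobian p z 1 1 * m 1 := by
        rw [← hDm, polyDeriv_apply]; simp [Fin.sum_univ_two]
      have s0 : sideTangent p j z 0 = -polyJacobian p z 0 0 * refNormal j 1 +
          polyJacobian p z 0 1 * refNormal j 0 := by
        simp [sideTangent, polyDeriv_apply, Fin.sum_univ_two, refTangent_apply_zero,
          refTangent_apply_one]
      have s1 : sideTangent p j z 1 = -polyJacobian p z 1 0 * refNormal j 1 +
          polyJacobian p z 1 1 * refNormal j 0 := by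
        simp [sideTangent, polyDeriv_apply, Fin.sum_univ_two, refTangent_apply_zero,
          refTangent_apply_one]
      have hl : ℓ m = refNormal j 0 * m 0 + refNormal j 1 * m 1 := by simp [ℓ]
      -- With `n = Dψ m = c · rot(Dψ τ̂)` one has `1 = n · n = c (cof(Dψ) n̂) · (Dψ m) = c det(Dψ)
      -- (n̂ · m)`, and `c det(Dψ)` is positive.
      have hkey : 1 = (c * (polyJacobian p z).det) * ℓ m := by
        have h1 : n 0 * n 0 + n 1 * n 1 = c * sideTangent p j z 1 * n 0 +
            -(c * sideTangent p j z 0) * n 1 := by rw [← e0, ← e1]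
        rw [hl, Matrix.det_fin_two, hin, h1, d0, d1, s0, s1]
        ring
      have hcd : 0 < c * (polyJacobian p z).det := by
        have hn := norm_pos_iff.2 (sideTangent_ne_zero hdet j)
        have : c * (polyJacobian p z).det = |(polyJacobian p z).det|⁻¹ *
            ((polyJacobian p z).det * (polyJacobian p z).det) * ‖sideTangent p j z‖⁻¹ := by
          rw [hc]; ring
        rw [this]
        have := mul_self_pos.2 hdet
        have := abs_pos.2 hdet
        positivity
      exact pos_of_mul_pos_right (by rw [← hkey]; exact one_pos) hcd.le
    have h5 := hd3.tendsto_slope_zero_right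
    have h6 := h5.eventually (lt_mem_nhds hpos)
    filter_upwards [h6, self_mem_nhdsWithin] with ε hε hε0
    have hz0 : refDist j z = 0 := refDist_refSide_self j t
    simp only [zero_smul, sub_zero, hGz, zero_add, hz0, smul_eq_mul] at hε
    exact pos_of_mul_pos_right hε (inv_nonneg.2 (le_of_lt hε0))
  have hoth : ∀ᶠ ε : ℝ in 𝓝[>] 0, ∀ i, i ≠ j → 0 < refDist i (G (polyMap p z - ε • n)) := by
    rw [eventually_all]
    intro i
    by_cases hij : i = j
    · exact Eventually.of_forall fun ε h => (h hij).elim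
    · exact ((hothers i hij).filter_mono nhdsWithin_le_nhds).mono fun ε h _ => h
  filter_upwards [hself, hoth, hright.filter_mono nhdsWithin_le_nhds] with ε h1 h2 h3
  refine ⟨_, mem_refOpenTriangle_iff.2 fun i => ?_, h3⟩
  by_cases hij : i = j
  · exact hij ▸ h1
  · exact h2 i hij

/-- Disjoint elements have opposite normals on a common side. -/
theorem sideNormal_eq_neg (hp : IsElementMap p) (hq : IsElementMap q) {i j : Fin 3}
    (h : side p i = side q j) (hd : Disjoint (openElement p) (openElement q)) {x : Plane}
    (hx : x ∈ openSide p i) : sideNormal q j x = -sideNormal p i x := by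
  refine (hp.sideNormal_eq_or_neg hq h (openSide_subset_side p i hx)).resolve_left fun he => ?_
  -- If the normals were equal, a small step against them would end in both open elements.
  have h1 := hp.eventually_sub_smul_sideNormal_mem hx
  have h2 := hq.eventually_sub_smul_sideNormal_mem (hp.openSide_subset hq h hx)
  rw [he] at h2
  obtain ⟨ε, h3, h4⟩ := (h1.and h2).exists
  exact Set.disjoint_left.1 hd h3 h4

theorem openSide_nonempty (p : PolyPair) (j : Fin 3) : (openSide p j).Nonempty :=
  ⟨_, 1 / 2, by norm_num, rfl⟩

/-- At most two disjoint elements have a common side. -/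
theorem not_three_elements (hp : IsElementMap p) (hq : IsElementMap q) (hr : IsElementMap r)
    {i j l : Fin 3} (hpq : side p i = side q j) (hpr : side p i = side r l)
    (dpq : Disjoint (openElement p) (openElement q))
    (dpr : Disjoint (openElement p) (openElement r))
    (dqr : Disjoint (openElement q) (openElement r)) : False := by
  obtain ⟨t, ht⟩ := openSide_nonempty p i
  have h1 := hp.sideNormal_eq_neg hq hpq dpq ht
  have h2 := hp.sideNormal_eq_neg hr hpr dpr ht
  -- Three pairwise opposite vectors vanish, but normals have length one.
  have h3 := hq.sideNormal_eq_neg hr (hpq.symm.trans hpr) dqr (hp.openSide_subset hq hpq ht)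
  rw [h1, h2, neg_neg] at h3
  obtain ⟨s, hs, rfl⟩ := ht
  have h4 := norm_sideNormal_polyMap hp i (refSide_mem (Set.Ioo_subset_Icc_self hs) i)
  have h5 : sideNormal p i (polyMap p (refSide i s)) = 0 := by
    have h6 : (2 : ℝ) • sideNormal p i (polyMap p (refSide i s)) = 0 := by
      rw [two_smul]; nth_rewrite 1 [← h3]; simp
    exact (smul_eq_zero.1 h6).resolve_left two_ne_zero
  rw [h5, norm_zero] at h4
  exact zero_ne_one h4

end IsElementMap

/-! ### Traces from both sides of a common side -/

theorem setIntegral_eq_add_of_ae_sdiff {α : Type*} [MeasurableSpace α] {μ : Measure α}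
    {A B V : Set α} {F : α → ℝ} (hB : MeasurableSet B)
    (hV : MeasurableSet V) (hAV : A ⊆ V) (hBV : B ⊆ V) (hd : Disjoint A B)
    (h : ∀ᵐ x ∂μ, x ∈ V \ (A ∪ B) → F x = 0) (hFA : IntegrableOn F A μ)
    (hFB : IntegrableOn F B μ) :
    ∫ x in V, F x ∂μ = ∫ x in A, F x ∂μ + ∫ x in B, F x ∂μ := by
  rw [setIntegral_eq_of_subset_of_ae_sdiff_eq_zero hV.nullMeasurableSet
    (Set.union_subset hAV hBV) h, setIntegral_union hd hB hFA hFB]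

namespace IsElementMap

variable {p q : PolyPair}

theorem ae_norm_sideNormal (hp : IsElementMap p) (j : Fin 3) :
    ∀ᵐ x ∂(sideMeasure p j), ‖sideNormal p j x‖ = 1 := by
  refine ae_sideMeasure_of_forall_openSide p j ?_
  rintro _ ⟨t, ht, rfl⟩
  exact norm_sideNormal_polyMap hp j (refSide_mem (Set.Ioo_subset_Icc_self ht) j)

theorem aestronglyMeasurable_sideNormal (hp : IsElementMap p) (j : Fin 3) (i : Fin 2) :
    AEStronglyMeasurable (fun x => sideNormal p j x i) (sideMeasure p j) :=
  ((hp.continuousOn_sideNormal j i).mono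
    (side_subset_element p j)).aestronglyMeasurable_sideMeasure

theorem memLp_mul_sideNormal (hp : IsElementMap p) {j : Fin 3} {τ : Plane → ℝ}
    (hτ : MemLp τ 2 (sideMeasure p j)) (i : Fin 2) :
    MemLp (fun x => τ x * sideNormal p j x i) 2 (sideMeasure p j) := by
  refine hτ.mono (hτ.1.mul (hp.aestronglyMeasurable_sideNormal j i)) ?_
  filter_upwards [hp.ae_norm_sideNormal j] with x hx
  rw [norm_mul]
  exact mul_le_of_le_one_right (norm_nonneg _) (hx ▸ PiLp.norm_apply_le _ i)

/-- A test function that vanishes on the other two sides isolates the trace on the side `j` in the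
integration by parts formula. -/
theorem integral_trace_of_eq_zero (hp : IsElementMap p) {w φ : Plane → ℝ}
    (hw : MemSobolev 1 (openElement p) w) (hφ : ContDiff ℝ 1 φ) {j : Fin 3}
    (h0 : ∀ a, a ≠ j → ∀ x ∈ side p a, φ x = 0) (i : Fin 2) :
    ∫ x, trace (openElement p) (sideMeasure p j) w x * (φ x * sideNormal p j x i)
        ∂(sideMeasure p j) =
      (∫ x in openElement p, weakPartial (openElement p) i w x * φ x) +
        ∫ x in openElement p, w x * fderiv ℝ φ x (basisVec i) := by
  rw [hp.integral_weakPartial_mul hw hφ i, Finset.sum_eq_single j, sub_add_cancel]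
  · intro a _ haj
    refine integral_eq_zero_of_ae ?_
    filter_upwards [ae_sideMeasure_mem_openSide p a] with x hx
    rw [h0 a haj x (openSide_subset_side p a hx)]
    simp
  · simp

/-- A Sobolev function on a neighbourhood of a common side has the same trace from both sides. -/
theorem trace_eq_of_side_eq (hp : IsElementMap p) (hq : IsElementMap q) {i j : Fin 3}
    (h : side p i = side q j) (hd : Disjoint (openElement p) (openElement q)) {V : Set Plane}
    (hV : IsOpen V) (hpV : openElement p ⊆ V) (hqV : openElement q ⊆ V)
    (hnhds : ∀ x ∈ openSide p i, V ∩ (element p ∪ element q) ∈ 𝓝 x) {w : Plane → ℝ}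
    (hw : MemSobolev 1 V w) :
    ∀ᵐ x ∂(sideMeasure p i), trace (openElement p) (sideMeasure p i) w x =
      trace (openElement q) (sideMeasure q j) w x := by
  have hσ := hp.sideMeasure_congr hq h
  have hOp := hp.isOpen_openElement
  have hOq := hq.isOpen_openElement
  set τ := trace (openElement p) (sideMeasure p i) w with hτ
  set τ' := trace (openElement q) (sideMeasure q j) w with hτ'
  have hτL : MemLp τ 2 (sideMeasure p i) := trace_memLp _ _ _
  have hτL' : MemLp τ' 2 (sideMeasure p i) := hσ ▸ trace_memLp _ _ _
  have hn : ∀ᵐ x ∂(sideMeasure p i), sideNormal q j x = -sideNormal p i x :=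
    ae_sideMeasure_of_forall_openSide p i fun x hx => hp.sideNormal_eq_neg hq h hd hx
  -- The neighbourhood `B` of `x` is chosen so small that it is covered by the two elements and
  -- misses all their other sides.
  have hlocal : ∀ x ∈ openSide p i, ∃ B, IsOpen B ∧ x ∈ B ∧ ∀ᵐ y ∂(sideMeasure p i), y ∈ B →
      τ y = τ' y := by
    intro x hx
    have hxq := hp.openSide_subset hq h hx
    have hclosed : ∀ (r : PolyPair) (a b : Fin 3), IsElementMap r → x ∈ openSide r a → a ≠ b →
        (side r b)ᶜ ∈ 𝓝 x := fun r a b hr hxa hab =>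
      (isCompact_side r b).isClosed.isOpen_compl.mem_nhds fun hxb => hab (hr.eq_of_mem_side hxa hxb)
    have hN : (V ∩ (element p ∪ element q)) ∩ ((⋂ a, ⋂ (_ : i ≠ a), (side p a)ᶜ) ∩
        ⋂ a, ⋂ (_ : j ≠ a), (side q a)ᶜ) ∈ 𝓝 x := by
      refine inter_mem (hnhds x hx) (inter_mem ?_ ?_)
      · exact iInter_mem.2 fun a => iInter_mem.2 fun ha => hclosed p i a hp hx ha
      · exact iInter_mem.2 fun a => iInter_mem.2 fun ha => hclosed q j a hq hxq ha
    obtain ⟨B, hBsub, hB, hxB⟩ := mem_nhds_iff.1 hN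
    refine ⟨B, hB, hxB, ?_⟩
    have hBV : B ⊆ V := fun y hy => (hBsub hy).1.1
    -- The integration by parts formulas of both elements are added for a test function supported in
    -- `B`. The volume terms cancel by the definition of the weak derivative on `V`, and the
    -- opposite normals leave `∫ (τ - τ') φ n_l = 0`.
    have hcomp : ∀ l : Fin 2, ∀ᵐ y ∂(sideMeasure p i), y ∈ B →
        τ y * sideNormal p i y l - τ' y * sideNormal p i y l = 0 := by
      intro l
      refine hB.ae_eq_zero_of_integral_contDiff_smul_eq_zero ?_ fun φ hφ hc hs => ?_
      · exact (((hp.memLp_mul_sideNormal hτL l).sub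
          (hp.memLp_mul_sideNormal hτL' l)).integrable (by norm_num)).locallyIntegrable.locallyIntegrableOn _
      have hφ1 : ContDiff ℝ 1 φ := hφ.of_le (by simp)
      have hz : ∀ y, y ∉ B → φ y = 0 := fun y hy =>
        image_eq_zero_of_notMem_tsupport fun h => hy (hs h)
      have hz' : ∀ y, y ∉ B → fderiv ℝ φ y (basisVec l) = 0 := fun y hy =>
        image_eq_zero_of_notMem_tsupport (f := fun y => fderiv ℝ φ y (basisVec l)) fun h =>
          hy (hs ((tsupport_fderiv_apply_subset ℝ _) h))
      have gp := hp.integral_trace_of_eq_zero (hw.mono hpV) hφ1 (j := i)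
        (fun a ha y hy => hz y fun hyB => by
          have := Set.mem_iInter₂.1 (hBsub hyB).2.1 a ha.symm
          exact this hy) l
      have gq := hq.integral_trace_of_eq_zero (hw.mono hqV) hφ1 (j := j)
        (fun a ha y hy => hz y fun hyB => by
          have := Set.mem_iInter₂.1 (hBsub hyB).2.2 a ha.symm
          exact this hy) l
      have hφL : ∀ (r : PolyPair), MemLp φ 2 (volume.restrict (openElement r)) := fun r =>
        hφ.continuous.memLp_two_restrict_of_isBounded (isBounded_openElement r)
      have hφL' : ∀ (r : PolyPair), MemLp (fun y => fderiv ℝ φ y (basisVec l)) 2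
          (volume.restrict (openElement r)) := fun r =>
        (contDiff_fderiv_apply (m := 0) hφ1 (by simp) _).continuous.memLp_two_restrict_of_isBounded
          (isBounded_openElement r)
      have hnull : ∀ F : Plane → ℝ, (∀ y, y ∉ B → F y = 0) →
          ∀ᵐ y, y ∈ V \ (openElement p ∪ openElement q) → F y = 0 := by
        intro F hF
        have np := measure_eq_zero_iff_ae_notMem.1 (volume_element_sdiff p)
        have nq := measure_eq_zero_iff_ae_notMem.1 (volume_element_sdiff q)
        filter_upwards [np, nq] with y hyp hyq hy
        refine hF y fun hyB => ?_
        rcases (hBsub hyB).1.2 with h1 | h1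
        · exact hyp ⟨h1, fun h2 => hy.2 (Or.inl h2)⟩
        · exact hyq ⟨h1, fun h2 => hy.2 (Or.inr h2)⟩
      have hwp := hw.isWeakPartial l
      have hsplit1 := setIntegral_eq_add_of_ae_sdiff (μ := volume)
        hOq.measurableSet hV.measurableSet hpV hqV hd
        (F := fun y => weakPartial V l w y * φ y)
        (hnull _ fun y hy => by simp only [hz y hy, mul_zero])
        (integrable_mul_of_memLp_two ((hw.weakPartial hV l).mono hpV).memLp (hφL p))
        (integrable_mul_of_memLp_two ((hw.weakPartial hV l).mono hqV).memLp (hφL q))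
      have hsplit2 := setIntegral_eq_add_of_ae_sdiff (μ := volume)
        hOq.measurableSet hV.measurableSet hpV hqV hd
        (F := fun y => w y * fderiv ℝ φ y (basisVec l))
        (hnull _ fun y hy => by simp only [hz' y hy, mul_zero])
        (integrable_mul_of_memLp_two (hw.mono hpV).memLp (hφL' p))
        (integrable_mul_of_memLp_two (hw.mono hqV).memLp (hφL' q))
      have ep : ∫ y in openElement p, weakPartial (openElement p) l w y * φ y =
          ∫ y in openElement p, weakPartial V l w y * φ y := integral_congr_ae (by
        filter_upwards [weakPartial_mono_ae hOp hpV hw l] with y hy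
        rw [hy])
      have eq : ∫ y in openElement q, weakPartial (openElement q) l w y * φ y =
          ∫ y in openElement q, weakPartial V l w y * φ y := integral_congr_ae (by
        filter_upwards [weakPartial_mono_ae hOq hqV hw l] with y hy
        rw [hy])
      have hweak := hwp.2.2 φ hφ hc (hs.trans hBV)
      rw [hsplit1, hsplit2, ← ep, ← eq] at hweak
      rw [← hτ'] at gq
      have eσ : ∫ y, τ' y * (φ y * sideNormal q j y l) ∂(sideMeasure q j) =
          -∫ y, τ' y * (φ y * sideNormal p i y l) ∂(sideMeasure p i) := by
        rw [← hσ, ← integral_neg]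
        refine integral_congr_ae ?_
        filter_upwards [hn] with y hy
        rw [hy]
        simp
      have hφσ := hφ.continuous.continuousOn.memLp_sideMeasure (p := p) (j := i)
      have e1 : ∀ {σ : Plane → ℝ}, MemLp σ 2 (sideMeasure p i) →
          Integrable (fun y => σ y * (φ y * sideNormal p i y l)) (sideMeasure p i) := fun hσ =>
        integrable_mul_of_memLp_two hσ (hp.memLp_mul_sideNormal hφσ l)
      have e2 : ∀ y, φ y • (τ y * sideNormal p i y l - τ' y * sideNormal p i y l) =
          τ y * (φ y * sideNormal p i y l) - τ' y * (φ y * sideNormal p i y l) := fun y => by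
        rw [smul_eq_mul]; ring
      simp only [e2]
      rw [integral_sub (e1 hτL) (e1 hτL')]
      rw [eσ] at gq
      linarith
    filter_upwards [hcomp 0, hcomp 1, hp.ae_norm_sideNormal i] with y h0 h1 hy hyB
    have h0 := h0 hyB
    have h1 := h1 hyB
    rw [← sub_mul] at h0 h1
    -- One component of the unit normal is nonzero.
    rcases mul_eq_zero.1 h0 with h2 | h2
    · exact sub_eq_zero.1 h2
    rcases mul_eq_zero.1 h1 with h3 | h3
    · exact sub_eq_zero.1 h3
    rw [EuclideanSpace.norm_eq, Fin.sum_univ_two, h2, h3] at hy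
    simp at hy
  -- A set that is null near each of its points is null, because the plane is second countable.
  have hnull : sideMeasure p i (openSide p i ∩ {y | τ y ≠ τ' y}) = 0 := by
    refine measure_null_of_locally_null _ fun x hx => ?_
    obtain ⟨B, hB, hxB, hBae⟩ := hlocal x hx.1
    refine ⟨B ∩ {y | τ y ≠ τ' y}, ?_, ?_⟩
    · filter_upwards [mem_nhdsWithin_of_mem_nhds (hB.mem_nhds hxB), self_mem_nhdsWithin]
        with y h1 h2 using ⟨h1, h2.2⟩
    · refine measure_eq_zero_iff_ae_notMem.2 ?_
      filter_upwards [hBae] with y hy hy' using hy'.2 (hy hy'.1)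
  filter_upwards [measure_eq_zero_iff_ae_notMem.1 hnull, ae_sideMeasure_mem_openSide p i]
    with y h1 h2
  by_contra h3
  exact h1 ⟨h2, h3⟩

end IsElementMap

/-! ### The sides of a triangulation -/

theorem FoldedPlate.isOpen_union (P : FoldedPlate) : IsOpen (P.Ω₁ ∪ P.Ω₂) :=
  P.isOpen_Ω₁.union P.isOpen_Ω₂

namespace IsoMesh

variable {k : ℕ} {P : FoldedPlate} (M : IsoMesh k P)

theorem openElement_subset_union (T : Fin M.n) : openElement (M.ψ T) ⊆ P.Ω₁ ∪ P.Ω₂ := by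
  intro x hx
  have h := M.openElement_subset T hx
  rw [P.partition] at h
  exact h.resolve_right (Set.disjoint_left.1 (M.openElement_disjoint_Γ T) hx)

theorem isSideIn (s : M.Side) : P.IsSideIn (M.el s) :=
  ⟨M.isElementMap s.1, M.openElement_subset_union s.1⟩

/-- By conformity two elements meet at most in a side or a vertex, and an open element contains no
point of its own sides. -/
theorem disjoint_openElement {T T' : Fin M.n} (h : T ≠ T') :
    Disjoint (openElement (M.ψ T)) (openElement (M.ψ T')) := by
  rw [Set.disjoint_left]
  intro x hx hx'
  have hxx : x ∈ element (M.ψ T) ∩ element (M.ψ T') :=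
    ⟨openElement_subset_element _ hx, openElement_subset_element _ hx'⟩
  have hside : ∀ i, x ∉ side (M.ψ T) i := fun i =>
    Set.disjoint_left.1 ((M.isElementMap T).disjoint_openElement_side i) hx
  rcases M.conforming T T' h with h1 | ⟨i, j, -, h1⟩ | ⟨i, j, -, h1⟩
  · exact Set.disjoint_left.1 h1 hxx.1 hxx.2
  · rw [h1, Set.mem_singleton_iff] at hxx
    exact hside i ⟨0, by simp, by rw [hxx, refVertex_eq_refSide]⟩
  · rw [h1] at hxx
    exact hside i hxx

theorem exists_side_eq {T T' : Fin M.n} (h : T ≠ T') {i : Fin 3} {x : Plane}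
    (hx : x ∈ openSide (M.ψ T) i) (hx' : x ∈ element (M.ψ T')) :
    ∃ j, side (M.ψ T) i = side (M.ψ T') j := by
  have hxx : x ∈ element (M.ψ T) ∩ element (M.ψ T') :=
    ⟨side_subset_element _ i (openSide_subset_side _ i hx), hx'⟩
  rcases M.conforming T T' h with h1 | ⟨a, b, -, h1⟩ | ⟨a, b, hab, h1⟩
  · exact (Set.disjoint_left.1 h1 hxx.1 hxx.2).elim
  · rw [h1, Set.mem_singleton_iff] at hxx
    exact ((M.isElementMap T).vertex_notMem_openSide i a (hxx ▸ hx)).elim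
  · rw [h1] at hxx
    exact ⟨b, by rw [(M.isElementMap T).eq_of_mem_side hx hxx]; exact hab⟩

theorem eq_of_side_eq {T : Fin M.n} {i j : Fin 3} (h : side (M.ψ T) i = side (M.ψ T) j) :
    i = j := by
  obtain ⟨x, hx⟩ := IsElementMap.openSide_nonempty (M.ψ T) i
  exact (M.isElementMap T).eq_of_mem_side hx (h ▸ openSide_subset_side _ i hx)

theorem not_three {T T' T'' : Fin M.n} {i j l : Fin 3} (h1 : T ≠ T') (h2 : T ≠ T'') (h3 : T' ≠ T'')
    (h : side (M.ψ T) i = side (M.ψ T') j) (h' : side (M.ψ T) i = side (M.ψ T'') l) : False :=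
  (M.isElementMap T).not_three_elements (M.isElementMap T') (M.isElementMap T'') h h'
    (M.disjoint_openElement h1) (M.disjoint_openElement h2) (M.disjoint_openElement h3)

/-- A side of an element is a side of at most one other element. -/
theorem eq_of_closedSet_eq {s t t' : M.Side} (h : s.1 ≠ t.1) (h' : s.1 ≠ t'.1)
    (hst : (M.el s).closedSet = (M.el t).closedSet)
    (hst' : (M.el s).closedSet = (M.el t').closedSet) : t = t' := by
  by_cases hT : t.1 = t'.1
  · obtain ⟨T, j⟩ := t
    obtain ⟨T', j'⟩ := t'
    obtain rfl : T = T' := hT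
    have : side (M.ψ T) j = side (M.ψ T) j' := hst.symm.trans hst'
    rw [M.eq_of_side_eq this]
  · exact (M.not_three h h' hT hst hst').elim

/-- Any further element through `x` would share the side, which three elements cannot do. The
remaining elements are finitely many closed sets that miss `x`, and the mesh covers `Ω`, so near `x`
the two elements cover everything. -/
theorem mem_nhds_of_side_eq {T T' : Fin M.n} {i j : Fin 3} (hT : T ≠ T')
    (h : side (M.ψ T) i = side (M.ψ T') j) (hV : openSide (M.ψ T) i ⊆ P.Ω₁ ∪ P.Ω₂) {x : Plane}
    (hx : x ∈ openSide (M.ψ T) i) :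
    (P.Ω₁ ∪ P.Ω₂) ∩ (element (M.ψ T) ∪ element (M.ψ T')) ∈ 𝓝 x := by
  have hN : (⋂ T'', ⋂ (_ : T ≠ T'' ∧ T' ≠ T''), (element (M.ψ T''))ᶜ) ∈ 𝓝 x := by
    refine iInter_mem.2 fun T'' => iInter_mem.2 fun hT'' => ?_
    refine (isCompact_element _).isClosed.isOpen_compl.mem_nhds fun hxT => ?_
    obtain ⟨l, hl⟩ := M.exists_side_eq hT''.1 hx hxT
    exact M.not_three hT hT''.1 hT''.2 h hl
  filter_upwards [hN, P.isOpen_union.mem_nhds (hV hx)] with y hy hyV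
  refine ⟨hyV, ?_⟩
  have hyc : y ∈ ⋃ T, element (M.ψ T) := by
    rw [M.cover, P.partition]
    exact subset_closure (Or.inl hyV)
  obtain ⟨T'', hyT⟩ := Set.mem_iUnion.1 hyc
  by_cases h1 : T = T''
  · exact Or.inl (h1 ▸ hyT)
  by_cases h2 : T' = T''
  · exact Or.inr (h2 ▸ hyT)
  exact (Set.mem_iInter₂.1 hy T'' ⟨h1, h2⟩ hyT).elim

theorem mem_innerSides {e : M.SidePair} : e ∈ M.innerSides ↔
    e.1.1 < e.2.1 ∧ (M.el e.1).closedSet = (M.el e.2).closedSet := by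
  simp [innerSides]

theorem mem_interfaceSides {e : M.SidePair} : e ∈ M.interfaceSides ↔
    e ∈ M.innerSides ∧ (M.el e.1).openSet ⊆ P.Γ := by
  simp [interfaceSides]

theorem mem_clampedSides {s : M.Side} : s ∈ M.clampedSides ↔ (M.el s).openSet ⊆ P.D := by
  simp [clampedSides]

open Classical in
/-- The sides that belong to only one element. -/
def boundarySides : Finset M.Side :=
  Finset.univ.filter fun s => ∀ t : M.Side, s.1 ≠ t.1 → (M.el s).closedSet ≠ (M.el t).closedSet

theorem mem_boundarySides {s : M.Side} : s ∈ M.boundarySides ↔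
    ∀ t : M.Side, s.1 ≠ t.1 → (M.el s).closedSet ≠ (M.el t).closedSet := by
  simp [boundarySides]

theorem openSet_subset_frontier {s : M.Side} (hs : s ∈ M.boundarySides) :
    (M.el s).openSet ⊆ frontier P.Ω :=
  M.boundary_side s.1 s.2 fun T' j hT => M.mem_boundarySides.1 hs (T', j) hT

theorem openSet_subset_of_mem_innerSides {e : M.SidePair} (he : e ∈ M.innerSides) :
    (M.el e.1).openSet ⊆ P.Ω :=
  M.interior_side e.1.1 e.2.1 e.1.2 e.2.2 (M.mem_innerSides.1 he).1.ne (M.mem_innerSides.1 he).2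

/-- A shared side lies in the open set `Ω`, whereas `D` lies in its frontier. -/
theorem clampedSides_subset : M.clampedSides ⊆ M.boundarySides := by
  intro s hs
  rw [M.mem_boundarySides]
  intro t hst hcl
  obtain ⟨x, hx⟩ := IsElementMap.openSide_nonempty (M.ψ s.1) s.2
  have h1 : x ∈ P.Ω := M.interior_side s.1 t.1 s.2 t.2 hst hcl hx
  have h2 : x ∈ frontier P.Ω := P.D_subset (M.mem_clampedSides.1 hs hx)
  rw [P.isOpen_Ω.frontier_eq] at h2
  exact h2.2 h1

-- Each side of an element occurs exactly once: as first or as second entry of one inner pair, or as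
-- a side without partner. Uniqueness of the neighbour makes both projections injective and their
-- images disjoint.
open Classical in
theorem sum_sides (F : M.Side → ℝ) :
    ∑ s, F s = ∑ e ∈ M.innerSides, (F e.1 + F e.2) + ∑ s ∈ M.boundarySides, F s := by
  have hinj1 : Set.InjOn (Prod.fst : M.SidePair → M.Side) M.innerSides := by
    rintro ⟨s, t⟩ h1 ⟨s', t'⟩ h2 (rfl : s = s')
    obtain ⟨a1, b1⟩ := M.mem_innerSides.1 h1
    obtain ⟨a2, b2⟩ := M.mem_innerSides.1 h2
    exact Prod.ext rfl (M.eq_of_closedSet_eq a1.ne a2.ne b1 b2)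
  have hinj2 : Set.InjOn (Prod.snd : M.SidePair → M.Side) M.innerSides := by
    rintro ⟨s, t⟩ h1 ⟨s', t'⟩ h2 (rfl : t = t')
    obtain ⟨a1, b1⟩ := M.mem_innerSides.1 h1
    obtain ⟨a2, b2⟩ := M.mem_innerSides.1 h2
    exact Prod.ext (M.eq_of_closedSet_eq a1.ne' a2.ne' b1.symm b2.symm) rfl
  have hd1 : Disjoint (M.innerSides.image Prod.fst) (M.innerSides.image Prod.snd) := by
    rw [Finset.disjoint_left]
    intro s h1 h2
    obtain ⟨⟨_, t⟩, e1, rfl⟩ := Finset.mem_image.1 h1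
    obtain ⟨⟨t', s⟩, e2, rfl⟩ := Finset.mem_image.1 h2
    obtain ⟨a1, b1⟩ := M.mem_innerSides.1 e1
    obtain ⟨a2, b2⟩ := M.mem_innerSides.1 e2
    have h3 : t = t' := M.eq_of_closedSet_eq (s := s) a1.ne a2.ne' b1 b2.symm
    rw [h3] at a1
    exact lt_asymm a1 a2
  have hd2 : Disjoint (M.innerSides.image Prod.fst ∪ M.innerSides.image Prod.snd)
      M.boundarySides := by
    rw [Finset.disjoint_left]
    intro s h1 h2
    rw [M.mem_boundarySides] at h2
    rcases Finset.mem_union.1 h1 with h1 | h1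
    · obtain ⟨⟨_, t⟩, e1, rfl⟩ := Finset.mem_image.1 h1
      obtain ⟨a1, b1⟩ := M.mem_innerSides.1 e1
      exact h2 t a1.ne b1
    · obtain ⟨⟨t, _⟩, e1, rfl⟩ := Finset.mem_image.1 h1
      obtain ⟨a1, b1⟩ := M.mem_innerSides.1 e1
      exact h2 t a1.ne' b1.symm
  have huniv : (M.innerSides.image Prod.fst ∪ M.innerSides.image Prod.snd) ∪ M.boundarySides =
      Finset.univ := by
    refine Finset.eq_univ_of_forall fun s => ?_
    by_cases hs : s ∈ M.boundarySides
    · exact Finset.mem_union_right _ hs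
    rw [M.mem_boundarySides] at hs
    push Not at hs
    obtain ⟨t, hst, hcl⟩ := hs
    refine Finset.mem_union_left _ ?_
    rcases lt_or_gt_of_ne hst with hlt | hlt
    · exact Finset.mem_union_left _ (Finset.mem_image.2 ⟨(s, t), M.mem_innerSides.2 ⟨hlt, hcl⟩, rfl⟩)
    · exact Finset.mem_union_right _
        (Finset.mem_image.2 ⟨(t, s), M.mem_innerSides.2 ⟨hlt, hcl.symm⟩, rfl⟩)
  rw [← huniv, Finset.sum_union hd2, Finset.sum_union hd1, Finset.sum_image hinj1,
    Finset.sum_image hinj2, Finset.sum_add_distrib]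

/-- The elements cover `Ω` up to null sets. -/
theorem setIntegral_eq_sum {F : Plane → ℝ}
    (hF : ∀ T, IntegrableOn F (openElement (M.ψ T))) :
    ∫ x in P.Ω, F x = ∑ T, ∫ x in openElement (M.ψ T), F x := by
  have hO := fun T => (M.isElementMap T).isOpen_openElement
  have hd : Pairwise (Function.onFun Disjoint fun T => openElement (M.ψ T)) := fun T T' h =>
    M.disjoint_openElement h
  rw [← integral_iUnion_fintype (fun T => (hO T).measurableSet) hd hF]
  refine setIntegral_eq_of_subset_of_ae_sdiff_eq_zero P.isOpen_Ω.measurableSet.nullMeasurableSet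
    (Set.iUnion_subset M.openElement_subset) ?_
  have hnull : ∀ᵐ x : Plane, ∀ T, x ∉ element (M.ψ T) \ openElement (M.ψ T) :=
    ae_all_iff.2 fun T => measure_eq_zero_iff_ae_notMem.1 (IsElementMap.volume_element_sdiff (M.ψ T))
  filter_upwards [hnull] with x hx hxΩ
  have hxc : x ∈ ⋃ T, element (M.ψ T) := by
    rw [M.cover]
    exact subset_closure hxΩ.1
  obtain ⟨T, hT⟩ := Set.mem_iUnion.1 hxc
  exact (hx T ⟨hT, fun h => hxΩ.2 (Set.mem_iUnion.2 ⟨T, h⟩)⟩).elim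

/-- Functions in the discrete space are smooth on the elements. -/
theorem exists_contDiff_ae_eq {v : Plane → ℝ} (hv : v ∈ M.discreteSpace) (T : Fin M.n) :
    ∃ v' : Plane → ℝ, ContDiff ℝ ((⊤ : ℕ∞) : WithTop ℕ∞) v' ∧
      v =ᵐ[volume.restrict (openElement (M.ψ T))] v' := by
  obtain ⟨q, -, hq⟩ := hv T
  obtain ⟨G, hG, hGl⟩ := (M.isElementMap T).exists_smooth_leftInverse
  refine ⟨fun x => MvPolynomial.eval (fun j => G x j) q,
    (contDiff_mvPolynomial_eval q).comp hG, ?_⟩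
  refine (M.isElementMap T).ae_openElement_of_ae_refTriangle ?_
  filter_upwards [hq, ae_restrict_mem isClosed_refTriangle.measurableSet] with x hx hxT
  rw [hx, hGl.self_of_nhdsSet x hxT]

theorem memSobolev_of_mem_discreteSpace {v : Plane → ℝ} (hv : v ∈ M.discreteSpace) (m : ℕ)
    (T : Fin M.n) : MemSobolev m (openElement (M.ψ T)) v := by
  obtain ⟨v', hv', h⟩ := M.exists_contDiff_ae_eq hv T
  exact (MemSobolev.of_contDiff (isBounded_openElement _) hv').congr h.symm

/-- Sobolev functions on both sides of a side have the same trace from both sides. -/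
theorem tr_eq_of_closedSet_eq {s t : M.Side} (hst : s.1 ≠ t.1)
    (h : (M.el s).closedSet = (M.el t).closedSet) (hV : (M.el s).openSet ⊆ P.Ω₁ ∪ P.Ω₂)
    {w : Plane → ℝ} (hw : MemSobolev 1 (P.Ω₁ ∪ P.Ω₂) w) :
    ∀ᵐ x ∂(M.el s).len, (M.el s).tr w x = (M.el t).tr w x :=
  (M.isElementMap s.1).trace_eq_of_side_eq (M.isElementMap t.1) h (M.disjoint_openElement hst)
    P.isOpen_union (M.openElement_subset_union _) (M.openElement_subset_union _)
    (fun _ hx => M.mem_nhds_of_side_eq hst h hV hx) hw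

theorem len_eq {s t : M.Side} (h : (M.el s).closedSet = (M.el t).closedSet) :
    (M.el s).len = (M.el t).len :=
  (M.isElementMap s.1).sideMeasure_congr (M.isElementMap t.1) h

theorem openSet_eq {s t : M.Side} (h : (M.el s).closedSet = (M.el t).closedSet) :
    (M.el s).openSet = (M.el t).openSet :=
  (M.isElementMap s.1).openSide_congr (M.isElementMap t.1) h

theorem normal_eq_neg {s t : M.Side} (hst : s.1 ≠ t.1)
    (h : (M.el s).closedSet = (M.el t).closedSet) :
    ∀ᵐ x ∂(M.el s).len, (M.el t).normal x = -(M.el s).normal x :=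
  ae_sideMeasure_of_forall_openSide _ _ fun _ hx => (M.isElementMap s.1).sideNormal_eq_neg
    (M.isElementMap t.1) h (M.disjoint_openElement hst) hx

end IsoMesh

/-! ### Green's identity for the Hessian on an element -/

theorem weakPartial_add_ae {U : Set Plane} (hU : IsOpen U) {w w' : Plane → ℝ}
    (h : MemSobolev 1 U w) (h' : MemSobolev 1 U w') (i : Fin 2) :
    weakPartial U i (w + w') =ᵐ[volume.restrict U] weakPartial U i w + weakPartial U i w' :=
  ((h.isWeakPartial i).add (h'.isWeakPartial i)).weakPartial_ae_eq hU

theorem weakLaplacian_eq_add (U : Set Plane) (w : Plane → ℝ) :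
    weakLaplacian U w = weakHess U 0 0 w + weakHess U 1 1 w := by
  ext x
  simp [weakLaplacian, Fin.sum_univ_two]

theorem MemSobolev.weakHess {U : Set Plane} {m : ℕ} {w : Plane → ℝ}
    (h : MemSobolev (m + 2) U w) (hU : IsOpen U) (i j : Fin 2) :
    MemSobolev m U (weakHess U i j w) :=
  (h.weakPartial (m := m + 1) hU i).weakPartial hU j

theorem MemSobolev.weakLaplacian {U : Set Plane} {m : ℕ} {w : Plane → ℝ}
    (h : MemSobolev (m + 2) U w) (hU : IsOpen U) : MemSobolev m U (weakLaplacian U w) := by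
  rw [weakLaplacian_eq_add]
  exact (h.weakHess hU 0 0).add (h.weakHess hU 1 1)

theorem weakHess_mono_ae {U V : Set Plane} (hU : IsOpen U) (hV : IsOpen V) (hVU : V ⊆ U)
    {w : Plane → ℝ} (h : MemSobolev 2 U w) (i j : Fin 2) :
    weakHess V i j w =ᵐ[volume.restrict V] weakHess U i j w := by
  have h1 := weakPartial_mono_ae hV hVU (h.of_le (by norm_num)) i
  unfold weakHess
  rw [weakPartial_congr h1]
  exact weakPartial_mono_ae hV hVU (h.weakPartial hU i) j

theorem weakLaplacian_mono_ae {U V : Set Plane} (hU : IsOpen U) (hV : IsOpen V) (hVU : V ⊆ U)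
    {w : Plane → ℝ} (h : MemSobolev 2 U w) :
    weakLaplacian V w =ᵐ[volume.restrict V] weakLaplacian U w := by
  rw [weakLaplacian_eq_add, weakLaplacian_eq_add]
  exact (weakHess_mono_ae hU hV hVU h 0 0).add (weakHess_mono_ae hU hV hVU h 1 1)

theorem weakHess_congr {U : Set Plane} {i j : Fin 2} {w w' : Plane → ℝ}
    (h : w =ᵐ[volume.restrict U] w') : weakHess U i j w = weakHess U i j w' := by
  rw [weakHess, weakHess, weakPartial_congr h]

theorem weakLaplacian_congr {U : Set Plane} {w w' : Plane → ℝ}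
    (h : w =ᵐ[volume.restrict U] w') : weakLaplacian U w = weakLaplacian U w' := by
  rw [weakLaplacian_eq_add, weakLaplacian_eq_add, weakHess_congr h, weakHess_congr h]

/-- The row-wise divergence of the Hessian is the gradient of the Laplacian: `∂_j ∂_j ∂_i w = ∂_j
∂_i ∂_j w = ∂_i ∂_j ∂_j w`, by two applications of the symmetry of weak derivatives. -/
theorem sum_weakPartial_weakHess_ae {U : Set Plane} (hU : IsOpen U) {w : Plane → ℝ}
    (h : MemSobolev 3 U w) (i : Fin 2) :
    ∀ᵐ x ∂(volume.restrict U), ∑ j, weakPartial U j (weakHess U i j w) x =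
      weakPartial U i (weakLaplacian U w) x := by
  have key : ∀ j, weakPartial U j (weakHess U i j w) =ᵐ[volume.restrict U]
      weakPartial U i (weakHess U j j w) := by
    intro j
    have h1 : weakHess U i j w =ᵐ[volume.restrict U] weakPartial U i (weakPartial U j w) :=
      weakPartial_comm_ae hU (h.of_le (by norm_num)) i j
    rw [weakPartial_congr h1]
    exact weakPartial_comm_ae hU (h.weakPartial hU j) i j
  have hsum := weakPartial_add_ae hU (h.weakHess hU 0 0) (h.weakHess hU 1 1) i
  rw [← weakLaplacian_eq_add] at hsum
  filter_upwards [key 0, key 1, hsum] with x h0 h1 h2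
  rw [Fin.sum_univ_two, h0, h1, h2]
  rfl

namespace ElemSide

theorem memLp_tr (s : ElemSide) (w : Plane → ℝ) : MemLp (s.tr w) 2 s.len := trace_memLp _ _ _

theorem memLp_tr_of_len_eq {s t : ElemSide} (hst : s.len = t.len) (w : Plane → ℝ) :
    MemLp (t.tr w) 2 s.len := hst ▸ t.memLp_tr w

theorem memLp_trGrad (s : ElemSide) (i : Fin 2) (w : Plane → ℝ) : MemLp (s.trGrad i w) 2 s.len :=
  trace_memLp _ _ _

theorem tr_congr (s : ElemSide) {w w' : Plane → ℝ} (h : w =ᵐ[volume.restrict s.elem] w') :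
    s.tr w = s.tr w' := trace_congr h

theorem trGrad_congr (s : ElemSide) {w w' : Plane → ℝ} (h : w =ᵐ[volume.restrict s.elem] w')
    (i : Fin 2) : s.trGrad i w = s.trGrad i w' := by
  rw [trGrad, trGrad, weakPartial_congr h]

theorem memLp_trHessNormal {s t : ElemSide} (hs : IsElementMap s.1) (hst : s.len = t.len)
    (i : Fin 2) (w : Plane → ℝ) : MemLp (t.trHessNormal s.normal i w) 2 s.len := by
  have h : t.trHessNormal s.normal i w =
      ∑ j, fun x => t.tr (weakHess t.elem i j w) x * s.normal x j := by
    ext x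
    simp [trHessNormal]
  rw [h]
  exact memLp_finsetSum' _ fun j _ => hs.memLp_mul_sideNormal (memLp_tr_of_len_eq hst _) j

theorem memLp_trLapNormal {s t : ElemSide} (hs : IsElementMap s.1) (hst : s.len = t.len)
    (w : Plane → ℝ) : MemLp (t.trLapNormal s.normal w) 2 s.len := by
  have h : t.trLapNormal s.normal w =
      ∑ i, fun x => t.tr (weakPartial t.elem i (weakLaplacian t.elem w)) x * s.normal x i := by
    ext x
    simp [trLapNormal]
  rw [h]
  exact memLp_finsetSum' _ fun j _ => hs.memLp_mul_sideNormal (memLp_tr_of_len_eq hst _) j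

end ElemSide

namespace IsElementMap

variable {p : PolyPair}

/-- For smooth `v` the trace of the weak gradient is the classical gradient, which turns the
boundary term into the shape delivered by `integral_weakPartial_mul`. -/
theorem inner_trHessNormal (hp : IsElementMap p) (a : Fin 3) (i : Fin 2) (u : Plane → ℝ)
    {v : Plane → ℝ} (hv : ContDiff ℝ ((⊤ : ℕ∞) : WithTop ℕ∞) v) :
    ElemSide.inner (p, a) (ElemSide.trHessNormal (p, a) (ElemSide.normal (p, a)) i u)
        (ElemSide.trGrad (p, a) i v) =
      ∑ j, ∫ x, trace (openElement p) (sideMeasure p a) (weakHess (openElement p) i j u) x *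
        (fderiv ℝ v x (basisVec i) * sideNormal p a x j) ∂(sideMeasure p a) := by
  have hU := hp.isOpen_openElement
  have hdv : ContDiff ℝ ((⊤ : ℕ∞) : WithTop ℕ∞) fun x => fderiv ℝ v x (basisVec i) :=
    contDiff_fderiv_apply hv (by simp) _
  have h1 : weakPartial (openElement p) i v =ᵐ[volume.restrict (openElement p)]
      fun x => fderiv ℝ v x (basisVec i) :=
    (IsWeakPartial.of_contDiff (hv.of_le (by simp)) i).weakPartial_ae_eq hU
  have h2 : ElemSide.trGrad (p, a) i v =ᵐ[sideMeasure p a] fun x => fderiv ℝ v x (basisVec i) := by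
    have h3 : ElemSide.trGrad (p, a) i v = trace (openElement p) (sideMeasure p a)
        fun x => fderiv ℝ v x (basisVec i) := trace_congr h1
    rw [h3]
    exact hp.trace_of_contDiff hdv a
  have hL : MemLp (fun x => fderiv ℝ v x (basisVec i)) 2 (sideMeasure p a) :=
    hdv.continuous.continuousOn.memLp_sideMeasure
  rw [← integral_finsetSum _ fun j _ => integrable_mul_of_memLp_two (trace_memLp _ _ _)
    (hp.memLp_mul_sideNormal hL j)]
  refine integral_congr_ae ?_
  filter_upwards [h2] with x hx
  rw [hx]
  simp only [ElemSide.trHessNormal, Finset.sum_mul]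
  refine Finset.sum_congr rfl fun j _ => ?_
  simp only [ElemSide.tr, ElemSide.elem, ElemSide.len, ElemSide.normal]
  ring

theorem inner_trLapNormal (hp : IsElementMap p) (a : Fin 3) (u : Plane → ℝ)
    {v : Plane → ℝ} (hv : ContDiff ℝ ((⊤ : ℕ∞) : WithTop ℕ∞) v) :
    ElemSide.inner (p, a) (ElemSide.trLapNormal (p, a) (ElemSide.normal (p, a)) u)
        (ElemSide.tr (p, a) v) =
      ∑ i, ∫ x, trace (openElement p) (sideMeasure p a)
        (weakPartial (openElement p) i (weakLaplacian (openElement p) u)) x *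
        (v x * sideNormal p a x i) ∂(sideMeasure p a) := by
  have hL : MemLp v 2 (sideMeasure p a) := hv.continuous.continuousOn.memLp_sideMeasure
  rw [← integral_finsetSum _ fun j _ => integrable_mul_of_memLp_two (trace_memLp _ _ _)
    (hp.memLp_mul_sideNormal hL j)]
  refine integral_congr_ae ?_
  have h2 : ElemSide.tr (p, a) v =ᵐ[sideMeasure p a] v := hp.trace_of_contDiff hv a
  filter_upwards [h2] with x hx
  rw [hx]
  simp only [ElemSide.trLapNormal, Finset.sum_mul]
  refine Finset.sum_congr rfl fun j _ => ?_
  simp only [ElemSide.tr, ElemSide.elem, ElemSide.len, ElemSide.normal]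
  ring

/-- Two integrations by parts: the first moves a derivative from `D²v` on to `D²u` and leaves `-∫
∇Δu · ∇v`, because the divergence of the Hessian is `∇Δu`; the second moves the gradient off `v` and
leaves `∫ Δ²u v`. -/
theorem integral_weakHess_mul (hp : IsElementMap p) {u v : Plane → ℝ}
    (hu : MemSobolev 4 (openElement p) u) (hv : ContDiff ℝ ((⊤ : ℕ∞) : WithTop ℕ∞) v) :
    ∫ x in openElement p, ∑ i, ∑ j,
        weakHess (openElement p) i j u x * weakHess (openElement p) i j v x =
      (∑ a : Fin 3, (∑ i, ElemSide.inner (p, a)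
          (ElemSide.trHessNormal (p, a) (ElemSide.normal (p, a)) i u) (ElemSide.trGrad (p, a) i v) -
        ElemSide.inner (p, a) (ElemSide.trLapNormal (p, a) (ElemSide.normal (p, a)) u)
          (ElemSide.tr (p, a) v))) +
      ∫ x in openElement p,
        weakLaplacian (openElement p) (weakLaplacian (openElement p) u) x * v x := by
  have hU := hp.isOpen_openElement
  have hb := isBounded_openElement p
  set U := openElement p with hUdef
  let dv : Fin 2 → Plane → ℝ := fun i x => fderiv ℝ v x (basisVec i)
  have hdv : ∀ i, ContDiff ℝ ((⊤ : ℕ∞) : WithTop ℕ∞) (dv i) := fun i =>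
    contDiff_fderiv_apply hv (by simp) _
  have hddv : ∀ i j, ContDiff ℝ ((⊤ : ℕ∞) : WithTop ℕ∞)
      fun x => fderiv ℝ (dv i) x (basisVec j) := fun i j =>
    contDiff_fderiv_apply (hdv i) (by simp) _
  have hcL : ∀ {f : Plane → ℝ}, ContDiff ℝ ((⊤ : ℕ∞) : WithTop ℕ∞) f →
      MemLp f 2 (volume.restrict U) := fun hf => hf.continuous.memLp_two_restrict_of_isBounded hb
  have hHv : ∀ i j, weakHess U i j v =ᵐ[volume.restrict U]
      fun x => fderiv ℝ (dv i) x (basisVec j) := by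
    intro i j
    have h1 : weakPartial U i v =ᵐ[volume.restrict U] dv i :=
      (IsWeakPartial.of_contDiff (hv.of_le (by simp)) i).weakPartial_ae_eq hU
    rw [weakHess, weakPartial_congr h1]
    exact (IsWeakPartial.of_contDiff ((hdv i).of_le (by simp)) j).weakPartial_ae_eq hU
  have hH : ∀ i j, MemSobolev 2 U (weakHess U i j u) := fun i j => hu.weakHess hU i j
  have hL : ∀ i, MemSobolev 1 U (weakPartial U i (weakLaplacian U u)) := fun i =>
    (hu.weakLaplacian (m := 2) hU).weakPartial hU i
  have e1 : ∫ x in U, ∑ i, ∑ j, weakHess U i j u x * weakHess U i j v x =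
      ∑ i, ∑ j, ∫ x in U, weakHess U i j u x * fderiv ℝ (dv i) x (basisVec j) := by
    have hint : ∀ i j, Integrable (fun x => weakHess U i j u x * fderiv ℝ (dv i) x (basisVec j))
        (volume.restrict U) := fun i j =>
      integrable_mul_of_memLp_two (hH i j).memLp (hcL (hddv i j))
    simp only [← integral_finsetSum Finset.univ fun j _ => hint _ j]
    rw [← integral_finsetSum _ fun i _ => integrable_finsetSum _ fun j _ => hint i j]
    refine integral_congr_ae ?_
    filter_upwards [hHv 0 0, hHv 0 1, hHv 1 0, hHv 1 1] with x h00 h01 h10 h11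
    simp only [Fin.sum_univ_two, h00, h01, h10, h11]
  have e2 : ∀ i j, ∫ x in U, weakHess U i j u x * fderiv ℝ (dv i) x (basisVec j) =
      ∑ a, ∫ x, trace U (sideMeasure p a) (weakHess U i j u) x * (dv i x * sideNormal p a x j)
        ∂(sideMeasure p a) - ∫ x in U, weakPartial U j (weakHess U i j u) x * dv i x := by
    intro i j
    have := hp.integral_weakPartial_mul ((hH i j).of_le (by norm_num))
      ((hdv i).of_le (by simp)) j
    linarith
  have e3 : ∀ i, ∑ j, ∫ x in U, weakPartial U j (weakHess U i j u) x * dv i x =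
      ∫ x in U, weakPartial U i (weakLaplacian U u) x * dv i x := by
    intro i
    rw [← integral_finsetSum _ fun j _ => integrable_mul_of_memLp_two
      ((hH i j).weakPartial (m := 1) hU j).memLp (hcL (hdv i))]
    refine integral_congr_ae ?_
    filter_upwards [sum_weakPartial_weakHess_ae hU (hu.of_le (by norm_num)) i] with x hx
    rw [← Finset.sum_mul, hx]
  have e4 : ∀ i, ∫ x in U, weakPartial U i (weakLaplacian U u) x * dv i x =
      ∑ a, ∫ x, trace U (sideMeasure p a) (weakPartial U i (weakLaplacian U u)) x *
        (v x * sideNormal p a x i) ∂(sideMeasure p a) -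
      ∫ x in U, weakPartial U i (weakPartial U i (weakLaplacian U u)) x * v x := by
    intro i
    have := hp.integral_weakPartial_mul (hL i) (hv.of_le (by simp)) i
    linarith
  have e5 : ∑ i, ∫ x in U, weakPartial U i (weakPartial U i (weakLaplacian U u)) x * v x =
      ∫ x in U, weakLaplacian U (weakLaplacian U u) x * v x := by
    rw [← integral_finsetSum _ fun i _ => integrable_mul_of_memLp_two
      ((hL i).weakPartial (m := 0) hU i).memLp (hcL hv)]
    simp only [weakLaplacian, Finset.sum_mul, weakHess]
  rw [e1]
  simp only [e2, hp.inner_trHessNormal _ _ u hv, hp.inner_trLapNormal _ u hv, ← hUdef,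
    Finset.sum_sub_distrib, e3, e4, e5]
  have c1 : ∀ F : Fin 2 → Fin 2 → Fin 3 → ℝ,
      ∑ i, ∑ j, ∑ a, F i j a = ∑ a, ∑ i, ∑ j, F i j a := fun F => by
    simp only [Fin.sum_univ_two, Fin.sum_univ_three]; ring
  have c2 : ∀ F : Fin 2 → Fin 3 → ℝ, ∑ i, ∑ a, F i a = ∑ a, ∑ i, F i a := fun F =>
    Finset.sum_comm
  rw [c1 fun i j a => ∫ x, trace U (sideMeasure p a) (weakHess U i j u) x *
    (dv i x * sideNormal p a x j) ∂(sideMeasure p a), c2]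
  ring

end IsElementMap

/-! ### Consistency -/

/-- Here `a` and `a'` are the fluxes of `u` from the two elements for one and the same normal, and
`b`, `b'` are the traces of `v`. The minus sign of the second integral is that of the opposite
outward normal. -/
theorem flux_add_average_mul_jump {α : Type*} [MeasurableSpace α] {μ : Measure α}
    {a a' b b' : α → ℝ} (ha : MemLp a 2 μ) (hb : MemLp b 2 μ) (hb' : MemLp b' 2 μ)
    (h : ∀ᵐ x ∂μ, a' x = a x) :
    ∫ x, a x * b x ∂μ - ∫ x, a x * b' x ∂μ + ∫ x, (a x + a' x) / 2 * (b' x - b x) ∂μ = 0 := by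
  have e : ∫ x, (a x + a' x) / 2 * (b' x - b x) ∂μ = ∫ x, a x * b' x - a x * b x ∂μ := by
    refine integral_congr_ae ?_
    filter_upwards [h] with x hx
    rw [hx]
    ring
  rw [e, integral_sub (integrable_mul_of_memLp_two ha hb') (integrable_mul_of_memLp_two ha hb)]
  ring

namespace ElemSide

/-- The boundary term with the gradient of `v` in Green's identity. -/
def gradFlux (s : ElemSide) (u v : Plane → ℝ) : ℝ :=
  ∑ i, s.inner (s.trHessNormal s.normal i u) (s.trGrad i v)

/-- The boundary term with the values of `v` in Green's identity. -/
def valueFlux (s : ElemSide) (u v : Plane → ℝ) : ℝ :=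
  s.inner (s.trLapNormal s.normal u) (s.tr v)

theorem inner_eq_zero_of_left {s : ElemSide} {a b : Plane → ℝ} (h : ∀ᵐ x ∂s.len, a x = 0) :
    s.inner a b = 0 :=
  integral_eq_zero_of_ae (by filter_upwards [h] with x hx; simp [hx])

theorem inner_eq_zero_of_right {s : ElemSide} {a b : Plane → ℝ} (h : ∀ᵐ x ∂s.len, b x = 0) :
    s.inner a b = 0 :=
  integral_eq_zero_of_ae (by filter_upwards [h] with x hx; simp [hx])

theorem gradFlux_eq_zero {s : ElemSide} {u : Plane → ℝ}
    (h : ∀ i, ∀ᵐ x ∂s.len, s.trHessNormal s.normal i u x = 0) (v : Plane → ℝ) :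
    s.gradFlux u v = 0 :=
  Finset.sum_eq_zero fun i _ => inner_eq_zero_of_left (h i)

theorem valueFlux_eq_zero {s : ElemSide} {u : Plane → ℝ}
    (h : ∀ᵐ x ∂s.len, s.trLapNormal s.normal u x = 0) (v : Plane → ℝ) :
    s.valueFlux u v = 0 :=
  inner_eq_zero_of_left h

theorem inner_trHessNormal_neg {s t : ElemSide} (hlen : s.len = t.len)
    (hn : ∀ᵐ x ∂s.len, t.normal x = -s.normal x) {i : Fin 2} {u : Plane → ℝ}
    (hA : ∀ᵐ x ∂s.len, t.trHessNormal s.normal i u x = s.trHessNormal s.normal i u x)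
    (b : Plane → ℝ) :
    t.inner (t.trHessNormal t.normal i u) b =
      -∫ x, s.trHessNormal s.normal i u x * b x ∂s.len := by
  rw [inner, ← hlen, ← integral_neg]
  refine integral_congr_ae ?_
  filter_upwards [hn, hA] with x h1 h2
  rw [← h2]
  simp only [trHessNormal, h1, PiLp.neg_apply, mul_neg, Finset.sum_neg_distrib, neg_mul]

theorem inner_trLapNormal_neg {s t : ElemSide} (hlen : s.len = t.len)
    (hn : ∀ᵐ x ∂s.len, t.normal x = -s.normal x) {u : Plane → ℝ}
    (hA : ∀ᵐ x ∂s.len, t.trLapNormal s.normal u x = s.trLapNormal s.normal u x)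
    (b : Plane → ℝ) :
    t.inner (t.trLapNormal t.normal u) b =
      -∫ x, s.trLapNormal s.normal u x * b x ∂s.len := by
  rw [inner, ← hlen, ← integral_neg]
  refine integral_congr_ae ?_
  filter_upwards [hn, hA] with x h1 h2
  rw [← h2]
  simp only [trLapNormal, h1, PiLp.neg_apply, mul_neg, Finset.sum_neg_distrib, neg_mul]

/-- Since `∇u` does not jump, the symmetry and penalty terms vanish for every weight `h`. The
remaining average term cancels the two fluxes. -/
theorem gradFlux_add_innerGradTerm {s t : ElemSide} (hs : IsElementMap s.1)
    (hlen : s.len = t.len) (hn : ∀ᵐ x ∂s.len, t.normal x = -s.normal x) {u : Plane → ℝ}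
    (hA : ∀ i, ∀ᵐ x ∂s.len, t.trHessNormal s.normal i u x = s.trHessNormal s.normal i u x)
    (hJ : ∀ i, ∀ᵐ x ∂s.len, s.trGrad i u x = t.trGrad i u x) (γ₁ : ℝ) (h v : Plane → ℝ) :
    s.gradFlux u v + t.gradFlux u v + innerGradTerm γ₁ h u v s t = 0 := by
  rw [gradFlux, gradFlux, innerGradTerm, ← Finset.sum_add_distrib, ← Finset.sum_add_distrib]
  refine Finset.sum_eq_zero fun i _ => ?_
  have hj : ∀ᵐ x ∂s.len, sideJump (·.trGrad i u) s t x = 0 := by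
    filter_upwards [hJ i] with x hx
    simp [sideJump, hx]
  rw [inner_trHessNormal_neg hlen hn (hA i), inner_eq_zero_of_right (b := sideJump _ s t) hj,
    inner_eq_zero_of_left (a := fun x => (h x)⁻¹ * sideJump (·.trGrad i u) s t x) (by
      filter_upwards [hj] with x hx
      rw [hx, mul_zero])]
  have := flux_add_average_mul_jump (memLp_trHessNormal hs rfl i u) (s.memLp_trGrad i v)
    (hlen ▸ t.memLp_trGrad i v) (hA i)
  simp only [inner, sideAverage, sideJump]
  linarith

theorem valueFlux_add_innerValueTerm {s t : ElemSide} (hs : IsElementMap s.1)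
    (hlen : s.len = t.len) (hn : ∀ᵐ x ∂s.len, t.normal x = -s.normal x) {u : Plane → ℝ}
    (hA : ∀ᵐ x ∂s.len, t.trLapNormal s.normal u x = s.trLapNormal s.normal u x)
    (hJ : ∀ᵐ x ∂s.len, s.tr u x = t.tr u x) (γ₀ : ℝ) (h v : Plane → ℝ) :
    -(s.valueFlux u v + t.valueFlux u v) + innerValueTerm γ₀ h u v s t = 0 := by
  rw [valueFlux, valueFlux, innerValueTerm]
  have hj : ∀ᵐ x ∂s.len, sideJump (·.tr u) s t x = 0 := by
    filter_upwards [hJ] with x hx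
    simp [sideJump, hx]
  rw [inner_trLapNormal_neg hlen hn hA, inner_eq_zero_of_right (b := sideJump (·.tr u) s t) hj,
    inner_eq_zero_of_left (a := fun x => (h x ^ 3)⁻¹ * sideJump (·.tr u) s t x) (by
      filter_upwards [hj] with x hx
      rw [hx, mul_zero])]
  have := flux_add_average_mul_jump (memLp_trLapNormal hs rfl u) (s.memLp_tr v)
    (hlen ▸ t.memLp_tr v) hA
  simp only [inner, sideAverage, sideJump]
  linarith

theorem tr_zero_ae {s : ElemSide} (hs : IsElementMap s.1) : ∀ᵐ x ∂s.len, s.tr 0 x = 0 :=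
  hs.trace_of_contDiff contDiff_const s.2

/-- `s.tr 0` is a chosen function and vanishes only almost everywhere, hence the passage through the
integral. -/
theorem inner_bdJump_zero {s : ElemSide} (hs : IsElementMap s.1) (a : Plane → ℝ)
    (q : ElemSide → Plane → ℝ) : s.inner a (bdJump (·.tr 0) q s) = -s.inner a (q s) := by
  rw [inner, inner, ← integral_neg]
  refine integral_congr_ae ?_
  filter_upwards [tr_zero_ae hs] with x hx
  simp [bdJump, hx]

theorem gradFlux_add_bdGradTerm {s : ElemSide} (hs : IsElementMap s.1) {u g : Plane → ℝ}
    {Φ : Fin 2 → Plane → ℝ} (hu : ∀ i, ∀ᵐ x ∂s.len, s.trGrad i u x = s.tr (Φ i) x) (γ₁ : ℝ)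
    (h v : Plane → ℝ) : s.gradFlux u v + bdGradTerm γ₁ h (g, Φ) u 0 v s = 0 := by
  rw [gradFlux, bdGradTerm, ← Finset.sum_add_distrib]
  refine Finset.sum_eq_zero fun i _ => ?_
  have hj : ∀ᵐ x ∂s.len, bdJump (·.tr (Φ i)) (·.trGrad i u) s x = 0 := by
    filter_upwards [hu i] with x hx
    simp [bdJump, hx]
  have h0 := inner_bdJump_zero hs (s.trHessNormal s.normal i u) (·.trGrad i v)
  rw [inner_eq_zero_of_right (b := bdJump (·.tr (Φ i)) _ s) hj,
    inner_eq_zero_of_left (a := fun x => (h x)⁻¹ * bdJump (·.tr (Φ i)) (·.trGrad i u) s x) (by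
      filter_upwards [hj] with x hx
      rw [hx, mul_zero])]
  have e : ((0 : BdData).2 i) = 0 := rfl
  rw [e, h0]
  ring

theorem valueFlux_add_bdValueTerm {s : ElemSide} (hs : IsElementMap s.1) {u g : Plane → ℝ}
    {Φ : Fin 2 → Plane → ℝ} (hu : ∀ᵐ x ∂s.len, s.tr u x = s.tr g x) (γ₀ : ℝ)
    (h v : Plane → ℝ) : -s.valueFlux u v + bdValueTerm γ₀ h (g, Φ) u 0 v s = 0 := by
  rw [valueFlux, bdValueTerm]
  have hj : ∀ᵐ x ∂s.len, bdJump (·.tr g) (·.tr u) s x = 0 := by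
    filter_upwards [hu] with x hx
    simp [bdJump, hx]
  have h0 := inner_bdJump_zero hs (s.trLapNormal s.normal u) (·.tr v)
  rw [inner_eq_zero_of_right (b := bdJump (·.tr g) _ s) hj,
    inner_eq_zero_of_left (a := fun x => (h x ^ 3)⁻¹ * bdJump (·.tr g) (·.tr u) s x) (by
      filter_upwards [hj] with x hx
      rw [hx, mul_zero])]
  have e : (0 : BdData).1 = 0 := rfl
  rw [e, h0]
  ring

end ElemSide

/-! ### Consistency of the form on the mesh. -/

namespace IsoMesh

variable {k : ℕ} {P : FoldedPlate} (M : IsoMesh k P)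

theorem weakHess_ae_eq {u : Plane → ℝ} (hu : MemSobolev 2 (P.Ω₁ ∪ P.Ω₂) u) (s : M.Side)
    (i j : Fin 2) : weakHess (M.el s).elem i j u =ᵐ[volume.restrict (M.el s).elem]
      weakHess (P.Ω₁ ∪ P.Ω₂) i j u :=
  weakHess_mono_ae P.isOpen_union (M.isElementMap s.1).isOpen_openElement
    (M.openElement_subset_union s.1) hu i j

theorem weakLaplacian_ae_eq {u : Plane → ℝ} (hu : MemSobolev 2 (P.Ω₁ ∪ P.Ω₂) u) (s : M.Side) :
    weakLaplacian (M.el s).elem u =ᵐ[volume.restrict (M.el s).elem]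
      weakLaplacian (P.Ω₁ ∪ P.Ω₂) u :=
  weakLaplacian_mono_ae P.isOpen_union (M.isElementMap s.1).isOpen_openElement
    (M.openElement_subset_union s.1) hu

theorem weakPartial_ae_eq {u : Plane → ℝ} (hu : MemSobolev 1 (P.Ω₁ ∪ P.Ω₂) u) (s : M.Side)
    (i : Fin 2) : weakPartial (M.el s).elem i u =ᵐ[volume.restrict (M.el s).elem]
      weakPartial (P.Ω₁ ∪ P.Ω₂) i u :=
  weakPartial_mono_ae (M.isElementMap s.1).isOpen_openElement (M.openElement_subset_union s.1) hu i

theorem trGrad_eq {u : Plane → ℝ} (hu : MemSobolev 1 (P.Ω₁ ∪ P.Ω₂) u) (s : M.Side) (i : Fin 2) :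
    (M.el s).trGrad i u = (M.el s).tr (weakPartial (P.Ω₁ ∪ P.Ω₂) i u) :=
  (M.el s).tr_congr (M.weakPartial_ae_eq hu s i)

theorem trHessNormal_eq {u : Plane → ℝ} (hu : MemSobolev 2 (P.Ω₁ ∪ P.Ω₂) u) (s : M.Side)
    (η : Plane → Plane) (i : Fin 2) : (M.el s).trHessNormal η i u =
      fun x => ∑ j, (M.el s).tr (weakHess (P.Ω₁ ∪ P.Ω₂) i j u) x * η x j := by
  ext x
  simp only [ElemSide.trHessNormal, (M.el s).tr_congr (M.weakHess_ae_eq hu s i _)]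

theorem trLapNormal_eq {u : Plane → ℝ} (hu : MemSobolev 3 (P.Ω₁ ∪ P.Ω₂) u) (s : M.Side)
    (η : Plane → Plane) : (M.el s).trLapNormal η u = fun x => ∑ i, (M.el s).tr
      (weakPartial (P.Ω₁ ∪ P.Ω₂) i (weakLaplacian (P.Ω₁ ∪ P.Ω₂) u)) x * η x i := by
  have h : ∀ i, weakPartial (M.el s).elem i (weakLaplacian (M.el s).elem u)
      =ᵐ[volume.restrict (M.el s).elem]
        weakPartial (P.Ω₁ ∪ P.Ω₂) i (weakLaplacian (P.Ω₁ ∪ P.Ω₂) u) := by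
    intro i
    rw [weakPartial_congr (M.weakLaplacian_ae_eq (hu.of_le (by norm_num)) s)]
    exact M.weakPartial_ae_eq (hu.weakLaplacian P.isOpen_union) s i
  ext x
  simp only [ElemSide.trLapNormal, (M.el s).tr_congr (h _)]

/-- On the element `v` is replaced by a smooth representative; weak derivatives and traces do not
notice. The equation for `u` is posed on `Ω₁ ∪ Ω₂` and is transferred to derivatives taken on the
element. -/
theorem green {f g : Plane → ℝ} {Φ : Fin 2 → Plane → ℝ} {u : Plane → ℝ}
    (hu : P.IsStrongSolution f g Φ u) (hu4 : MemSobolev 4 (P.Ω₁ ∪ P.Ω₂) u)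
    {v : Plane → ℝ} (hv : v ∈ M.discreteSpace) (T : Fin M.n) :
    ∫ x in openElement (M.ψ T), ∑ i, ∑ j,
        weakHess (openElement (M.ψ T)) i j u x * weakHess (openElement (M.ψ T)) i j v x =
      ∑ a : Fin 3, ((M.el (T, a)).gradFlux u v - (M.el (T, a)).valueFlux u v) +
        ∫ x in openElement (M.ψ T), f x * v x := by
  obtain ⟨v', hv', hvv'⟩ := M.exists_contDiff_ae_eq hv T
  have hT := M.isElementMap T
  have hU := hT.isOpen_openElement
  have hsub := M.openElement_subset_union T
  have key := hT.integral_weakHess_mul (hu4.mono hsub) hv'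
  simp only [← weakHess_congr hvv'] at key
  rw [key]
  congr 1
  · refine Finset.sum_congr rfl fun a _ => ?_
    simp only [ElemSide.gradFlux, ElemSide.valueFlux, (M.el (T, a)).trGrad_congr hvv',
      (M.el (T, a)).tr_congr hvv']
    rfl
  · refine integral_congr_ae ?_
    have h1 := M.weakLaplacian_ae_eq (hu4.of_le (by norm_num)) (T, 0)
    have h2 := M.weakLaplacian_ae_eq (hu4.weakLaplacian (m := 2) P.isOpen_union) (T, 0)
    have h3 : ∀ᵐ x ∂(volume.restrict (openElement (M.ψ T))),
        weakLaplacian (P.Ω₁ ∪ P.Ω₂) (weakLaplacian (P.Ω₁ ∪ P.Ω₂) u) x = f x :=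
      ae_restrict_of_ae_restrict_of_subset hsub hu.equation
    rw [← weakLaplacian_congr h1] at h2
    filter_upwards [h2, h3, hvv'] with x e2 e3 e4
    rw [← e3, ← e2, e4]
    rfl

/-- On the interface the gradient fluxes vanish separately, which is why the form has no gradient
terms there, and the value terms cancel by the jump conditions. Off the interface the open side lies
in `Ω₁ ∪ Ω₂`, so the traces from the two elements agree for every `H¹` function on that set, in
particular for the derivatives of `u` up to order three. -/
theorem inner_consistency {f g : Plane → ℝ} {Φ : Fin 2 → Plane → ℝ} {u : Plane → ℝ}
    (hu : P.IsStrongSolution f g Φ u) (hu4 : MemSobolev 4 (P.Ω₁ ∪ P.Ω₂) u) {e : M.SidePair}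
    (he : e ∈ M.innerSides) (γ₀ γ₁ : ℝ) (h v : Plane → ℝ) :
    (e ∉ M.interfaceSides → (M.el e.1).gradFlux u v + (M.el e.2).gradFlux u v +
        innerGradTerm γ₁ h u v (M.el e.1) (M.el e.2) = 0) ∧
      (e ∈ M.interfaceSides → (M.el e.1).gradFlux u v + (M.el e.2).gradFlux u v = 0) ∧
      -((M.el e.1).valueFlux u v + (M.el e.2).valueFlux u v) +
        innerValueTerm γ₀ h u v (M.el e.1) (M.el e.2) = 0 := by
  obtain ⟨hlt, hcl⟩ := M.mem_innerSides.1 he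
  have hV := P.isOpen_union
  have hs := M.isElementMap e.1.1
  have hlen := M.len_eq hcl
  have hn := M.normal_eq_neg hlt.ne hcl
  by_cases hif : (M.el e.1).openSet ⊆ P.Γ
  · refine ⟨fun h => (h (M.mem_interfaceSides.2 ⟨he, hif⟩)).elim, fun _ => ?_, ?_⟩
    · rw [ElemSide.gradFlux_eq_zero (hu.interface_hess _ (M.isSideIn _) hif),
        ElemSide.gradFlux_eq_zero (hu.interface_hess _ (M.isSideIn _)
          (by rw [← M.openSet_eq hcl]; exact hif)), add_zero]
    · refine ElemSide.valueFlux_add_innerValueTerm hs hlen hn ?_ ?_ γ₀ h v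
      · filter_upwards [hu.interface_lap _ _ (M.isSideIn e.1) (M.isSideIn e.2)
          (M.disjoint_openElement hlt.ne) hcl hif] with x hx using sub_eq_zero.1 hx
      · filter_upwards [hu.interface_value _ _ (M.isSideIn e.1) (M.isSideIn e.2)
          (M.disjoint_openElement hlt.ne) hcl hif] with x hx using (sub_eq_zero.1 hx).symm
  · have hsub : (M.el e.1).openSet ⊆ P.Ω₁ ∪ P.Ω₂ := by
      intro x hx
      have h1 := M.openSet_subset_of_mem_innerSides he hx
      rw [P.partition] at h1
      exact h1.resolve_right
        (Set.disjoint_left.1 ((M.side_Γ e.1.1 e.1.2).resolve_left hif) hx)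
    have htr : ∀ {w : Plane → ℝ}, MemSobolev 1 (P.Ω₁ ∪ P.Ω₂) w →
        ∀ᵐ x ∂(M.el e.1).len, (M.el e.1).tr w x = (M.el e.2).tr w x := fun hw =>
      M.tr_eq_of_closedSet_eq hlt.ne hcl hsub hw
    refine ⟨fun _ => ?_, fun h => (hif (M.mem_interfaceSides.1 h).2).elim, ?_⟩
    · refine ElemSide.gradFlux_add_innerGradTerm hs hlen hn (fun i => ?_) (fun i => ?_) γ₁ h v
      · have h2 : MemSobolev 2 (P.Ω₁ ∪ P.Ω₂) u := hu4.of_le (by norm_num)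
        rw [M.trHessNormal_eq h2, M.trHessNormal_eq h2]
        have h3 : MemSobolev 3 (P.Ω₁ ∪ P.Ω₂) u := hu4.of_le (by norm_num)
        filter_upwards [htr (h3.weakHess (m := 1) hV i 0), htr (h3.weakHess (m := 1) hV i 1)]
          with x h0 h1
        simp only [Fin.sum_univ_two, h0, h1]
      · have h1 : MemSobolev 1 (P.Ω₁ ∪ P.Ω₂) u := hu4.of_le (by norm_num)
        have h2 : MemSobolev 2 (P.Ω₁ ∪ P.Ω₂) u := hu4.of_le (by norm_num)
        rw [M.trGrad_eq h1, M.trGrad_eq h1]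
        exact htr (h2.weakPartial hV i)
    · refine ElemSide.valueFlux_add_innerValueTerm hs hlen hn ?_
        (htr (hu4.of_le (by norm_num))) γ₀ h v
      have h3 : MemSobolev 3 (P.Ω₁ ∪ P.Ω₂) u := hu4.of_le (by norm_num)
      rw [M.trLapNormal_eq h3, M.trLapNormal_eq h3]
      have hL := fun i => htr ((hu4.weakLaplacian (m := 2) hV).weakPartial hV i)
      filter_upwards [hL 0, hL 1] with x h0 h1
      simp only [Fin.sum_univ_two, h0, h1]

open Classical in
/-- The solution of the strong form satisfies the discrete problem. -/
theorem consistency {f g : Plane → ℝ} {Φ : Fin 2 → Plane → ℝ} {u : Plane → ℝ}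
    (hf : MemLp f 2 (volume.restrict P.Ω)) (hu : P.IsStrongSolution f g Φ u)
    (hu4 : MemSobolev 4 (P.Ω₁ ∪ P.Ω₂) u) (γ₀ γ₁ : ℝ) (h : Plane → ℝ)
    {v : Plane → ℝ} (hv : v ∈ M.discreteSpace) :
    M.dgForm γ₀ γ₁ h (g, Φ) u 0 v = ∫ x in P.Ω, f x * v x := by
  have hfv : ∀ T, IntegrableOn (fun x => f x * v x) (openElement (M.ψ T)) := fun T =>
    integrable_mul_of_memLp_two
      (hf.mono_measure (Measure.restrict_mono (M.openElement_subset T) le_rfl))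
      (M.memSobolev_of_mem_discreteSpace hv 0 T).memLp
  have hsides := M.sum_sides fun s => (M.el s).gradFlux u v - (M.el s).valueFlux u v
  rw [Fintype.sum_prod_type] at hsides
  have hinner := fun {e : M.SidePair} (he : e ∈ M.innerSides) =>
    M.inner_consistency hu hu4 he γ₀ γ₁ h v
  have hif : M.interfaceSides ⊆ M.innerSides := fun e he => (M.mem_interfaceSides.1 he).1
  -- A boundary side that is not clamped is disjoint from `D`, and the natural boundary conditions
  -- make its fluxes vanish.
  have hbd : ∑ s ∈ M.boundarySides, ((M.el s).gradFlux u v - (M.el s).valueFlux u v) =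
      ∑ s ∈ M.clampedSides, ((M.el s).gradFlux u v - (M.el s).valueFlux u v) := by
    refine (Finset.sum_subset M.clampedSides_subset fun s hs hs' => ?_).symm
    have hsub : (M.el s).openSet ⊆ frontier P.Ω \ P.D := fun x hx =>
      ⟨M.openSet_subset_frontier hs hx, Set.disjoint_left.1
        ((M.side_D s.1 s.2).resolve_left fun h => hs' (M.mem_clampedSides.2 h)) hx⟩
    rw [ElemSide.gradFlux_eq_zero (hu.natural_hess _ (M.isSideIn s) hsub),
      ElemSide.valueFlux_eq_zero (hu.natural_lap _ (M.isSideIn s) hsub), sub_zero]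
  have hcl : ∑ s ∈ M.clampedSides, ((M.el s).gradFlux u v - (M.el s).valueFlux u v) +
      ∑ s ∈ M.clampedSides, (bdGradTerm γ₁ h (g, Φ) u 0 v (M.el s) +
        bdValueTerm γ₀ h (g, Φ) u 0 v (M.el s)) = 0 := by
    rw [← Finset.sum_add_distrib]
    refine Finset.sum_eq_zero fun s hs => ?_
    have hD := M.mem_clampedSides.1 hs
    have h1 := ElemSide.gradFlux_add_bdGradTerm (g := g) (M.isElementMap s.1)
      (hu.clamped_grad _ (M.isSideIn s) hD) γ₁ h v
    have h2 := ElemSide.valueFlux_add_bdValueTerm (Φ := Φ) (M.isElementMap s.1)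
      (hu.clamped_value _ (M.isSideIn s) hD) γ₀ h v
    linarith
  have hgrad : ∑ e ∈ M.innerSides, ((M.el e.1).gradFlux u v + (M.el e.2).gradFlux u v) +
      ∑ e ∈ M.innerSides \ M.interfaceSides, innerGradTerm γ₁ h u v (M.el e.1) (M.el e.2) = 0 := by
    rw [← Finset.sum_sdiff hif, Finset.sum_eq_zero fun e he => (hinner (hif he)).2.1 he, add_zero,
      ← Finset.sum_add_distrib]
    exact Finset.sum_eq_zero fun e he =>
      (hinner (Finset.mem_sdiff.1 he).1).1 (Finset.mem_sdiff.1 he).2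
  have hvalue : -∑ e ∈ M.innerSides, ((M.el e.1).valueFlux u v + (M.el e.2).valueFlux u v) +
      ∑ e ∈ M.innerSides, innerValueTerm γ₀ h u v (M.el e.1) (M.el e.2) = 0 := by
    rw [← Finset.sum_neg_distrib, ← Finset.sum_add_distrib]
    exact Finset.sum_eq_zero fun e he => (hinner he).2.2
  have hsplit : ∑ e ∈ M.innerSides, (((M.el e.1).gradFlux u v - (M.el e.1).valueFlux u v) +
      ((M.el e.2).gradFlux u v - (M.el e.2).valueFlux u v)) =
      ∑ e ∈ M.innerSides, ((M.el e.1).gradFlux u v + (M.el e.2).gradFlux u v) -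
      ∑ e ∈ M.innerSides, ((M.el e.1).valueFlux u v + (M.el e.2).valueFlux u v) := by
    rw [← Finset.sum_sub_distrib]
    exact Finset.sum_congr rfl fun e _ => by ring
  rw [hsplit, hbd] at hsides
  rw [dgForm, M.setIntegral_eq_sum hfv]
  simp only [M.green hu hu4 hv, Finset.sum_add_distrib (s := (Finset.univ : Finset (Fin M.n))),
    hsides]
  linarith

end IsoMesh

/-! ### Linearity of the interior penalty form -/

theorem weakHess_sub_ae {U : Set Plane} (hU : IsOpen U) {w w' : Plane → ℝ}
    (h : MemSobolev 2 U w) (h' : MemSobolev 2 U w') (i j : Fin 2) :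
    weakHess U i j (w - w') =ᵐ[volume.restrict U] weakHess U i j w - weakHess U i j w' := by
  have h1 := weakPartial_sub_ae hU (h.of_le (by norm_num)) (h'.of_le (by norm_num)) i
  rw [weakHess, weakPartial_congr h1]
  exact weakPartial_sub_ae hU (h.weakPartial hU i) (h'.weakPartial hU i) j

theorem weakLaplacian_sub_ae {U : Set Plane} (hU : IsOpen U) {w w' : Plane → ℝ}
    (h : MemSobolev 2 U w) (h' : MemSobolev 2 U w') :
    weakLaplacian U (w - w') =ᵐ[volume.restrict U] weakLaplacian U w - weakLaplacian U w' := by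
  simp only [weakLaplacian_eq_add]
  filter_upwards [weakHess_sub_ae hU h h' 0 0, weakHess_sub_ae hU h h' 1 1] with x h0 h1
  simp only [Pi.add_apply, Pi.sub_apply, h0, h1]
  ring

theorem MeasureTheory.MemLp.mul_of_ae_bound {α : Type*} [MeasurableSpace α] {μ : Measure α}
    {a b : α → ℝ} (hb : MemLp b 2 μ) (ha : AEStronglyMeasurable a μ) {C : ℝ}
    (hC : ∀ᵐ x ∂μ, |a x| ≤ C) : MemLp (fun x => a x * b x) 2 μ := by
  refine hb.of_le_mul (c := C) (ha.mul hb.1) ?_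
  filter_upwards [hC] with x hx
  rw [norm_mul]
  exact mul_le_mul_of_nonneg_right hx (norm_nonneg _)

namespace ElemSide

variable {s t : ElemSide}

theorem inner_sub_left {a a₁ a₂ b : Plane → ℝ} (h : ∀ᵐ x ∂s.len, a x = a₁ x - a₂ x)
    (h₁ : MemLp a₁ 2 s.len) (h₂ : MemLp a₂ 2 s.len) (hb : MemLp b 2 s.len) :
    s.inner a b = s.inner a₁ b - s.inner a₂ b := by
  rw [inner, inner, inner, ← integral_sub (integrable_mul_of_memLp_two h₁ hb)
    (integrable_mul_of_memLp_two h₂ hb)]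
  refine integral_congr_ae ?_
  filter_upwards [h] with x hx
  rw [hx, sub_mul]

theorem inner_comm (s : ElemSide) (a b : Plane → ℝ) : s.inner a b = s.inner b a := by
  simp only [inner, mul_comm]

theorem inner_sub_right {a b b₁ b₂ : Plane → ℝ} (h : ∀ᵐ x ∂s.len, b x = b₁ x - b₂ x)
    (h₁ : MemLp b₁ 2 s.len) (h₂ : MemLp b₂ 2 s.len) (ha : MemLp a 2 s.len) :
    s.inner a b = s.inner a b₁ - s.inner a b₂ := by
  rw [inner_comm s a b, inner_comm s a b₁, inner_comm s a b₂, inner_sub_left h h₁ h₂ ha]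

theorem tr_sub (hs : IsElementMap s.1) {w w' : Plane → ℝ} (hw : MemSobolev 1 s.elem w)
    (hw' : MemSobolev 1 s.elem w') : ∀ᵐ x ∂s.len, s.tr (w - w') x = s.tr w x - s.tr w' x :=
  hs.trace_sub hw hw' s.2

theorem trGrad_sub (hs : IsElementMap s.1) {w w' : Plane → ℝ} (hw : MemSobolev 2 s.elem w)
    (hw' : MemSobolev 2 s.elem w') (i : Fin 2) :
    ∀ᵐ x ∂s.len, s.trGrad i (w - w') x = s.trGrad i w x - s.trGrad i w' x := by
  have hU : IsOpen s.elem := hs.isOpen_openElement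
  rw [trGrad, s.tr_congr (weakPartial_sub_ae hU (hw.of_le (by norm_num))
    (hw'.of_le (by norm_num)) i)]
  exact tr_sub hs (hw.weakPartial hU i) (hw'.weakPartial hU i)

theorem trHessNormal_sub (hs : IsElementMap s.1) {w w' : Plane → ℝ} (hw : MemSobolev 3 s.elem w)
    (hw' : MemSobolev 3 s.elem w') (η : Plane → Plane) (i : Fin 2) :
    ∀ᵐ x ∂s.len, s.trHessNormal η i (w - w') x =
      s.trHessNormal η i w x - s.trHessNormal η i w' x := by
  have hU : IsOpen s.elem := hs.isOpen_openElement
  have h : ∀ j, ∀ᵐ x ∂s.len, s.tr (weakHess s.elem i j (w - w')) x =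
      s.tr (weakHess s.elem i j w) x - s.tr (weakHess s.elem i j w') x := by
    intro j
    rw [s.tr_congr (weakHess_sub_ae hU (hw.of_le (by norm_num)) (hw'.of_le (by norm_num)) i j)]
    exact tr_sub hs (hw.weakHess (m := 1) hU i j) (hw'.weakHess (m := 1) hU i j)
  filter_upwards [h 0, h 1] with x h0 h1
  simp only [trHessNormal, Fin.sum_univ_two, h0, h1]
  ring

theorem trLapNormal_sub (hs : IsElementMap s.1) {w w' : Plane → ℝ} (hw : MemSobolev 4 s.elem w)
    (hw' : MemSobolev 4 s.elem w') (η : Plane → Plane) :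
    ∀ᵐ x ∂s.len, s.trLapNormal η (w - w') x = s.trLapNormal η w x - s.trLapNormal η w' x := by
  have hU : IsOpen s.elem := hs.isOpen_openElement
  have hL := hw.weakLaplacian (m := 2) hU
  have hL' := hw'.weakLaplacian (m := 2) hU
  have h : ∀ j, ∀ᵐ x ∂s.len, s.tr (weakPartial s.elem j (weakLaplacian s.elem (w - w'))) x =
      s.tr (weakPartial s.elem j (weakLaplacian s.elem w)) x -
        s.tr (weakPartial s.elem j (weakLaplacian s.elem w')) x := by
    intro j
    rw [weakPartial_congr (weakLaplacian_sub_ae hU (hw.of_le (by norm_num))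
      (hw'.of_le (by norm_num))), s.tr_congr (weakPartial_sub_ae hU (hL.of_le (by norm_num))
      (hL'.of_le (by norm_num)) j)]
    exact tr_sub hs (hL.weakPartial (m := 1) hU j) (hL'.weakPartial (m := 1) hU j)
  filter_upwards [h 0, h 1] with x h0 h1
  simp only [trLapNormal, Fin.sum_univ_two, h0, h1]
  ring

end ElemSide

/-! ### Differences of averages and jumps. -/

section

variable {μ : Measure Plane} {q q₁ q₂ : ElemSide → Plane → ℝ} {s t : ElemSide}

theorem sideAverage_sub (hs : ∀ᵐ x ∂μ, q s x = q₁ s x - q₂ s x)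
    (ht : ∀ᵐ x ∂μ, q t x = q₁ t x - q₂ t x) :
    ∀ᵐ x ∂μ, sideAverage q s t x = sideAverage q₁ s t x - sideAverage q₂ s t x := by
  filter_upwards [hs, ht] with x h1 h2
  simp only [sideAverage, h1, h2]
  ring

theorem sideJump_sub (hs : ∀ᵐ x ∂μ, q s x = q₁ s x - q₂ s x)
    (ht : ∀ᵐ x ∂μ, q t x = q₁ t x - q₂ t x) :
    ∀ᵐ x ∂μ, sideJump q s t x = sideJump q₁ s t x - sideJump q₂ s t x := by
  filter_upwards [hs, ht] with x h1 h2
  simp only [sideJump, h1, h2]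
  ring

theorem memLp_sideAverage (hs : MemLp (q s) 2 μ) (ht : MemLp (q t) 2 μ) :
    MemLp (sideAverage q s t) 2 μ := by
  have h := (hs.add ht).const_mul (1 / 2 : ℝ)
  refine h.congr_norm ?_ (Eventually.of_forall fun x => ?_)
  · exact ((hs.1.add ht.1).mul_const (2 : ℝ)⁻¹).congr
      (Eventually.of_forall fun x => by simp [sideAverage, div_eq_mul_inv])
  · simp only [sideAverage, Pi.add_apply]
    congr 1
    ring

theorem memLp_sideJump (hs : MemLp (q s) 2 μ) (ht : MemLp (q t) 2 μ) :
    MemLp (sideJump q s t) 2 μ := ht.sub hs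

theorem memLp_bdJump {b : ElemSide → Plane → ℝ} (hb : MemLp (b s) 2 μ) (hq : MemLp (q s) 2 μ) :
    MemLp (bdJump b q s) 2 μ := hb.sub hq

/-- Both functions are taken with the same data `b`, which cancel; the difference carries the data
zero. -/
theorem bdJump_sub {b : ElemSide → Plane → ℝ} (hs : IsElementMap s.1)
    (hq : ∀ᵐ x ∂s.len, q s x = q₁ s x - q₂ s x) :
    ∀ᵐ x ∂s.len, bdJump (·.tr 0) q s x = bdJump b q₁ s x - bdJump b q₂ s x := by
  filter_upwards [hq, ElemSide.tr_zero_ae hs] with x h1 h2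
  simp only [bdJump, h1, h2]
  ring

theorem mul_sub_ae {c a a₁ a₂ : Plane → ℝ} (h : ∀ᵐ x ∂μ, a x = a₁ x - a₂ x) :
    ∀ᵐ x ∂μ, c x * a x = c x * a₁ x - c x * a₂ x := by
  filter_upwards [h] with x hx
  rw [hx, mul_sub]

end

section

variable {s t : ElemSide} {w w' h : Plane → ℝ}

/-- Integrals are additive only for integrable functions, so all factors must be in `L²` of the
side. For the penalty term this is the hypothesis `hh`, supplied by the lower bound on the mesh
size. -/
theorem innerGradTerm_sub (hs : IsElementMap s.1) (ht : IsElementMap t.1) (hst : s.len = t.len)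
    (hws : MemSobolev 4 s.elem w) (hws' : MemSobolev 4 s.elem w')
    (hwt : MemSobolev 4 t.elem w) (hwt' : MemSobolev 4 t.elem w')
    (hh : ∀ a, MemLp a 2 s.len → MemLp (fun x => (h x)⁻¹ * a x) 2 s.len) (γ₁ : ℝ)
    (v : Plane → ℝ) : innerGradTerm γ₁ h (w - w') v s t =
      innerGradTerm γ₁ h w v s t - innerGradTerm γ₁ h w' v s t := by
  rw [innerGradTerm, innerGradTerm, innerGradTerm, ← Finset.sum_sub_distrib]
  refine Finset.sum_congr rfl fun i _ => ?_
  have hA := fun w => memLp_sideAverage (q := (·.trHessNormal s.normal i w))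
    (ElemSide.memLp_trHessNormal hs rfl i w) (ElemSide.memLp_trHessNormal hs hst i w)
  have hJ := fun w => memLp_sideJump (μ := s.len) (q := (·.trGrad i w)) (s.memLp_trGrad i w)
    (hst ▸ t.memLp_trGrad i w)
  have dA := sideAverage_sub (q := (·.trHessNormal s.normal i (w - w')))
    (q₁ := (·.trHessNormal s.normal i w)) (q₂ := (·.trHessNormal s.normal i w'))
    (ElemSide.trHessNormal_sub hs (hws.of_le (by norm_num)) (hws'.of_le (by norm_num)) s.normal i)
    (hst ▸ ElemSide.trHessNormal_sub ht (hwt.of_le (by norm_num)) (hwt'.of_le (by norm_num))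
      s.normal i)
  have dJ := sideJump_sub (q := (·.trGrad i (w - w')))
    (q₁ := (·.trGrad i w)) (q₂ := (·.trGrad i w'))
    (ElemSide.trGrad_sub hs (hws.of_le (by norm_num)) (hws'.of_le (by norm_num)) i)
    (hst ▸ ElemSide.trGrad_sub ht (hwt.of_le (by norm_num)) (hwt'.of_le (by norm_num)) i)
  rw [ElemSide.inner_sub_left dA (hA w) (hA w') (hJ v),
    ElemSide.inner_sub_right dJ (hJ w) (hJ w') (hA v),
    ElemSide.inner_sub_left (mul_sub_ae dJ) (hh _ (hJ w)) (hh _ (hJ w')) (hJ v)]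
  ring

theorem innerValueTerm_sub (hs : IsElementMap s.1) (ht : IsElementMap t.1) (hst : s.len = t.len)
    (hws : MemSobolev 4 s.elem w) (hws' : MemSobolev 4 s.elem w')
    (hwt : MemSobolev 4 t.elem w) (hwt' : MemSobolev 4 t.elem w')
    (hh : ∀ a, MemLp a 2 s.len → MemLp (fun x => (h x ^ 3)⁻¹ * a x) 2 s.len) (γ₀ : ℝ)
    (v : Plane → ℝ) : innerValueTerm γ₀ h (w - w') v s t =
      innerValueTerm γ₀ h w v s t - innerValueTerm γ₀ h w' v s t := by
  rw [innerValueTerm, innerValueTerm, innerValueTerm]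
  have hA := fun w => memLp_sideAverage (q := (·.trLapNormal s.normal w))
    (ElemSide.memLp_trLapNormal hs rfl w) (ElemSide.memLp_trLapNormal hs hst w)
  have hJ := fun w => memLp_sideJump (μ := s.len) (q := (·.tr w)) (s.memLp_tr w)
    (hst ▸ t.memLp_tr w)
  have dA := sideAverage_sub (q := (·.trLapNormal s.normal (w - w')))
    (q₁ := (·.trLapNormal s.normal w)) (q₂ := (·.trLapNormal s.normal w'))
    (ElemSide.trLapNormal_sub hs hws hws' s.normal)
    (hst ▸ ElemSide.trLapNormal_sub ht hwt hwt' s.normal)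
  have dJ := sideJump_sub (q := (·.tr (w - w'))) (q₁ := (·.tr w)) (q₂ := (·.tr w'))
    (ElemSide.tr_sub hs (hws.of_le (by norm_num)) (hws'.of_le (by norm_num)))
    (hst ▸ ElemSide.tr_sub ht (hwt.of_le (by norm_num)) (hwt'.of_le (by norm_num)))
  rw [ElemSide.inner_sub_left dA (hA w) (hA w') (hJ v),
    ElemSide.inner_sub_right dJ (hJ w) (hJ w') (hA v),
    ElemSide.inner_sub_left (mul_sub_ae dJ) (hh _ (hJ w)) (hh _ (hJ w')) (hJ v)]
  ring

theorem bdGradTerm_sub (hs : IsElementMap s.1)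
    (hw : MemSobolev 4 s.elem w) (hw' : MemSobolev 4 s.elem w')
    (hh : ∀ a, MemLp a 2 s.len → MemLp (fun x => (h x)⁻¹ * a x) 2 s.len) (γ₁ : ℝ)
    (a b : BdData) (v : Plane → ℝ) : bdGradTerm γ₁ h 0 (w - w') b v s =
      bdGradTerm γ₁ h a w b v s - bdGradTerm γ₁ h a w' b v s := by
  rw [bdGradTerm, bdGradTerm, bdGradTerm, ← Finset.sum_sub_distrib]
  refine Finset.sum_congr rfl fun i _ => ?_
  have hA := fun w => ElemSide.memLp_trHessNormal hs rfl i w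
  have hJ := fun (a : BdData) w => memLp_bdJump (μ := s.len) (b := (·.tr (a.2 i)))
    (q := (·.trGrad i w)) (s.memLp_tr _) (s.memLp_trGrad i w)
  have dA := ElemSide.trHessNormal_sub hs (hw.of_le (by norm_num)) (hw'.of_le (by norm_num))
    s.normal i
  have dJ := bdJump_sub (b := (·.tr (a.2 i))) (q := (·.trGrad i (w - w')))
    (q₁ := (·.trGrad i w)) (q₂ := (·.trGrad i w')) hs
    (ElemSide.trGrad_sub hs (hw.of_le (by norm_num)) (hw'.of_le (by norm_num)) i)
  have e : (0 : BdData).2 i = 0 := rfl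
  rw [e, ElemSide.inner_sub_left dA (hA w) (hA w') (hJ b v),
    ElemSide.inner_sub_right dJ (hJ a w) (hJ a w') (hA v),
    ElemSide.inner_sub_left (mul_sub_ae dJ) (hh _ (hJ a w)) (hh _ (hJ a w')) (hJ b v)]
  ring

theorem bdValueTerm_sub (hs : IsElementMap s.1)
    (hw : MemSobolev 4 s.elem w) (hw' : MemSobolev 4 s.elem w')
    (hh : ∀ a, MemLp a 2 s.len → MemLp (fun x => (h x ^ 3)⁻¹ * a x) 2 s.len) (γ₀ : ℝ)
    (a b : BdData) (v : Plane → ℝ) : bdValueTerm γ₀ h 0 (w - w') b v s =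
      bdValueTerm γ₀ h a w b v s - bdValueTerm γ₀ h a w' b v s := by
  rw [bdValueTerm, bdValueTerm, bdValueTerm]
  have hA := fun w => ElemSide.memLp_trLapNormal hs rfl w
  have hJ := fun (a : BdData) w => memLp_bdJump (μ := s.len) (b := (·.tr a.1))
    (q := (·.tr w)) (s.memLp_tr _) (s.memLp_tr w)
  have dA := ElemSide.trLapNormal_sub hs hw hw' s.normal
  have dJ := bdJump_sub (b := (·.tr a.1)) (q := (·.tr (w - w')))
    (q₁ := (·.tr w)) (q₂ := (·.tr w')) hs
    (ElemSide.tr_sub hs (hw.of_le (by norm_num)) (hw'.of_le (by norm_num)))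
  have e : (0 : BdData).1 = 0 := rfl
  rw [e, ElemSide.inner_sub_left dA (hA w) (hA w') (hJ b v),
    ElemSide.inner_sub_right dJ (hJ a w) (hJ a w') (hA v),
    ElemSide.inner_sub_left (mul_sub_ae dJ) (hh _ (hJ a w)) (hh _ (hJ a w')) (hJ b v)]
  ring

end

theorem IsElementMap.diam_openSide_pos {p : PolyPair} (hp : IsElementMap p) (j : Fin 3) :
    0 < Metric.diam (openSide p j) := by
  refine Metric.diam_pos ?_ ((isCompact_side p j).isBounded.subset (openSide_subset_side p j))
  have h1 : (1 / 3 : ℝ) ∈ Set.Ioo (0 : ℝ) 1 := by norm_num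
  have h2 : (1 / 2 : ℝ) ∈ Set.Ioo (0 : ℝ) 1 := by norm_num
  refine ⟨_, ⟨_, h1, rfl⟩, _, ⟨_, h2, rfl⟩, fun h => ?_⟩
  have := refSide_injective j (hp.1 (refSide_mem (Set.Ioo_subset_Icc_self h1) j)
    (refSide_mem (Set.Ioo_subset_Icc_self h2) j) h)
  norm_num at this

namespace IsoMesh

variable {k : ℕ} {P : FoldedPlate} (M : IsoMesh k P)

/-- On a fixed side `h` is bounded below by a positive multiple of the diameter, so the weight
`h^{-m}` is bounded. -/
theorem IsMeshSize.memLp_mul {M : IsoMesh k P} {h : Plane → ℝ} (hh : M.IsMeshSize h) {s : M.Side}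
    (hs : (M.el s).openSet ⊆ P.Ω ∨ (M.el s).openSet ⊆ P.D) (m : ℕ) {a : Plane → ℝ}
    (ha : MemLp a 2 (M.el s).len) : MemLp (fun x => (h x ^ m)⁻¹ * a x) 2 (M.el s).len := by
  obtain ⟨hm, c, C, hc, hb⟩ := hh
  have hd : 0 < c * Metric.diam (M.el s).openSet :=
    mul_pos hc ((M.isElementMap s.1).diam_openSide_pos s.2)
  refine ha.mul_of_ae_bound (C := ((c * Metric.diam (M.el s).openSet) ^ m)⁻¹)
    (hm.pow_const m).inv.aestronglyMeasurable ?_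
  filter_upwards [hb s hs] with x hx
  rw [abs_of_nonneg (inv_nonneg.2 (pow_nonneg (hd.le.trans hx.1) m))]
  exact inv_anti₀ (pow_pos hd m) (pow_le_pow_left₀ hd.le hx.1 m)

-- For equal data `a` the form is affine in its first argument, so that a difference is governed by
-- the linear part, which is the form with data zero.
open Classical in
theorem dgForm_sub {h : Plane → ℝ} (hh : M.IsMeshSize h) {w w' v : Plane → ℝ}
    (hw : ∀ T, MemSobolev 4 (openElement (M.ψ T)) w)
    (hw' : ∀ T, MemSobolev 4 (openElement (M.ψ T)) w')
    (hv : ∀ T, MemSobolev 2 (openElement (M.ψ T)) v) (γ₀ γ₁ : ℝ) (a b : BdData) :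
    M.dgForm γ₀ γ₁ h 0 (w - w') b v =
      M.dgForm γ₀ γ₁ h a w b v - M.dgForm γ₀ γ₁ h a w' b v := by
  have hvol : ∀ T, ∫ x in openElement (M.ψ T), ∑ i, ∑ j,
        weakHess (openElement (M.ψ T)) i j (w - w') x * weakHess (openElement (M.ψ T)) i j v x =
      (∫ x in openElement (M.ψ T), ∑ i, ∑ j,
        weakHess (openElement (M.ψ T)) i j w x * weakHess (openElement (M.ψ T)) i j v x) -
      ∫ x in openElement (M.ψ T), ∑ i, ∑ j,
        weakHess (openElement (M.ψ T)) i j w' x * weakHess (openElement (M.ψ T)) i j v x := by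
    intro T
    have hU := (M.isElementMap T).isOpen_openElement
    have hint : ∀ {w : Plane → ℝ}, MemSobolev 4 (openElement (M.ψ T)) w → Integrable
        (fun x => ∑ i, ∑ j, weakHess (openElement (M.ψ T)) i j w x *
          weakHess (openElement (M.ψ T)) i j v x) (volume.restrict (openElement (M.ψ T))) :=
      fun hw => integrable_finsetSum _ fun i _ => integrable_finsetSum _ fun j _ =>
        integrable_mul_of_memLp_two (hw.weakHess (m := 2) hU i j).memLp
          ((hv T).weakHess (m := 0) hU i j).memLp
    rw [← integral_sub (hint (hw T)) (hint (hw' T))]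
    refine integral_congr_ae ?_
    have hd := weakHess_sub_ae hU ((hw T).of_le (by norm_num : 2 ≤ 4))
      ((hw' T).of_le (by norm_num))
    filter_upwards [hd 0 0, hd 0 1, hd 1 0, hd 1 1] with x h1 h2 h3 h4
    simp only [Fin.sum_univ_two, h1, h2, h3, h4, Pi.sub_apply]
    ring
  have h1 := fun {s : M.Side} (hs : (M.el s).openSet ⊆ P.Ω ∨ (M.el s).openSet ⊆ P.D)
    (a : Plane → ℝ) (ha : MemLp a 2 (M.el s).len) => by simpa only [pow_one] using hh.memLp_mul hs 1 ha
  have h3 := fun {s : M.Side} (hs : (M.el s).openSet ⊆ P.Ω ∨ (M.el s).openSet ⊆ P.D)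
    (a : Plane → ℝ) (ha : MemLp a 2 (M.el s).len) => hh.memLp_mul hs 3 ha
  have hinner : ∀ {e}, e ∈ M.innerSides → (M.el e.1).openSet ⊆ P.Ω ∨ (M.el e.1).openSet ⊆ P.D :=
    fun he => Or.inl (M.openSet_subset_of_mem_innerSides he)
  have hgrad : ∀ e ∈ M.innerSides, innerGradTerm γ₁ h (w - w') v (M.el e.1) (M.el e.2) =
      innerGradTerm γ₁ h w v (M.el e.1) (M.el e.2) -
        innerGradTerm γ₁ h w' v (M.el e.1) (M.el e.2) := fun e he =>
    innerGradTerm_sub (M.isElementMap _) (M.isElementMap _) (M.len_eq (M.mem_innerSides.1 he).2)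
      (hw e.1.1) (hw' e.1.1) (hw e.2.1) (hw' e.2.1) (h1 (hinner he)) γ₁ v
  have hvalue : ∀ e ∈ M.innerSides, innerValueTerm γ₀ h (w - w') v (M.el e.1) (M.el e.2) =
      innerValueTerm γ₀ h w v (M.el e.1) (M.el e.2) -
        innerValueTerm γ₀ h w' v (M.el e.1) (M.el e.2) := fun e he =>
    innerValueTerm_sub (M.isElementMap _) (M.isElementMap _) (M.len_eq (M.mem_innerSides.1 he).2)
      (hw e.1.1) (hw' e.1.1) (hw e.2.1) (hw' e.2.1) (h3 (hinner he)) γ₀ v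
  have hbd : ∀ s ∈ M.clampedSides, bdGradTerm γ₁ h 0 (w - w') b v (M.el s) +
      bdValueTerm γ₀ h 0 (w - w') b v (M.el s) =
      (bdGradTerm γ₁ h a w b v (M.el s) + bdValueTerm γ₀ h a w b v (M.el s)) -
      (bdGradTerm γ₁ h a w' b v (M.el s) + bdValueTerm γ₀ h a w' b v (M.el s)) := by
    intro s hs
    have hsD := Or.inr (a := (M.el s).openSet ⊆ P.Ω) (M.mem_clampedSides.1 hs)
    have e1 := bdGradTerm_sub (s := M.el s) (M.isElementMap s.1) (hw s.1) (hw' s.1) (h1 hsD) γ₁ a b v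
    have e2 := bdValueTerm_sub (s := M.el s) (M.isElementMap s.1) (hw s.1) (hw' s.1) (h3 hsD) γ₀
      a b v
    rw [e1, e2]
    ring
  have sgrad := (Finset.sum_congr (s₁ := M.innerSides \ M.interfaceSides) rfl fun e he =>
    hgrad e (Finset.mem_sdiff.1 he).1).trans (Finset.sum_sub_distrib _ _)
  have svalue := (Finset.sum_congr rfl hvalue).trans (Finset.sum_sub_distrib _ _)
  have sbd := (Finset.sum_congr rfl hbd).trans (Finset.sum_sub_distrib _ _)
  have svol := (Finset.sum_congr (s₁ := Finset.univ) rfl fun T _ => hvol T).trans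
    (Finset.sum_sub_distrib _ _)
  unfold dgForm
  rw [svol, sgrad, svalue, sbd]
  ring

end IsoMesh

end

theorem mainTheorem4 (k : ℕ) (P : FoldedPlate) (M : IsoMesh k P)
    (γ₀ γ₁ : ℝ) (h : Plane → ℝ) (hh : M.IsMeshSize h)
    (f : Plane → ℝ) (hf : MemLp f 2 (volume.restrict P.Ω))
    (g : Plane → ℝ) (hg : MemSobolev 1 P.Ω g)
    (Φ : Fin 2 → Plane → ℝ) (hΦ : ∀ i, MemSobolev 1 P.Ω (Φ i))
    (u : Plane → ℝ) (hu : P.IsStrongSolution f g Φ u)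
    (hu4 : MemSobolev 4 (P.Ω₁ ∪ P.Ω₂) u) (hu1 : MemSobolev 1 P.Ω u)
    (u_h : Plane → ℝ) (huh : M.IsDiscreteSolution γ₀ γ₁ h f g Φ u_h) :
    ∀ v ∈ M.discreteSpace, M.dgForm γ₀ γ₁ h 0 (u - u_h) 0 v = 0 := by
  intro v hv
  rw [M.dgForm_sub hh (fun T => hu4.mono (M.openElement_subset_union T))
    (M.memSobolev_of_mem_discreteSpace huh.1 4) (M.memSobolev_of_mem_discreteSpace hv 2)
    γ₀ γ₁ (g, Φ) 0, M.consistency hf hu hu4 γ₀ γ₁ h hv, huh.2 v hv, sub_self]
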